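/- Let $k$ be a field of characteristic $0$, let $\mathbf{GL}=\bigcup_{n\ge 1}\mathrm{GL}_n(k)$ (a discrete group), and let $\mathbf{V}=\bigcup_{n\ge1}k^n$ be its standard representation. A representation of $\mathbf{GL}$ over $k$ is *polynomial* if it is a subquotient of a (possibly infinite) direct sum of tensor powers of $\mathbf V$; an element of a representation is *polynomial* if the subrepresentation it generates is polynomial. For a tuple $\underline\lambda=[\lambda_1,\dots,\lambda_r]$ of partitions put $k^{\oplus\underline\lambda}=\bigoplus_{i=1}^r \mathbf S_{\lambda_i}(\mathbf V)$, where $\mathbf S_\lambda$ denotes the Schur functor, and for a $k$-algebra $B$ with an action of $\mathbf{GL}$ by $k$-algebra automorphisms put $B^{\oplus\underline\lambda}=B\otimes_k k^{\oplus\underline\lambda}$ with the diagonal action of $\mathbf{GL}$. (a) Let $A$ be a $k$-algebra that is an integral domain, let $\underline\sigma$ be a tuple of partitions, and let $R=A\otimes_k \mathrm{Sym}(k^{\oplus\underline\sigma})$, with $\mathbf{GL}$ acting trivially on $A$. Let $M$ be a torsion-free $R$-module with a compatible (semilinear) action of $\mathbf{GL}$ under which $M$ is a polynomial representation, and suppose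 that $M$ is generated as an $R$-module by the $\mathbf{GL}$-orbits of finitely many elements. Then there are a tuple $\underline\mu$ of partitions and an injective $\mathbf{GL}$-equivariant $R$-linear map $M\to R^{\oplus\underline\mu}$. (b) Let $\underline\sigma$ be a tuple of partitions and let $K=\mathrm{Frac}(\mathrm{Sym}(k^{\oplus\underline\sigma}))$ with the induced action of $\mathbf{GL}$. Let $M$ be a $K$-vector space with a semilinear action of $\mathbf{GL}$ such that every element of $M$ has the form $ax$ with $a\in K$ and $x\in M$ polynomial, and suppose that $M$ is generated over $K$ by the $\mathbf{GL}$-orbits of finitely many elements. Then there are a tuple $\underline\lambda$ of partitions and an injective $\mathbf{GL}$-equivariant $K$-linear map $M\to K^{\oplus\underline\lambda}$. -/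

import Mathlib

open scoped TensorProduct DirectSum

noncomputable section

namespace GLEmbed

universe u v w

/-- The infinite general linear group `⋃ₙ GLₙ(k)`, as a group of automorphisms of
`𝐕 = ⋃ₙ kⁿ = (ℕ →₀ k)`: the automorphisms fixing all but finitely many standard basis vectors `eᵢ`.
(If `g` fixes `eᵢ` for `i ≥ n` and `N ≥ n` bounds the supports of `g e₀, …, g eₙ₋₁`, then `g`
preserves `k^N` and fixes `eᵢ` for `i ≥ N`, that is, it is a block matrix in `GL_N(k)`.) -/
def GLInf (k : Type u) [Field k] : Subgroup ((ℕ →₀ k) ≃ₗ[k] (ℕ →₀ k)) where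
  carrier := {g | ∃ n : ℕ, ∀ i, n ≤ i → g (Finsupp.single i 1) = Finsupp.single i 1}
  one_mem' := ⟨0, fun _ _ => rfl⟩
  mul_mem' := by
    rintro g h ⟨n, hn⟩ ⟨m, hm⟩
    refine ⟨max n m, fun i hi => ?_⟩
    rw [LinearEquiv.mul_apply, hm i (le_trans (le_max_right _ _) hi),
      hn i (le_trans (le_max_left _ _) hi)]
  inv_mem' := by
    rintro g ⟨n, hn⟩
    refine ⟨n, fun i hi => ?_⟩
    conv_lhs => rw [← hn i hi]
    exact g.symm_apply_apply _

section Polynomial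

variable (k : Type u) [Field k]

/-- The standard representation `𝐕` of `GL`. -/
def stdRep : Representation k (GLInf k) (ℕ →₀ k) where
  toFun g := (g : (ℕ →₀ k) ≃ₗ[k] (ℕ →₀ k)).toLinearMap
  map_one' := rfl
  map_mul' _ _ := rfl

/-- The tensor power `𝐕^{⊗ I}` with the diagonal action of `GL`. -/
def tensorRep (I : Type v) : Representation k (GLInf k) (⨂[k] _ : I, (ℕ →₀ k)) where
  toFun g := PiTensorProduct.map fun _ => stdRep k g
  map_one' := by simp only [map_one]; exact PiTensorProduct.map_one
  map_mul' g h := by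
    simp only [map_mul]
    exact PiTensorProduct.map_mul (fun _ => stdRep k g) (fun _ => stdRep k h)

variable {k}

/-- A representation of `GL` is polynomial if it is a subquotient of a (possibly infinite) direct
sum of tensor powers of `𝐕`, that is, a quotient of a subrepresentation `N` of such a sum.
(Index sets in the universe of `M` suffice.) -/
def IsPolynomial {M : Type w} [AddCommMonoid M] [Module k M]
    (ρ : Representation k (GLInf k) M) : Prop :=
  ∃ (J : Type w) (d : J → ℕ)
    (N : Subrepresentation (Representation.directSum fun j : J => tensorRep k (Fin (d j))))
    (q : Representation.IntertwiningMap N.toRepresentation ρ), Function.Surjective q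

/-- The subrepresentation generated by an element. -/
def orbitSpan {M : Type w} [AddCommMonoid M] [Module k M]
    (ρ : Representation k (GLInf k) M) (x : M) : Subrepresentation ρ where
  toSubmodule := Submodule.span k (Set.range fun g => ρ g x)
  apply_mem_toSubmodule g v hv := by
    have h : Submodule.span k (Set.range fun g => ρ g x) ≤
        (Submodule.span k (Set.range fun g => ρ g x)).comap (ρ g) := by
      refine Submodule.span_le.2 ?_
      rintro _ ⟨h, rfl⟩
      refine Submodule.subset_span ⟨g * h, ?_⟩
      simp
    exact h hv

/-- An element is polynomial if the subrepresentation it generates is polynomial. -/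
def IsPolynomialElement {M : Type w} [AddCommMonoid M] [Module k M]
    (ρ : Representation k (GLInf k) M) (x : M) : Prop :=
  IsPolynomial (orbitSpan ρ x).toRepresentation

end Polynomial

section Schur

variable (k : Type u) [Field k]

/-- A permutation of the tensor factors, as a `GL`-equivariant map. -/
def permMap (I : Type v) (p : Equiv.Perm I) :
    Representation.IntertwiningMap (tensorRep k I) (tensorRep k I) where
  toLinearMap := (PiTensorProduct.reindex k (fun _ : I => (ℕ →₀ k)) p).toLinearMap
  isIntertwining' g := by
    exact (PiTensorProduct.map_comp_reindex_eq (fun _ : I => stdRep k g) p).symm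

/-- Symmetrization along the rows of a Young diagram, on the tensor power of `𝐕` whose factors
are indexed by the cells. -/
def rowSymmetrizer (l : YoungDiagram) :
    Representation.IntertwiningMap (tensorRep k l.cells) (tensorRep k l.cells) :=
  ∑ p : Equiv.Perm l.cells with ∀ c, (p c).1.1 = c.1.1, permMap k l.cells p

/-- Antisymmetrization along the columns of a Young diagram. -/
def columnAntisymmetrizer (l : YoungDiagram) :
    Representation.IntertwiningMap (tensorRep k l.cells) (tensorRep k l.cells) :=
  ∑ p : Equiv.Perm l.cells with ∀ c, (p c).1.2 = c.1.2,
    ((Equiv.Perm.sign p : ℤ) : k) • permMap k l.cells p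

/-- `𝐒_λ(𝐕)`, the image of the Young symmetrizer of `λ` on `𝐕^{⊗|λ|}`, as a subrepresentation. -/
def schur (l : YoungDiagram) : Subrepresentation (tensorRep k l.cells) :=
  ((columnAntisymmetrizer k l).comp (rowSymmetrizer k l)).range

/-- `k^{⊕λ}` for a tuple of partitions `λ = [λ₁, …, λᵣ]`: the direct sum of the `𝐒_{λᵢ}(𝐕)`. -/
def TupleSpace {r : ℕ} (l : Fin r → YoungDiagram) : Type u :=
  ⨁ i, (schur k (l i)).toSubmodule

instance {r : ℕ} (l : Fin r → YoungDiagram) : AddCommMonoid (TupleSpace k l) :=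
  inferInstanceAs (AddCommMonoid (⨁ i, (schur k (l i)).toSubmodule))

instance {r : ℕ} (l : Fin r → YoungDiagram) : Module k (TupleSpace k l) :=
  inferInstanceAs (Module k (⨁ i, (schur k (l i)).toSubmodule))

instance {r : ℕ} (l : Fin r → YoungDiagram) : AddCommGroup (TupleSpace k l) :=
  Module.addCommMonoidToAddCommGroup k

/-- The action of `GL` on `k^{⊕λ}`. -/
def tupleRep {r : ℕ} (l : Fin r → YoungDiagram) :
    Representation k (GLInf k) (TupleSpace k l) :=
  Representation.directSum fun i => (schur k (l i)).toRepresentation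

end Schur

section Actions

variable {k : Type u} [Field k]

/-- The action of a group on `Sym(V)` by algebra automorphisms induced by a representation `V`. -/
def symAction {G : Type v} [Group G] {V : Type w} [AddCommGroup V] [Module k V]
    (ρ : Representation k G V) :
    G →* (SymmetricAlgebra k V ≃ₐ[k] SymmetricAlgebra k V) :=
  (AlgEquiv.algHomUnitsEquiv k (SymmetricAlgebra k V)).toMonoidHom.comp
    (MonoidHom.toHomUnits
      { toFun := fun g => SymmetricAlgebra.lift (SymmetricAlgebra.ι k V ∘ₗ ρ g)
        map_one' := by
          ext x
          simp
        map_mul' := fun g h => by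
          ext x
          simp })

/-- The ring `A ⊗ Sym(k^{⊕σ})`. -/
abbrev PolyRing (A : Type v) [CommRing A] [Algebra k A] {r : ℕ} (s : Fin r → YoungDiagram) :
    Type (max u v) :=
  A ⊗[k] SymmetricAlgebra k (TupleSpace k s)

/-- The action of `GL` on `A ⊗ Sym(k^{⊕σ})`, trivial on `A`. -/
def polyRingAction (A : Type v) [CommRing A] [Algebra k A] {r : ℕ} (s : Fin r → YoungDiagram) :
    GLInf k →* (PolyRing (k := k) A s ≃ₐ[k] PolyRing (k := k) A s) where
  toFun g := Algebra.TensorProduct.congr AlgEquiv.refl (symAction (tupleRep k s) g)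
  map_one' := by
    rw [map_one]
    exact Algebra.TensorProduct.congr_refl
  map_mul' g h := by
    rw [map_mul]
    apply AlgEquiv.coe_toAlgHom_injective
    ext x <;> simp

variable (k) in
/-- The rational `GL`-field `Frac(Sym(k^{⊕σ}))`. -/
abbrev RatField {r : ℕ} (s : Fin r → YoungDiagram) : Type u :=
  FractionRing (SymmetricAlgebra k (TupleSpace k s))

variable (k) in
/-- The action of `GL` on `Frac(Sym(k^{⊕σ}))` extending the one on `Sym(k^{⊕σ})`. -/
def ratFieldAction {r : ℕ} (s : Fin r → YoungDiagram) :
    GLInf k →* (RatField k s ≃ₐ[k] RatField k s) :=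
  (IsFractionRing.fieldEquivOfAlgEquivHom k (RatField k s)).comp (symAction (tupleRep k s))

end Actions

section Modules

variable {k : Type u} [Field k] {B : Type v} [CommRing B] [Algebra k B]
  (α : GLInf k →* (B ≃ₐ[k] B))
  {M : Type w} [AddCommMonoid M] [Module k M] [Module B M]

/-- Compatibility of an action of `GL` on a `B`-module with the action `α` on `B`. -/
def IsSemilinear (ρ : Representation k (GLInf k) M) : Prop :=
  ∀ (g : GLInf k) (b : B) (m : M), ρ g (b • m) = α g b • ρ g m

/-- `M` is a module over the `GL`-algebra `(B, α)`: the action on `M` is compatible with the one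
on `B` and makes `M` a polynomial representation. -/
structure IsGLModule (ρ : Representation k (GLInf k) M) : Prop where
  semilinear : IsSemilinear α ρ
  polynomial : IsPolynomial ρ

/-- `M` is a module over the `GL`-field `(B, α)`: a semilinear representation in which every
element is a scalar multiple of a polynomial element. -/
structure IsGLFieldModule (ρ : Representation k (GLInf k) M) : Prop where
  semilinear : IsSemilinear α ρ
  polynomial : ∀ m : M, ∃ (b : B) (x : M), IsPolynomialElement ρ x ∧ m = b • x

variable (B) in
/-- `M` is generated as a `B`-module by the `GL`-orbits of finitely many elements. -/
def IsFinitelyGLGenerated (ρ : Representation k (GLInf k) M) : Prop :=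
  ∃ S : Finset M, Submodule.span B {y : M | ∃ g, ∃ x ∈ S, y = ρ g x} = ⊤

/-- The diagonal action of `GL` on `B^{⊕μ} = B ⊗ k^{⊕μ}`. -/
def freeRep {r : ℕ} (l : Fin r → YoungDiagram) :
    Representation k (GLInf k) (B ⊗[k] TupleSpace k l) where
  toFun g := TensorProduct.map (α g).toLinearMap (tupleRep k l g)
  map_one' := by
    ext
    simp
  map_mul' g h := by
    ext
    simp

/-- There are a tuple `μ` and an injective, `GL`-equivariant, `B`-linear map `M → B^{⊕μ}`. -/
def EmbedsInFree (ρ : Representation k (GLInf k) M) : Prop :=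
  ∃ (r : ℕ) (l : Fin r → YoungDiagram) (j : M →ₗ[B] B ⊗[k] TupleSpace k l),
    Function.Injective j ∧ ∀ (g : GLInf k) (m : M), j (ρ g m) = freeRep α l g (j m)

end Modules

end GLEmbed

end

/-!
The proof uses the following properties of the coefficient ring `R = A ⊗ Sym(k^{⊕σ})`: it is a
domain, the one-parameter unipotent subgroups `1 + t η` of `GL` act by polynomials in `t`, every
element is fixed by the group elements fixing sufficiently many basis vectors `eᵢ` of `𝐕`
(`IsAlgebraicAction`), and the shift of coordinates `eᵢ ↦ e_{i+n}` splits off (`IsShiftable`).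

*Reduction to images of tensor powers.* An element of a subrepresentation `N` of a sum of tensor
powers lies in the span of the images of equivariant maps from tensor powers into `N`: the part of
top degree is extracted as a limit of `t^d (1 + t⁻¹ η)`, and polarization with the help of far away
basis vectors turns it into equivariant maps (`sum_range_mem_equivariantSpan`). Hence a module
generated by finitely many polynomial orbits is the `R`-span of the images of finitely many
equivariant maps `f : 𝐕^{⊗e} → M`.

*Generic freeness.* By induction on the maximal degree `d` of these maps, `M` embeds into a finite
sum of modules `R ⊗ 𝐕^{⊗e}`, equivariantly for the subgroup of `GL` acting on the coordinates from
some `n` on (`separated_genSpan`). Modulo lower degree, the relations between the values of the maps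
of degree `d` at tensors of basis vectors have coefficients in the invariant ring, and are governed
by a single subspace of the finite-dimensional space of coefficient vectors, which stabilizes for
large `n`. A projection onto it, averaged over `S_d` and with denominators cleared, splits off the
part of degree `d`, where `M` becomes a submodule of a sum of copies of `R ⊗ 𝐕^{⊗d}`; what is left
over has lower degree for the smaller group, because `𝐕` is the sum of a trivial representation and
of a copy of `𝐕` for this group.

*Return to the full group.* Shifting the coordinates by `n` identifies `GL` with the smaller group,
so that composing the embedding with the shift of `M` gives a `GL`-equivariant map. It is made
`R`-linear by a homomorphism `δ : R → R ⊗ S` that sends shifted elements `r` to `r ⊗ 1`, at the cost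
of tensoring the target with the `GL`-representation `S`, which again embeds into sums of tensor
powers (`exists_equivariant_family`); finite generation leaves finitely many of these.

*Schur functors.* Finally `𝐕^{⊗d}` embeds into a finite sum of Schur functors, as the Young
symmetrizers generate the unit ideal of the group algebra of `S_d`: a trace form on the group algebra
vanishing at all Young symmetrizers is zero, since the Young symmetrizers of different shapes are
orthogonal and there are as many shapes as conjugacy classes (`exists_schur_family`).

For part (b), the polynomial parts of the generators generate a lattice over `Sym(k^{⊕σ})`, and its
embedding extends to the vector space that it spans (`EmbedsInFree.of_lattice`).
-/

open Module
open scoped TensorProduct DirectSum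

set_option linter.unusedSectionVars false

noncomputable section

namespace GLEmbed

universe u v w

variable {k : Type u} [Field k]

/-! ### Polynomial functions of one parameter -/

section PolyFun

variable {X Y Z : Type*} [AddCommGroup X] [Module k X] [AddCommGroup Y] [Module k Y]
  [AddCommGroup Z] [Module k Z]

variable (k X) in
/-- The polynomial functions `k → X`: the combinations of the functions `t ↦ tⁱ x`. -/
def polyFuns : Submodule k (k → X) :=
  Submodule.span k {F | ∃ (i : ℕ) (x : X), F = fun t => t ^ i • x}

lemma monomial_mem_polyFuns (i : ℕ) (x : X) : (fun t : k => t ^ i • x) ∈ polyFuns k X :=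
  Submodule.subset_span ⟨i, x, rfl⟩

lemma const_mem_polyFuns (x : X) : (fun _ : k => x) ∈ polyFuns k X := by
  simpa using monomial_mem_polyFuns (k := k) 0 x

lemma polyFuns_map (f : X →ₗ[k] Y) {F : k → X} (hF : F ∈ polyFuns k X) :
    (fun t => f (F t)) ∈ polyFuns k Y := by
  induction hF using Submodule.span_induction with
  | mem F h =>
    obtain ⟨i, x, rfl⟩ := h
    simpa using monomial_mem_polyFuns i (f x)
  | zero => exact (by simpa using const_mem_polyFuns (k := k) (0 : Y))
  | add F G _ _ hF hG =>
    convert (polyFuns k Y).add_mem hF hG using 1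
    ext t
    simp
  | smul c F _ hF =>
    convert (polyFuns k Y).smul_mem c hF using 1
    ext t
    simp

lemma polyFuns_bilin (B : X →ₗ[k] Y →ₗ[k] Z) {F : k → X} {G : k → Y}
    (hF : F ∈ polyFuns k X) (hG : G ∈ polyFuns k Y) :
    (fun t => B (F t) (G t)) ∈ polyFuns k Z := by
  induction hF, hG using Submodule.span_induction₂ with
  | mem_mem F G h h' =>
    obtain ⟨i, x, rfl⟩ := h
    obtain ⟨j, y, rfl⟩ := h'
    convert monomial_mem_polyFuns (k := k) (i + j) (B x y) using 1
    ext t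
    rw [map_smul, map_smul, LinearMap.smul_apply, smul_smul, pow_add, mul_comm]
  | zero_left => simpa using const_mem_polyFuns (k := k) (0 : Z)
  | zero_right => simpa using const_mem_polyFuns (k := k) (0 : Z)
  | add_left F F' G _ _ _ h h' | add_right F G G' _ _ _ h h' =>
    convert (polyFuns k Z).add_mem h h' using 1
    ext t
    simp
  | smul_left c F G _ _ h | smul_right c F G _ _ h =>
    convert (polyFuns k Z).smul_mem c h using 1
    ext t
    simp

lemma polyFuns_sum {ι : Type*} (s : Finset ι) {F : ι → k → X}
    (hF : ∀ i ∈ s, F i ∈ polyFuns k X) : (fun t => ∑ i ∈ s, F i t) ∈ polyFuns k X := by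
  have := (polyFuns k X).sum_mem hF
  convert this using 1
  ext t
  simp

lemma polyFuns_multilinear {ι : Type*} [Fintype ι] (f : MultilinearMap k (fun _ : ι => X) Y)
    (v w : ι → X) : (fun t => f (fun i => v i + t • w i)) ∈ polyFuns k Y := by
  classical
  have : (fun t : k => f (fun i => v i + t • w i)) =
      fun t => ∑ s : Finset ι, t ^ (sᶜ).card • f (s.piecewise v w) := by
    ext t
    have h := f.map_add_univ v (fun i => t • w i)
    rw [show (fun i => v i + t • w i) = v + fun i => t • w i from rfl, h]
    refine Finset.sum_congr rfl fun s _ => ?_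
    have h2 := f.map_piecewise_smul (fun _ => t) (s.piecewise v w) sᶜ
    rw [Finset.prod_const] at h2
    rw [← h2]
    congr 1
    ext i
    by_cases hi : i ∈ s <;> simp [hi]
  rw [this]
  exact polyFuns_sum _ fun s _ => monomial_mem_polyFuns _ _

/-- A polynomial function with values in a subspace for `t ≠ 0` has its value at `0` there too. -/
lemma polyFuns_zero_mem [CharZero k] {F : k → X} (hF : F ∈ polyFuns k X) (N : Submodule k X)
    (h : ∀ t, t ≠ 0 → F t ∈ N) : F 0 ∈ N := by
  by_contra h0
  obtain ⟨φ, hφ, hN⟩ := Submodule.exists_le_ker_of_notMem h0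
  have hp : ∃ P : Polynomial k, ∀ t, φ (F t) = P.eval t := by
    clear h0 hφ h
    induction hF using Submodule.span_induction with
    | mem F h =>
      obtain ⟨i, x, rfl⟩ := h
      exact ⟨Polynomial.C (φ x) * Polynomial.X ^ i, fun t => by
        simp only [map_smul, smul_eq_mul, Polynomial.eval_mul, Polynomial.eval_C,
          Polynomial.eval_pow, Polynomial.eval_X]
        ring⟩
    | zero => exact ⟨0, by simp⟩
    | add F G _ _ hF hG =>
      obtain ⟨P, hP⟩ := hF
      obtain ⟨Q, hQ⟩ := hG
      exact ⟨P + Q, fun t => by simp [hP, hQ]⟩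
    | smul c F _ hF =>
      obtain ⟨P, hP⟩ := hF
      exact ⟨Polynomial.C c * P, fun t => by simp [hP]⟩
  obtain ⟨P, hP⟩ := hp
  have hX : Polynomial.X * P = 0 := by
    refine Polynomial.funext fun t => ?_
    by_cases ht : t = 0
    · simp [ht]
    · have : φ (F t) = 0 := hN (h t ht)
      simp [← hP, this]
  have hP0 : P = 0 := by simpa [Polynomial.X_ne_zero] using hX
  exact hφ (by rw [hP, hP0]; simp)

end PolyFun

/-! ### Elements of `GL` -/

section Elements

/-- The endomorphisms `η` with `η² = 0` that kill almost all basis vectors; for them `1 + t η`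
is a one-parameter subgroup of `GL`. -/
def IsSqZero (η : (ℕ →₀ k) →ₗ[k] (ℕ →₀ k)) : Prop :=
  (∀ v, η (η v) = 0) ∧ ∃ n : ℕ, ∀ i, n ≤ i → η (Finsupp.single i 1) = 0

lemma IsSqZero.smul {η : (ℕ →₀ k) →ₗ[k] (ℕ →₀ k)} (h : IsSqZero η) (t : k) :
    IsSqZero (t • η) := by
  refine ⟨fun v => by simp [h.1], ?_⟩
  obtain ⟨n, hn⟩ := h.2
  exact ⟨n, fun i hi => by simp [hn i hi]⟩

/-- The unipotent element `1 + η` of `GL`. -/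
def unip (η : (ℕ →₀ k) →ₗ[k] (ℕ →₀ k)) (h : IsSqZero η) : GLInf k :=
  ⟨LinearEquiv.ofLinearMap (LinearMap.id + η) (LinearMap.id - η)
    (by ext1; ext1; simp [h.1]) (by ext1; ext1; simp [h.1]), by
    obtain ⟨n, hn⟩ := h.2
    exact ⟨n, fun i hi => by simp [hn i hi]⟩⟩

@[simp] lemma stdRep_unip (η : (ℕ →₀ k) →ₗ[k] (ℕ →₀ k)) (h : IsSqZero η) (v : ℕ →₀ k) :
    stdRep k (unip η h) v = v + η v := rfl

@[simp] lemma tensorRep_tprod (I : Type*) (g : GLInf k) (v : I → ℕ →₀ k) :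
    tensorRep k I g (PiTensorProduct.tprod k v) =
      PiTensorProduct.tprod k fun i => stdRep k g (v i) :=
  PiTensorProduct.map_tprod _ _

variable (k) in
/-- The copy of `GL` that acts on the coordinates with index at least `n`. -/
def GLFrom (n : ℕ) : Subgroup (GLInf k) where
  carrier := {g | (∀ j < n, stdRep k g (Finsupp.single j 1) = Finsupp.single j 1) ∧
    ∀ v, ∀ j < n, stdRep k g v j = v j}
  one_mem' := ⟨fun _ _ => by simp, fun _ _ _ => by simp⟩
  mul_mem' := by
    rintro g h ⟨hg, hg'⟩ ⟨hh, hh'⟩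
    refine ⟨fun j hj => ?_, fun v j hj => ?_⟩
    · rw [map_mul, Module.End.mul_apply, hh j hj, hg j hj]
    · rw [map_mul, Module.End.mul_apply, hg' _ j hj, hh' _ j hj]
  inv_mem' := by
    rintro g ⟨hg, hg'⟩
    have h1 : ∀ v, stdRep k g⁻¹ (stdRep k g v) = v := fun v => by
      rw [← Module.End.mul_apply, ← map_mul]; simp
    have h2 : ∀ v, stdRep k g (stdRep k g⁻¹ v) = v := fun v => by
      rw [← Module.End.mul_apply, ← map_mul]; simp
    refine ⟨fun j hj => ?_, fun v j hj => ?_⟩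
    · conv_lhs => rw [← hg j hj]
      exact h1 _
    · rw [← hg' _ j hj, h2]

lemma GLFrom_le {m n : ℕ} (h : m ≤ n) : GLFrom k n ≤ GLFrom k m := fun _ hg =>
  ⟨fun j hj => hg.1 j (hj.trans_le h), fun v j hj => hg.2 v j (hj.trans_le h)⟩

lemma unip_mem_GLFrom {η : (ℕ →₀ k) →ₗ[k] (ℕ →₀ k)} (h : IsSqZero η) {n : ℕ}
    (h1 : ∀ j < n, η (Finsupp.single j 1) = 0) (h2 : ∀ v, ∀ j < n, η v j = 0) :
    unip η h ∈ GLFrom k n :=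
  ⟨fun j hj => by simp [h1 j hj], fun v j hj => by simp [h2 v j hj]⟩

/-- The endomorphism of `𝐕` with `e_{aᵢ} ↦ vᵢ` that kills the other basis vectors. -/
def sendTo {I : Type*} (a : I → ℕ) (v : I → ℕ →₀ k) : (ℕ →₀ k) →ₗ[k] (ℕ →₀ k) :=
  Finsupp.linearCombination k (Function.extend a v 0)

lemma sendTo_apply {I : Type*} {a : I → ℕ} (ha : Function.Injective a) (v : I → ℕ →₀ k) (i : I) :
    sendTo a v (Finsupp.single (a i) 1) = v i := by
  simp [sendTo, ha.extend_apply]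

lemma sendTo_eq_zero {I : Type*} {a : I → ℕ} (v : I → ℕ →₀ k) (j : ℕ) (hj : ∀ i, a i ≠ j) :
    sendTo a v (Finsupp.single j 1) = 0 := by
  rw [sendTo, Finsupp.linearCombination_single, Function.extend_apply' _ _ _ (by simpa using hj)]
  simp

/-- A linear map vanishes at vectors whose coordinates avoid the basis vectors it does not kill. -/
lemma map_eq_zero_of_support {X : Type*} [AddCommGroup X] [Module k X] (f : (ℕ →₀ k) →ₗ[k] X)
    (v : ℕ →₀ k) (h : ∀ j, v j ≠ 0 → f (Finsupp.single j 1) = 0) : f v = 0 := by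
  conv_lhs => rw [← Finsupp.sum_single v]
  rw [Finsupp.sum, map_sum]
  refine Finset.sum_eq_zero fun j hj => ?_
  rw [show Finsupp.single j (v j) = v j • Finsupp.single j (1 : k) by simp, map_smul,
    h j (by simpa using hj), smul_zero]

lemma sendTo_apply_coord {I : Type*} (a : I → ℕ) (v : I → ℕ →₀ k) (j : ℕ) (h : ∀ i, v i j = 0)
    (x : ℕ →₀ k) : sendTo a v x j = 0 := by
  classical
  rw [sendTo, Finsupp.linearCombination_apply, Finsupp.sum, Finsupp.finsetSum_apply]
  refine Finset.sum_eq_zero fun b _ => ?_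
  rw [Finsupp.smul_apply]
  by_cases hb : ∃ i, a i = b
  · rw [Function.extend_def, dif_pos hb, h, smul_zero]
  · rw [Function.extend_apply' _ _ _ hb]; simp

lemma isSqZero_sendTo {I : Type*} [Finite I] {a : I → ℕ} (v : I → ℕ →₀ k)
    (h : ∀ i j, v i (a j) = 0) : IsSqZero (sendTo a v) := by
  refine ⟨fun x => map_eq_zero_of_support _ _ fun j hj => sendTo_eq_zero _ _ ?_, ?_⟩
  · rintro i rfl
    exact hj (sendTo_apply_coord a v _ (fun j => h j i) x)
  · obtain ⟨n, hn⟩ := (Set.finite_range a).bddAbove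
    refine ⟨n + 1, fun i hi => sendTo_eq_zero _ _ fun j hj => ?_⟩
    have := hn ⟨j, hj⟩
    omega

/-- If a subspace `L` meets the orbit condition for `GL` on the coordinates from `n` on and
contains the value of `z` at one tensor of distinct basis vectors, then it contains its values at
all tensors of vectors in those coordinates: such a tensor is the limit at `t = 0` of
`(t e_{a₁} + v₁) ⊗ ⋯ ⊗ (t e_{a_d} + v_d)`. -/
lemma map_tprod_mem_of_single [CharZero k] {X : Type*} [AddCommGroup X] [Module k X]
    {d n : ℕ} (L : Submodule k X) (z : (⨂[k] _ : Fin d, (ℕ →₀ k)) →ₗ[k] X)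
    (H : ∀ g ∈ GLFrom k n, ∀ x, z x ∈ L → z (tensorRep k (Fin d) g x) ∈ L)
    {a : Fin d → ℕ} (ha : Function.Injective a) (han : ∀ i, n ≤ a i)
    (h0 : z (PiTensorProduct.tprod k fun i => Finsupp.single (a i) 1) ∈ L)
    (v : Fin d → ℕ →₀ k) (hv : ∀ i, ∀ j < n, v i j = 0) :
    z (PiTensorProduct.tprod k v) ∈ L := by
  have key : ∀ (a : Fin d → ℕ), Function.Injective a → (∀ i, n ≤ a i) →
      z (PiTensorProduct.tprod k fun i => Finsupp.single (a i) 1) ∈ L →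
      ∀ (v : Fin d → ℕ →₀ k), (∀ i, ∀ j < n, v i j = 0) → (∀ i j, v i (a j) = 0) →
      z (PiTensorProduct.tprod k v) ∈ L := by
    intro a ha han h0 v hv hva
    have hF := polyFuns_map z (polyFuns_multilinear (PiTensorProduct.tprod k) v
      fun i => Finsupp.single (a i) (1 : k))
    have := polyFuns_zero_mem hF L fun t ht => ?_
    · simpa using this
    · have hη := (isSqZero_sendTo v hva).smul t⁻¹
      have hg : unip _ hη ∈ GLFrom k n := by
        refine unip_mem_GLFrom _ (fun j hj => ?_) fun x j hj => ?_
        · rw [LinearMap.smul_apply, sendTo_eq_zero _ _ fun i hi => ?_, smul_zero]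
          have := han i
          omega
        · rw [LinearMap.smul_apply, Finsupp.smul_apply,
            sendTo_apply_coord _ _ _ (fun i => hv i j hj), smul_zero]
      have h1 := L.smul_mem (t ^ d) (H _ hg _ h0)
      rw [tensorRep_tprod] at h1
      have h2 : (t ^ d) • (PiTensorProduct.tprod k fun i : Fin d =>
          stdRep k (unip _ hη) (Finsupp.single (a i) 1)) =
          PiTensorProduct.tprod k fun i => v i + t • Finsupp.single (a i) (1 : k) := by
        have := (PiTensorProduct.tprod k).map_smul_univ (fun _ : Fin d => t)
          (fun i => stdRep k (unip _ hη) (Finsupp.single (a i) 1))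
        rw [Finset.prod_const, Finset.card_univ, Fintype.card_fin] at this
        rw [← this]
        congr 1
        ext1 i
        rw [stdRep_unip, LinearMap.smul_apply, sendTo_apply ha, smul_add, smul_smul,
          mul_inv_cancel₀ ht, one_smul, add_comm]
      rw [← map_smul, h2] at h1
      exact h1
  -- pass through basis vectors far away from both `a` and the supports of the `vᵢ`
  obtain ⟨m, hm⟩ : ∃ m, n ≤ m ∧ (∀ i, a i < m) ∧ ∀ i j, m ≤ j → v i j = 0 := by
    classical
    refine ⟨n + Finset.univ.sup (fun i => a i + 1) +
      Finset.univ.sup (fun i => (v i).support.sup id + 1), by omega, fun i => ?_, fun i j hj => ?_⟩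
    · have := Finset.le_sup (f := fun i => a i + 1) (Finset.mem_univ i)
      omega
    · by_contra h
      have h1 := Finset.le_sup (f := fun i => (v i).support.sup id + 1) (Finset.mem_univ i)
      have h2 := Finset.le_sup (f := id) (Finsupp.mem_support_iff.2 h)
      simp only [id] at h1 h2
      omega
  refine key (fun i => m + i) (fun i j hij => by simpa [Fin.ext_iff] using hij) (fun i => by omega)
    ?_ v hv fun i j => hm.2.2 _ _ (by omega)
  refine key a ha han h0 _ (fun i j hj => ?_) fun i j => ?_
  · rw [Finsupp.single_apply, if_neg (by omega)]
  · rw [Finsupp.single_apply, if_neg]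
    have := hm.2.1 j
    omega

/-- The polarization identity. -/
lemma sum_neg_one_pow_smul_map_sum {d : ℕ} {X Y : Type*} [AddCommGroup X] [Module k X]
    [AddCommGroup Y] [Module k Y] (f : MultilinearMap k (fun _ : Fin d => X) Y)
    (y : Fin d → Fin d → X) :
    ∑ S : Finset (Fin d), (-1 : k) ^ (Sᶜ.card) • f (fun i => ∑ l ∈ S, y i l) =
      ∑ τ : Equiv.Perm (Fin d), f fun i => y i (τ i) := by
  classical
  have h1 : ∀ S : Finset (Fin d), f (fun i => ∑ l ∈ S, y i l) =
      ∑ r : Fin d → Fin d, if ∀ i, r i ∈ S then f (fun i => y i (r i)) else 0 := by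
    intro S
    rw [f.map_sum_finset, ← Finset.sum_filter]
    refine Finset.sum_congr ?_ fun _ _ => rfl
    ext r
    simp [Fintype.mem_piFinset]
  simp_rw [h1, Finset.smul_sum]
  rw [Finset.sum_comm]
  have h2 : ∀ r : Fin d → Fin d, (∑ S : Finset (Fin d), (-1 : k) ^ (Sᶜ.card) •
      (if ∀ i, r i ∈ S then f (fun i => y i (r i)) else 0)) =
      if Function.Bijective r then f (fun i => y i (r i)) else 0 := by
    intro r
    have h3 : (∑ S : Finset (Fin d), if ∀ i, r i ∈ S then (-1 : k) ^ (Sᶜ.card) else 0) =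
        if Function.Bijective r then 1 else 0 := by
      rw [← Finset.sum_filter]
      have : ∑ S : Finset (Fin d) with ∀ i, r i ∈ S, (-1 : k) ^ (Sᶜ.card) =
          ∑ T ∈ ((Finset.univ.image r)ᶜ).powerset, (-1 : k) ^ T.card := by
        refine Finset.sum_nbij' (fun S => Sᶜ) (fun T => Tᶜ) ?_ ?_ ?_ ?_ ?_
        · intro S hS
          simp only [Finset.mem_filter, Finset.mem_univ, true_and] at hS
          rw [Finset.mem_powerset, Finset.compl_subset_compl]
          intro x hx
          obtain ⟨i, -, rfl⟩ := Finset.mem_image.1 hx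
          exact hS i
        · intro T hT
          rw [Finset.mem_powerset] at hT
          simp only [Finset.mem_filter, Finset.mem_univ, true_and, Finset.mem_compl]
          intro i hi
          have := hT hi
          simp at this
        · simp
        · simp
        · simp
      rw [this]
      have h4 := Finset.sum_powerset_neg_one_pow_card (x := (Finset.univ.image r)ᶜ)
      have h5 := congrArg (Int.cast : ℤ → k) h4
      push_cast at h5
      rw [h5]
      have : (Finset.univ.image r)ᶜ = ∅ ↔ Function.Bijective r := by
        rw [Finset.compl_eq_empty_iff, ← Finset.coe_eq_univ, Finset.coe_image, Finset.coe_univ,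
          Set.image_univ, Set.range_eq_univ, Finite.injective_iff_surjective.symm.trans
          Finite.injective_iff_bijective]
      simp [this]
    have h6 : ∀ S : Finset (Fin d), (-1 : k) ^ (Sᶜ.card) •
        (if ∀ i, r i ∈ S then f (fun i => y i (r i)) else 0) =
        (if ∀ i, r i ∈ S then (-1 : k) ^ (Sᶜ.card) else 0) • f (fun i => y i (r i)) := by
      intro S
      split_ifs <;> simp
    simp_rw [h6]
    rw [← Finset.sum_smul, h3]
    split_ifs <;> simp
  simp_rw [h2]
  rw [← Finset.sum_filter]
  refine Finset.sum_bij' (fun r hr => Equiv.ofBijective r (by simpa using hr)) (fun τ _ => τ)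
    ?_ ?_ ?_ ?_ ?_
  · simp
  · intro τ _
    exact Finset.mem_filter.2 ⟨Finset.mem_univ _, τ.bijective⟩
  · intros; rfl
  · intros; ext; rfl
  · intros; rfl

end Elements

/-! ### Shifts -/

section Shift

variable (k) in
/-- The shift `eᵢ ↦ e_{i+n}` of `𝐕`. -/
def sh (n : ℕ) : (ℕ →₀ k) →ₗ[k] (ℕ →₀ k) := Finsupp.lmapDomain k k (· + n)

variable (k) in
/-- The left inverse of the shift that kills the first `n` basis vectors. -/
def ret (n : ℕ) : (ℕ →₀ k) →ₗ[k] (ℕ →₀ k) :=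
  Finsupp.lcomapDomain (· + n) (add_left_injective n)

@[simp] lemma sh_single (n i : ℕ) (c : k) :
    sh k n (Finsupp.single i c) = Finsupp.single (i + n) c := by
  simp [sh]

@[simp] lemma ret_apply (n : ℕ) (v : ℕ →₀ k) (i : ℕ) : ret k n v i = v (i + n) := rfl

@[simp] lemma sh_apply_add (n : ℕ) (v : ℕ →₀ k) (i : ℕ) : sh k n v (i + n) = v i :=
  Finsupp.mapDomain_apply (add_left_injective n) v i

lemma sh_apply_of_lt (n : ℕ) (v : ℕ →₀ k) {i : ℕ} (hi : i < n) : sh k n v i = 0 :=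
  Finsupp.mapDomain_of_notMem_range _ _ (by simp; omega)

@[simp] lemma ret_sh (n : ℕ) (v : ℕ →₀ k) : ret k n (sh k n v) = v := by
  ext i; simp

lemma ret_single_of_lt {n i : ℕ} (hi : i < n) (c : k) : ret k n (Finsupp.single i c) = 0 := by
  ext j
  rw [ret_apply, Finsupp.single_apply, if_neg (by omega)]
  rfl

@[simp] lemma ret_sub (n : ℕ) (v : ℕ →₀ k) : ret k n (v - sh k n (ret k n v)) = 0 := by
  simp

/-- `g` acting on the coordinates from `n` on, as a linear map. -/
def upLin (n : ℕ) (g : GLInf k) : (ℕ →₀ k) →ₗ[k] (ℕ →₀ k) :=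
  LinearMap.id - sh k n ∘ₗ ret k n + sh k n ∘ₗ stdRep k g ∘ₗ ret k n

lemma upLin_apply (n : ℕ) (g : GLInf k) (v : ℕ →₀ k) :
    upLin n g v = v - sh k n (ret k n v) + sh k n (stdRep k g (ret k n v)) := rfl

lemma upLin_mul (n : ℕ) (g h : GLInf k) (v : ℕ →₀ k) :
    upLin n g (upLin n h v) = upLin n (g * h) v := by
  simp [upLin_apply, map_add, map_sub]

lemma upLin_one (n : ℕ) (v : ℕ →₀ k) : upLin n 1 v = v := by
  simp [upLin_apply]

variable (k) in
/-- The isomorphism of `GL` with its copy acting on the coordinates from `n` on. -/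
def up (n : ℕ) : GLInf k →* GLInf k where
  toFun g := ⟨LinearEquiv.ofLinearMap (upLin n g) (upLin n g⁻¹)
      (by refine LinearMap.ext fun v => ?_; simp [upLin_mul, upLin_one])
      (by refine LinearMap.ext fun v => ?_; simp [upLin_mul, upLin_one]), by
    obtain ⟨m, hm⟩ := g.2
    refine ⟨m + n, fun i hi => ?_⟩
    obtain ⟨j, rfl⟩ : ∃ j, i = j + n := ⟨i - n, by omega⟩
    have h1 : ret k n (Finsupp.single (j + n) (1 : k)) = Finsupp.single j 1 := by
      rw [← sh_single, ret_sh]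
    have h2 : stdRep k g (Finsupp.single j 1) = Finsupp.single j 1 := hm j (by omega)
    change upLin n g _ = _
    rw [upLin_apply, h1, h2]
    simp⟩
  map_one' := by
    ext1; ext1 v
    exact upLin_one n v
  map_mul' g h := by
    ext1; ext1 v
    exact (upLin_mul n g h v).symm

lemma stdRep_up (n : ℕ) (g : GLInf k) (v : ℕ →₀ k) :
    stdRep k (up k n g) v = v - sh k n (ret k n v) + sh k n (stdRep k g (ret k n v)) := rfl

@[simp] lemma stdRep_up_sh (n : ℕ) (g : GLInf k) (v : ℕ →₀ k) :
    stdRep k (up k n g) (sh k n v) = sh k n (stdRep k g v) := by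
  simp [stdRep_up]

@[simp] lemma ret_stdRep_up (n : ℕ) (g : GLInf k) (v : ℕ →₀ k) :
    ret k n (stdRep k (up k n g) v) = stdRep k g (ret k n v) := by
  simp [stdRep_up]

lemma up_mem_GLFrom (n : ℕ) (g : GLInf k) : up k n g ∈ GLFrom k n := by
  refine ⟨fun j hj => ?_, fun v j hj => ?_⟩
  · rw [stdRep_up, ret_single_of_lt hj]; simp
  · simp [stdRep_up, sh_apply_of_lt n _ hj]

/-- A finitely supported permutation of `ℕ` with `i ↦ i + n` for `i < N`. -/
def shiftPerm (n N : ℕ) : Equiv.Perm ℕ where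
  toFun i := if i < N then i + n else if i < N + n then i - N else i
  invFun i := if i < n then i + N else if i < N + n then i - n else i
  left_inv i := by dsimp only; split_ifs <;> omega
  right_inv i := by dsimp only; split_ifs <;> omega

variable (k) in
/-- An element of `GL` with `eᵢ ↦ e_{i+n}` for `i < N`. -/
def shiftElt (n N : ℕ) : GLInf k :=
  ⟨Finsupp.domLCongr (shiftPerm n N), N + n, fun i hi => by
    rw [Finsupp.domLCongr_single]
    congr 1
    simp only [shiftPerm, Equiv.coe_fn_mk]
    rw [if_neg (by omega), if_neg (by omega)]⟩

lemma stdRep_shiftElt {n N i : ℕ} (hi : i < N) (c : k) :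
    stdRep k (shiftElt k n N) (Finsupp.single i c) = Finsupp.single (i + n) c := by
  change Finsupp.domLCongr (shiftPerm n N) _ = _
  rw [Finsupp.domLCongr_single]
  simp [shiftPerm, hi]

end Shift

/-! ### Projections onto submodules of relations, with denominators cleared -/

section Projection

/-- Over a domain, a submodule of a finite free module is the image of an `h`-fold projection. -/
lemma exists_projMatrix {R₀ ι : Type*} (K : Type*) [CommRing R₀] [IsDomain R₀] [Field K]
    [Algebra R₀ K] [IsFractionRing R₀ K] [Fintype ι]
    (q : Submodule R₀ (ι → R₀)) :
    ∃ (h : R₀) (p : ι → ι → R₀), h ≠ 0 ∧ (∀ i, (fun i' => p i' i) ∈ q) ∧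
      ∀ c ∈ q, ∀ i', ∑ i, p i' i * c i = h * c i' := by
  classical
  let j : (ι → R₀) →ₗ[R₀] (ι → K) := (Algebra.linearMap R₀ K).compLeft ι
  have hj : ∀ c i, j c i = algebraMap R₀ K (c i) := fun _ _ => rfl
  let Q : Submodule K (ι → K) := Submodule.span K (j '' q)
  -- a projection onto the span of `q` over `K`; its denominators are cleared below
  obtain ⟨π, hπ⟩ := Q.subtype.exists_leftInverse_of_injective Q.ker_subtype
  have hden : ∀ y ∈ Q, ∃ s : R₀, s ≠ 0 ∧ ∃ c ∈ q, j c = s • y := by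
    intro y hy
    induction hy using Submodule.span_induction with
    | mem y hy =>
      obtain ⟨c, hc, rfl⟩ := hy
      exact ⟨1, one_ne_zero, c, hc, by simp⟩
    | zero => exact ⟨1, one_ne_zero, 0, q.zero_mem, by simp⟩
    | add y z _ _ hy hz =>
      obtain ⟨s, hs, c, hc, h1⟩ := hy
      obtain ⟨t, ht, d, hd, h2⟩ := hz
      refine ⟨s * t, mul_ne_zero hs ht, t • c + s • d,
        q.add_mem (q.smul_mem _ hc) (q.smul_mem _ hd), ?_⟩
      rw [map_add, map_smul, map_smul, h1, h2, smul_add, smul_smul, smul_smul, mul_comm t s]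
    | smul a y _ hy =>
      obtain ⟨s, hs, c, hc, h1⟩ := hy
      obtain ⟨x, t, ht, rfl⟩ := IsFractionRing.div_surjective (A := R₀) a
      refine ⟨s * t, mul_ne_zero hs (nonZeroDivisors.ne_zero ht), x • c, q.smul_mem _ hc, ?_⟩
      have ht' : algebraMap R₀ K t ≠ 0 := by
        simpa using nonZeroDivisors.ne_zero ht
      rw [map_smul, h1]
      rw [← algebraMap_smul K x, ← algebraMap_smul K s, ← algebraMap_smul K (s * t), smul_smul,
        smul_smul, map_mul]
      congr 1
      field_simp
  choose s hs c hc hsc using fun i : ι => hden (π (Pi.single i 1)) (π (Pi.single i 1)).2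
  refine ⟨∏ i, s i, fun i' i => (∏ l ∈ Finset.univ.erase i, s l) * c i i',
    Finset.prod_ne_zero_iff.2 fun i _ => hs i, fun i => q.smul_mem _ (hc i), ?_⟩
  intro x hx i'
  have h1 : ∀ i, algebraMap R₀ K ((∏ l ∈ Finset.univ.erase i, s l) * c i i') =
      algebraMap R₀ K (∏ l, s l) * (π (Pi.single i 1) : ι → K) i' := by
    intro i
    have := congrFun (hsc i) i'
    rw [hj, Pi.smul_apply, Algebra.smul_def] at this
    rw [map_mul, this, ← mul_assoc, ← map_mul, Finset.prod_erase_mul _ _ (Finset.mem_univ i)]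
  have h2 : (∑ i, algebraMap R₀ K (x i) • (π (Pi.single i 1) : ι → K)) = j x := by
    have h3 : j x ∈ Q := Submodule.subset_span ⟨x, hx, rfl⟩
    have h4 : (π (j x) : ι → K) = j x := by
      have := LinearMap.congr_fun hπ ⟨j x, h3⟩
      exact congrArg Subtype.val this
    conv_rhs => rw [← h4, pi_eq_sum_univ' (j x)]
    rw [map_sum, Submodule.coe_sum]
    refine Finset.sum_congr rfl fun i _ => ?_
    rw [map_smul, Submodule.coe_smul, hj]
  apply IsFractionRing.injective R₀ K
  rw [map_sum, map_mul, ← hj x i', ← h2, Finset.sum_apply, Finset.mul_sum]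
  refine Finset.sum_congr rfl fun i _ => ?_
  rw [map_mul, h1, Pi.smul_apply, smul_eq_mul]
  ring

/-- The projection of `exists_projMatrix` can be averaged over a finite group of symmetries. -/
lemma exists_projMatrix_equivariant {R₀ G J : Type*} [CommRing R₀] [IsDomain R₀] [CharZero R₀]
    [Group G] [Fintype G] [Fintype J] (q : Submodule R₀ (G × J → R₀))
    (hq : ∀ c ∈ q, ∀ σ : G, (fun i : G × J => c (σ * i.1, i.2)) ∈ q) :
    ∃ (h : R₀) (p : G × J → G × J → R₀), h ≠ 0 ∧ (∀ i, (fun i' => p i' i) ∈ q) ∧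
      (∀ c ∈ q, ∀ i', ∑ i, p i' i * c i = h * c i') ∧
      ∀ σ i' i, p (σ * i'.1, i'.2) (σ * i.1, i.2) = p i' i := by
  obtain ⟨h, p, h0, hp, hpc⟩ := exists_projMatrix (FractionRing R₀) q
  refine ⟨Fintype.card G * h, fun i' i => ∑ σ : G, p (σ * i'.1, i'.2) (σ * i.1, i.2),
    mul_ne_zero (by simp) h0, fun i => ?_, fun c hc i' => ?_, fun σ i' i => ?_⟩
  · have := q.sum_mem fun σ (_ : σ ∈ Finset.univ) => hq _ (hp (σ * i.1, i.2)) σ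
    convert this using 1
    ext i'
    simp
  · have h1 : ∀ σ : G, ∑ i : G × J, p (σ * i'.1, i'.2) (σ * i.1, i.2) * c i = h * c i' := by
      intro σ
      have := hpc _ (hq c hc σ⁻¹) (σ * i'.1, i'.2)
      simp only [inv_mul_cancel_left] at this
      rw [← this]
      refine Fintype.sum_equiv ((Equiv.mulLeft σ).prodCongr (Equiv.refl J)) _ _ fun i => ?_
      simp [Prod.map]
    simp_rw [Finset.sum_mul]
    rw [Finset.sum_comm]
    simp [h1, mul_assoc]
  · refine Fintype.sum_equiv (Equiv.mulRight σ) _ _ fun τ => ?_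
    simp [mul_assoc]

end Projection

/-- A linear map that kills the kernel of `F` descends to the range of `F`. -/
lemma exists_comp_rangeRestrict {R A M Y : Type*} [CommRing R] [AddCommGroup A] [Module R A]
    [AddCommGroup M] [Module R M] [AddCommGroup Y] [Module R Y] (F : A →ₗ[R] M) (G : A →ₗ[R] Y)
    (h : LinearMap.ker F ≤ LinearMap.ker G) :
    ∃ H : LinearMap.range F →ₗ[R] Y, ∀ a, H ⟨F a, a, rfl⟩ = G a := by
  refine ⟨((LinearMap.ker F).liftQ G h) ∘ₗ F.quotKerEquivRange.symm.toLinearMap, fun a => ?_⟩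
  have : F.quotKerEquivRange.symm ⟨F a, a, rfl⟩ = (LinearMap.ker F).mkQ a := by
    rw [LinearEquiv.symm_apply_eq]
    rfl
  simp [this]

/-! ### Semilinear representations -/

section Semilinear

variable {R : Type v} [CommRing R] [Algebra k R] (α : GLInf k →* (R ≃ₐ[k] R))

/-- The diagonal action of `GL` on `R ⊗ P`. -/
def semiRep {P : Type*} [AddCommMonoid P] [Module k P] (π : Representation k (GLInf k) P) :
    Representation k (GLInf k) (R ⊗[k] P) where
  toFun g := TensorProduct.map (α g).toLinearMap (π g)
  map_one' := by
    ext
    simp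
  map_mul' g h := by
    ext
    simp

@[simp] lemma semiRep_tmul {P : Type*} [AddCommMonoid P] [Module k P]
    (π : Representation k (GLInf k) P) (g : GLInf k) (r : R) (x : P) :
    semiRep α π g (r ⊗ₜ x) = α g r ⊗ₜ π g x := rfl

lemma semiRep_smul {P : Type*} [AddCommMonoid P] [Module k P]
    (π : Representation k (GLInf k) P) (g : GLInf k) (r : R) (x : R ⊗[k] P) :
    semiRep α π g (r • x) = α g r • semiRep α π g x := by
  induction x using TensorProduct.induction_on with
  | zero => simp
  | tmul s p => simp [TensorProduct.smul_tmul']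
  | add x y hx hy => simp only [smul_add, map_add, hx, hy]

/-- The two properties of the action on the coefficient ring that make it behave like a polynomial
representation: one-parameter unipotent subgroups act polynomially, and every element is fixed by
all group elements that fix sufficiently many basis vectors of `𝐕`. -/
structure IsAlgebraicAction : Prop where
  poly : ∀ (η : (ℕ →₀ k) →ₗ[k] (ℕ →₀ k)) (hη : IsSqZero η) (r : R),
    (fun t => α (unip (t • η) (hη.smul t)) r) ∈ polyFuns k R
  finitary : ∀ r, ∃ N : ℕ, ∀ g : GLInf k,
    (∀ i < N, stdRep k g (Finsupp.single i 1) = Finsupp.single i 1) → α g r = r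

/-- The elements of the coefficient ring fixed by `GL` acting on the coordinates from `n` on. -/
def fixedSub (n : ℕ) : Subalgebra k R where
  carrier := {r | ∀ g ∈ GLFrom k n, α g r = r}
  mul_mem' ha hb g hg := by rw [map_mul, ha g hg, hb g hg]
  add_mem' ha hb g hg := by rw [map_add, ha g hg, hb g hg]
  algebraMap_mem' c g _ := by simp

variable {α} in
lemma IsAlgebraicAction.exists_mem_fixedSub (h : IsAlgebraicAction α) {ι : Type*} (s : Finset ι)
    (r : ι → R) : ∃ N, ∀ N', N ≤ N' → ∀ i ∈ s, r i ∈ fixedSub α N' := by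
  choose N hN using fun i => h.finitary (r i)
  refine ⟨s.sup N, fun N' hN' i hi g hg => hN i g fun j hj => hg.1 j ?_⟩
  have := Finset.le_sup (f := N) hi
  omega

variable (k) in
/-- The tensor power `𝐕^{⊗d}`. -/
abbrev Tens (d : ℕ) : Type u := ⨂[k] _ : Fin d, (ℕ →₀ k)

variable (k) in
/-- The basis of `𝐕^{⊗d}` given by the words of length `d`. -/
def wordBasis (d : ℕ) : Basis (Fin d → ℕ) k (Tens k d) :=
  Basis.piTensorProduct fun _ => Finsupp.basisSingleOne

variable (k) in
/-- The basis tensor of a word. -/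
def word {d : ℕ} (w : Fin d → ℕ) : Tens k d :=
  PiTensorProduct.tprod k fun i => Finsupp.single (w i) 1

lemma wordBasis_apply {d : ℕ} (w : Fin d → ℕ) : wordBasis k d w = word k w := by
  simp [wordBasis, word]

variable (R) in
/-- The coefficient of a word in an element of `R ⊗ 𝐕^{⊗d}`. -/
def wordCoeff {d : ℕ} (w : Fin d → ℕ) : R ⊗[k] Tens k d →ₗ[R] R :=
  ((wordBasis k d).baseChange R).coord w

lemma wordCoeff_tmul_word {d : ℕ} (w w' : Fin d → ℕ) (r : R) :
    wordCoeff R w (r ⊗ₜ word k w') = if w' = w then r else 0 := by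
  rw [wordCoeff, Basis.coord_apply, Basis.baseChange_repr_tmul, ← wordBasis_apply,
    Basis.repr_self, Finsupp.single_apply]
  split_ifs <;> simp

lemma linearMap_ext_baseChange_word {d : ℕ} {X : Type*} [AddCommGroup X] [Module R X]
    {f g : R ⊗[k] Tens k d →ₗ[R] X}
    (h : ∀ w, f (1 ⊗ₜ word k w) = g (1 ⊗ₜ word k w)) : f = g :=
  ((wordBasis k d).baseChange R).ext fun w => by
    rw [Basis.baseChange_apply, wordBasis_apply, h]

lemma eq_zero_of_wordCoeff {d : ℕ} (x : R ⊗[k] Tens k d) (h : ∀ w, wordCoeff R w x = 0) :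
    x = 0 :=
  ((wordBasis k d).baseChange R).ext_elem fun w => by simpa [wordCoeff] using h w

lemma exists_eq_sum_word {d : ℕ} {J : Type*} [Finite J] (x : J → R ⊗[k] Tens k d) :
    ∃ W : Finset (Fin d → ℕ), ∀ j,
      x j = ∑ w ∈ W, wordCoeff R w (x j) • (1 : R) ⊗ₜ[k] word k w ∧
      ∀ w, w ∉ W → wordCoeff R w (x j) = 0 := by
  classical
  have := Fintype.ofFinite J
  let b := (wordBasis k d).baseChange R
  refine ⟨Finset.univ.biUnion fun j => (b.repr (x j)).support, fun j => ⟨?_, fun w hw => ?_⟩⟩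
  · conv_lhs => rw [← b.linearCombination_repr (x j), Finsupp.linearCombination_apply]
    rw [Finsupp.sum_of_support_subset (s := Finset.univ.biUnion fun j => (b.repr (x j)).support)]
    · refine Finset.sum_congr rfl fun w _ => ?_
      rw [Basis.baseChange_apply, wordBasis_apply]
      rfl
    · exact Finset.subset_biUnion_of_mem (fun j => (b.repr (x j)).support) (Finset.mem_univ j)
    · simp
  · by_contra h
    exact hw (Finset.mem_biUnion.2 ⟨j, Finset.mem_univ _, Finsupp.mem_support_iff.2 h⟩)

end Semilinear

/-! ### Relations of top degree -/

section Relations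

variable {R : Type v} [CommRing R] [Algebra k R] {α : GLInf k →* (R ≃ₐ[k] R)}
  {M : Type w} [AddCommGroup M] [Module k M] [Module R M] [IsScalarTower k R M]
  {ρ : Representation k (GLInf k) M}

/-- A map on a tensor power commutes with `GL` acting on the coordinates from `n` on. -/
def EquivariantFrom (ρ : Representation k (GLInf k) M) (n : ℕ) {d : ℕ}
    (f : Tens k d →ₗ[k] M) : Prop :=
  ∀ g ∈ GLFrom k n, ∀ x, f (tensorRep k (Fin d) g x) = ρ g (f x)

variable (R) in
/-- The `R`-submodule spanned by the images of the given maps on tensor powers of degree `< d`. -/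
def genSpan {ι : ℕ → Type} (f : ∀ e, ι e → Tens k e →ₗ[k] M) (d : ℕ) : Submodule R M :=
  Submodule.span R {m | ∃ e < d, ∃ i x, f e i x = m}

variable (R) in
/-- The part of `genSpan R f (d + 1)` of degree `< d` for `GL` acting on the coordinates from `N`
on: one adds to `genSpan R f d` the values of the maps of degree `d` at tensors one of whose
factors is `e_u` with `u < N`. -/
def lowSpan {ι : ℕ → Type} (f : ∀ e, ι e → Tens k e →ₗ[k] M) (d N : ℕ) : Submodule R M :=
  Submodule.span R ({m | ∃ e < d, ∃ i x, f e i x = m} ∪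
    {m | ∃ i v, (∃ l, ∃ u < N, v l = Finsupp.single u 1) ∧
      f d i (PiTensorProduct.tprod k v) = m})

lemma lowSpan_mono {ι : ℕ → Type} (f : ∀ e, ι e → Tens k e →ₗ[k] M) (d : ℕ) {N N' : ℕ}
    (h : N ≤ N') : lowSpan R f d N ≤ lowSpan R f d N' := by
  refine Submodule.span_mono (Set.union_subset_union_right _ ?_)
  rintro _ ⟨i, v, ⟨l, u, hu, hv⟩, rfl⟩
  exact ⟨i, v, ⟨l, u, hu.trans_le h, hv⟩, rfl⟩

lemma map_tprod_mem_lowSpan {ι : ℕ → Type} (f : ∀ e, ι e → Tens k e →ₗ[k] M) {d N : ℕ} (i : ι d)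
    (v : Fin d → ℕ →₀ k) (l : Fin d) (u : ℕ) (hu : u < N) (hv : v l = Finsupp.single u 1) :
    f d i (PiTensorProduct.tprod k v) ∈ lowSpan R f d N :=
  Submodule.subset_span (Or.inr ⟨i, v, ⟨l, u, hu, hv⟩, rfl⟩)

lemma span_stable (hρ : IsSemilinear α ρ) {s : Set M} (g : GLInf k)
    (hs : ∀ m ∈ s, ρ g m ∈ Submodule.span R s) {m : M} (hm : m ∈ Submodule.span R s) :
    ρ g m ∈ Submodule.span R s := by
  induction hm using Submodule.span_induction with
  | mem m h => exact hs m h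
  | zero => simp
  | add x y _ _ hx hy => rw [map_add]; exact add_mem hx hy
  | smul r x _ hx => rw [hρ]; exact Submodule.smul_mem _ _ hx

lemma genSpan_stable (hρ : IsSemilinear α ρ) {ι : ℕ → Type} {f : ∀ e, ι e → Tens k e →ₗ[k] M}
    {n : ℕ} (hf : ∀ e i, EquivariantFrom ρ n (f e i)) (d : ℕ) {g : GLInf k} (hg : g ∈ GLFrom k n)
    {m : M} (hm : m ∈ genSpan R f d) : ρ g m ∈ genSpan R f d := by
  refine span_stable hρ g ?_ hm
  rintro _ ⟨e, he, i, x, rfl⟩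
  rw [← hf e i g hg]
  exact Submodule.subset_span ⟨e, he, i, _, rfl⟩

lemma lowSpan_stable (hρ : IsSemilinear α ρ) {ι : ℕ → Type} {f : ∀ e, ι e → Tens k e →ₗ[k] M}
    {n N : ℕ} (hn : n ≤ N) (hf : ∀ e i, EquivariantFrom ρ n (f e i)) (d : ℕ) {g : GLInf k}
    (hg : g ∈ GLFrom k N) {m : M} (hm : m ∈ lowSpan R f d N) : ρ g m ∈ lowSpan R f d N := by
  refine span_stable hρ g ?_ hm
  rintro _ (⟨e, he, i, x, rfl⟩ | ⟨i, v, ⟨l, u, hu, hv⟩, rfl⟩)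
  · rw [← hf e i g (GLFrom_le hn hg)]
    exact Submodule.subset_span (Or.inl ⟨e, he, i, _, rfl⟩)
  · rw [← hf d i g (GLFrom_le hn hg), tensorRep_tprod]
    exact map_tprod_mem_lowSpan f i _ l u hu (by rw [hv, hg.1 u hu])

/-- The permutation of tensor factors with `v ↦ v ∘ τ`. -/
def permT {d : ℕ} (τ : Equiv.Perm (Fin d)) : Tens k d →ₗ[k] Tens k d :=
  (PiTensorProduct.reindex k (fun _ => (ℕ →₀ k)) τ.symm).toLinearMap

@[simp] lemma permT_tprod {d : ℕ} (τ : Equiv.Perm (Fin d)) (v : Fin d → ℕ →₀ k) :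
    permT τ (PiTensorProduct.tprod k v) = PiTensorProduct.tprod k (v ∘ τ) := by
  simp only [permT, LinearEquiv.coe_coe]
  exact PiTensorProduct.reindex_tprod _ _

@[simp] lemma permT_word {d : ℕ} (τ : Equiv.Perm (Fin d)) (w : Fin d → ℕ) :
    permT (k := k) τ (word k w) = word k (w ∘ τ) := permT_tprod _ _

lemma permT_tensorRep {d : ℕ} (τ : Equiv.Perm (Fin d)) (g : GLInf k) (x : Tens k d) :
    permT τ (tensorRep k (Fin d) g x) = tensorRep k (Fin d) g (permT τ x) := by
  have : permT τ ∘ₗ tensorRep k (Fin d) g = tensorRep k (Fin d) g ∘ₗ permT τ := by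
    ext v
    simp [Function.comp_def]
  exact LinearMap.congr_fun this x

/-- The combination `∑ c(τ,j) f_j ∘ τ` of maps on a tensor power. -/
def relMap {d : ℕ} {J : Type*} [Fintype J] (f : J → Tens k d →ₗ[k] M)
    (c : Equiv.Perm (Fin d) × J → R) : Tens k d →ₗ[k] M :=
  ∑ i, c i • (f i.2 ∘ₗ permT i.1)

lemma relMap_apply {d : ℕ} {J : Type*} [Fintype J] (f : J → Tens k d →ₗ[k] M)
    (c : Equiv.Perm (Fin d) × J → R) (x : Tens k d) :
    relMap f c x = ∑ i, c i • f i.2 (permT i.1 x) := by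
  simp [relMap]

lemma relMap_tensorRep (hρ : IsSemilinear α ρ) {d : ℕ} {J : Type*} [Fintype J]
    {f : J → Tens k d →ₗ[k] M} {n : ℕ} (hf : ∀ i, EquivariantFrom ρ n (f i))
    {c : Equiv.Perm (Fin d) × J → R} {g : GLInf k} (hg : g ∈ GLFrom k n)
    (hc : ∀ i, α g (c i) = c i) (x : Tens k d) :
    relMap f c (tensorRep k (Fin d) g x) = ρ g (relMap f c x) := by
  rw [relMap_apply, relMap_apply, map_sum]
  refine Finset.sum_congr rfl fun i _ => ?_
  rw [hρ, hc, permT_tensorRep, hf i.2 g hg]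

variable [CharZero k]

/-- A relation with invariant coefficients modulo `lowSpan` holds for all tensors once it holds
for one tensor of distinct basis vectors. -/
lemma relMap_mem_lowSpan (hρ : IsSemilinear α ρ) {ι : ℕ → Type} {f : ∀ e, ι e → Tens k e →ₗ[k] M}
    {n N d : ℕ} [Fintype (ι d)] (hn : n ≤ N) (hf : ∀ e i, EquivariantFrom ρ n (f e i))
    {c : Equiv.Perm (Fin d) × ι d → R} (hc : ∀ i, c i ∈ fixedSub α N)
    (h : relMap (f d) c (word k fun i => N + i) ∈ lowSpan R f d N) (w : Fin d → ℕ) :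
    relMap (f d) c (word k w) ∈ lowSpan R f d N := by
  by_cases hw : ∀ i, N ≤ w i
  · refine map_tprod_mem_of_single (n := N) ((lowSpan R f d N).restrictScalars k)
      (relMap (f d) c) ?_ (a := fun i => N + i) (fun i j hij => by simpa [Fin.ext_iff] using hij)
      (fun i => by omega) h _ fun i j hj => ?_
    · intro g hg x hx
      rw [relMap_tensorRep hρ (hf d) (GLFrom_le hn hg) fun i => hc i g hg]
      exact lowSpan_stable hρ hn hf d hg hx
    · have := hw i
      rw [Finsupp.single_apply, if_neg (by omega)]
  · push Not at hw
    obtain ⟨l, hl⟩ := hw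
    rw [relMap_apply]
    refine Submodule.sum_mem _ fun i _ => Submodule.smul_mem _ _ ?_
    rw [permT_word]
    exact map_tprod_mem_lowSpan f _ _ (i.1.symm l) (w l) hl (by simp)

/-- Polarization: the combination of the maps `f_j ∘ τ` with the coefficients at the words
`col ∘ τ` is recovered from the substitutions of the sum of the `e_{N+l}` with `l ∈ S`, `col l = a`
for the letter `a`. -/
lemma relMap_eq_sum_polarization {d : ℕ} {J : Type*} [Fintype J] (f : J → Tens k d →ₗ[k] M)
    (r : J → (Fin d → ℕ) → R) (W : Finset (Fin d → ℕ)) (hr : ∀ j w, w ∉ W → r j w = 0)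
    (col : Fin d → ℕ) (N : ℕ) :
    relMap f (fun i => r i.2 (col ∘ i.1)) (word k fun i => N + i) =
      ∑ S : Finset (Fin d), (-1 : k) ^ (Sᶜ.card) • ∑ j, ∑ w ∈ W, r j w •
        f j (PiTensorProduct.tprod k fun i => ∑ l ∈ S,
          if col l = w i then Finsupp.single (N + (l : ℕ)) 1 else 0) := by
  classical
  let y : (Fin d → ℕ) → Fin d → Fin d → ℕ →₀ k := fun w i l =>
    if col l = w i then Finsupp.single (N + l) 1 else 0
  change _ = ∑ S : Finset (Fin d), (-1 : k) ^ (Sᶜ.card) • ∑ j, ∑ w ∈ W, r j w •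
        f j (PiTensorProduct.tprod k fun i => ∑ l ∈ S, y w i l)
  have h2 : ∀ j, ∀ w, ∑ S : Finset (Fin d), (-1 : k) ^ (Sᶜ.card) •
      f j (PiTensorProduct.tprod k fun i => ∑ l ∈ S, y w i l) =
      ∑ τ : Equiv.Perm (Fin d), if col ∘ τ = w then f j (word k fun i => N + τ i) else 0 := by
    intro j w
    have := sum_neg_one_pow_smul_map_sum
      ((f j).compMultilinearMap (PiTensorProduct.tprod k)) (y w)
    simp only [LinearMap.compMultilinearMap_apply] at this
    rw [this]
    refine Finset.sum_congr rfl fun τ _ => ?_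
    split_ifs with h
    · congr 2
      ext1 i
      exact if_pos (congrFun h i)
    · obtain ⟨i, hi⟩ : ∃ i, col (τ i) ≠ w i := by
        by_contra hne
        push Not at hne
        exact h (funext hne)
      rw [(PiTensorProduct.tprod k).map_coord_zero i (if_neg hi), map_zero]
  simp_rw [Finset.smul_sum]
  rw [Finset.sum_comm]
  simp_rw [Finset.sum_comm (s := Finset.univ) (t := W), smul_comm _ (r _ _)]
  simp_rw [← Finset.smul_sum, h2]
  rw [relMap_apply, Fintype.sum_prod_type, Finset.sum_comm, Finset.sum_comm (s := W)]
  refine Finset.sum_congr rfl fun j _ => ?_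
  simp_rw [Finset.smul_sum]
  rw [Finset.sum_comm]
  refine Finset.sum_congr rfl fun τ _ => ?_
  simp only [smul_ite, smul_zero, Finset.sum_ite_eq, permT_word]
  split_ifs with h
  · rfl
  · rw [hr j _ h, zero_smul]

/-- The endomorphism of `𝐕` that sends `e_a` to the sum of the `e_{N+l}` with `l ∈ S`,
`col l = a`. -/
def spread {d : ℕ} (N : ℕ) (col : Fin d → ℕ) (S : Finset (Fin d)) : (ℕ →₀ k) →ₗ[k] (ℕ →₀ k) :=
  Finsupp.linearCombination k fun a => ∑ l ∈ S, if col l = a then Finsupp.single (N + l) 1 else 0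

lemma spread_single {d : ℕ} (N : ℕ) (col : Fin d → ℕ) (S : Finset (Fin d)) (a : ℕ) :
    spread N col S (Finsupp.single a 1) =
      ∑ l ∈ S, if col l = a then Finsupp.single (N + (l : ℕ)) (1 : k) else 0 := by
  simp [spread]

lemma spread_coord {d : ℕ} {N : ℕ} (col : Fin d → ℕ) (S : Finset (Fin d)) (v : ℕ →₀ k) {j : ℕ}
    (hj : j < N) : spread N col S v j = 0 := by
  simp only [spread, Finsupp.linearCombination_apply, Finsupp.sum, Finsupp.finsetSum_apply,
    Finsupp.smul_apply]
  refine Finset.sum_eq_zero fun a _ => ?_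
  rw [Finset.sum_eq_zero, smul_zero]
  intro l _
  split_ifs
  · rw [Finsupp.single_apply, if_neg (by omega)]
  · rfl

lemma spread_single_eq_zero {d : ℕ} (N : ℕ) {col : Fin d → ℕ} (S : Finset (Fin d)) {a : ℕ}
    (ha : ∀ l, col l ≠ a) : spread N col S (Finsupp.single a (1 : k)) = 0 := by
  rw [spread_single]
  exact Finset.sum_eq_zero fun l _ => if_neg (ha l)

lemma isSqZero_spread {d : ℕ} {N : ℕ} {col : Fin d → ℕ} (hcol : ∀ l, col l < N)
    (S : Finset (Fin d)) : IsSqZero (spread (k := k) N col S) := by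
  have h : ∀ a, N ≤ a → spread N col S (Finsupp.single a (1 : k)) = 0 := fun a ha =>
    spread_single_eq_zero N S fun l => ((hcol l).trans_le ha).ne
  refine ⟨fun v => map_eq_zero_of_support _ _ fun j hj => h j ?_, N, h⟩
  by_contra hlt
  exact hj (spread_coord col S v (by omega))

/-- A relation of degree `d` modulo `lowSpan` has consequences with multilinear words: apply
`1 + t η`, where `η` sends `e_a` to the sum of the `e_{N+l}` with `l ∈ S` and `col l = a`, let
`t → 0` in the part of degree `d`, and polarize over the subsets `S`. -/
lemma relation_mem_lowSpan (hα : IsAlgebraicAction α) (hρ : IsSemilinear α ρ) {ι : ℕ → Type}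
    {f : ∀ e, ι e → Tens k e →ₗ[k] M} {n d : ℕ} [Fintype (ι d)]
    (hf : ∀ e i, EquivariantFrom ρ n (f e i)) (x : ι d → R ⊗[k] Tens k d)
    (hx : ∑ j, (f d j).liftBaseChange R (x j) ∈ lowSpan R f d n) (col : Fin d → ℕ)
    (hcol : ∀ i, n ≤ col i) :
    ∃ N₀, ∀ N, N₀ ≤ N → relMap (f d) (fun i => wordCoeff R (col ∘ i.1) (x i.2))
      (word k fun i => N + i) ∈ lowSpan R f d N := by
  classical
  obtain ⟨W, hW⟩ := exists_eq_sum_word x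
  refine ⟨n + ∑ i, (col i + 1) + ∑ w ∈ W, ∑ i, (w i + 1), fun N hN => ?_⟩
  have hcolN : ∀ i, col i < N := fun i => by
    have := Finset.single_le_sum (f := fun i => col i + 1) (fun _ _ => Nat.zero_le _)
      (Finset.mem_univ i)
    omega
  have hWN : ∀ w ∈ W, ∀ i, w i < N := fun w hw i => by
    have h1 := Finset.single_le_sum (f := fun i => w i + 1) (fun _ _ => Nat.zero_le _)
      (Finset.mem_univ i)
    have h2 := Finset.single_le_sum (f := fun w : Fin d → ℕ => ∑ i, (w i + 1))
      (fun _ _ => Nat.zero_le _) hw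
    omega
  have hnN : n ≤ N := by omega
  set r : ι d → (Fin d → ℕ) → R := fun j w => wordCoeff R w (x j) with hr
  have hx' : ∑ j, ∑ w ∈ W, r j w • f d j (word k w) ∈ lowSpan R f d n := by
    convert hx using 1
    refine Finset.sum_congr rfl fun j _ => ?_
    conv_rhs => rw [(hW j).1]
    simp [map_sum, hr]
  let y : (Fin d → ℕ) → Fin d → Fin d → ℕ →₀ k := fun w i l =>
    if col l = w i then Finsupp.single (N + l) 1 else 0
  -- the limit `t → 0` for a single subset `S`
  have key : ∀ S : Finset (Fin d), ∑ j, ∑ w ∈ W,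
      r j w • f d j (PiTensorProduct.tprod k fun i => ∑ l ∈ S, y w i l) ∈ lowSpan R f d N := by
    intro S
    let η : (ℕ →₀ k) →ₗ[k] (ℕ →₀ k) := spread N col S
    have hη : IsSqZero η := isSqZero_spread hcolN S
    have hg : ∀ t : k, unip _ (hη.smul t) ∈ GLFrom k n := fun t => by
      refine unip_mem_GLFrom _ (fun j hj => ?_) fun v j hj => ?_
      · simp [η, spread_single_eq_zero N S fun l => (hj.trans_le (hcol l)).ne']
      · simp [η, spread_coord col S v (hj.trans_le hnN)]
    let F : k → M := fun t => ∑ j, ∑ w ∈ W, α (unip _ (hη.smul t)) (r j w) •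
      f d j (PiTensorProduct.tprod k fun i => η (Finsupp.single (w i) 1))
    have hF : F ∈ polyFuns k M := by
      refine polyFuns_sum _ fun j _ => polyFuns_sum _ fun w _ => ?_
      exact polyFuns_map ((LinearMap.toSpanSingleton R M
        (f d j (PiTensorProduct.tprod k fun i => η (Finsupp.single (w i) 1)))).restrictScalars k)
        (hα.poly η hη (r j w))
    have h0 := polyFuns_zero_mem hF ((lowSpan R f d N).restrictScalars k) fun t ht => ?_
    · have h1 : unip _ (hη.smul 0) = 1 := by
        ext v
        simp [unip]
      change F 0 ∈ lowSpan R f d N at h0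
      simp only [F, h1, map_one, AlgEquiv.one_apply, η, spread_single] at h0
      exact h0
    · have h1 : ∑ j, ∑ w ∈ W, α (unip _ (hη.smul t)) (r j w) •
          f d j (PiTensorProduct.tprod k fun i => Finsupp.single (w i) 1 +
            t • η (Finsupp.single (w i) 1)) ∈ lowSpan R f d N := by
        have h2 := lowSpan_mono f d hnN
          (lowSpan_stable hρ le_rfl hf d (hg t) hx')
        convert h2 using 1
        simp only [map_sum, hρ _]
        refine Finset.sum_congr rfl fun j _ => Finset.sum_congr rfl fun w _ => ?_
        rw [← hf d j _ (hg t), word, tensorRep_tprod]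
        rfl
      have h2 : ∀ j, ∀ w ∈ W, f d j (PiTensorProduct.tprod k fun i => Finsupp.single (w i) 1 +
            t • η (Finsupp.single (w i) 1)) -
            t ^ d • f d j (PiTensorProduct.tprod k fun i => η (Finsupp.single (w i) 1)) ∈
            lowSpan R f d N := by
        intro j w hw
        have h3 := ((f d j).compMultilinearMap (PiTensorProduct.tprod k)).map_add_univ
          (fun i => Finsupp.single (w i) 1) (fun i => t • η (Finsupp.single (w i) 1))
        have h4 := ((f d j).compMultilinearMap (PiTensorProduct.tprod k)).map_smul_univ
          (fun _ => t) (fun i => η (Finsupp.single (w i) 1))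
        rw [Finset.prod_const, Finset.card_univ, Fintype.card_fin] at h4
        simp only [LinearMap.compMultilinearMap_apply] at h3 h4
        rw [← h4, show (fun i => Finsupp.single (w i) 1 + t • η (Finsupp.single (w i) 1)) =
          (fun i => Finsupp.single (w i) 1) + fun i => t • η (Finsupp.single (w i) 1) from rfl, h3,
          ← Finset.sum_erase_add _ _ (Finset.mem_univ ∅), Finset.piecewise_empty,
          add_sub_cancel_right]
        refine Submodule.sum_mem _ fun s hs => ?_
        obtain ⟨i, hi⟩ := Finset.nonempty_iff_ne_empty.2 (Finset.ne_of_mem_erase hs)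
        exact map_tprod_mem_lowSpan f j _ i (w i) (hWN w hw i)
          (Finset.piecewise_eq_of_mem _ _ _ hi)
      have h3 : t ^ d • F t ∈ (lowSpan R f d N).restrictScalars k := by
        have h4 : ∑ j, ∑ w ∈ W, α (unip _ (hη.smul t)) (r j w) •
          (f d j (PiTensorProduct.tprod k fun i => Finsupp.single (w i) 1 +
            t • η (Finsupp.single (w i) 1)) -
            t ^ d • f d j (PiTensorProduct.tprod k fun i => η (Finsupp.single (w i) 1))) ∈
            lowSpan R f d N :=
          Submodule.sum_mem _ fun j _ => Submodule.sum_mem _ fun w hw =>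
            Submodule.smul_mem _ _ (h2 j w hw)
        have h5 := Submodule.sub_mem _ h1 h4
        change t ^ d • F t ∈ lowSpan R f d N
        convert h5 using 1
        rw [← Finset.sum_sub_distrib]
        simp only [F, Finset.smul_sum]
        refine Finset.sum_congr rfl fun j _ => ?_
        rw [← Finset.sum_sub_distrib]
        refine Finset.sum_congr rfl fun w _ => ?_
        rw [smul_sub, sub_sub_cancel, smul_comm]
      have h4 := Submodule.smul_mem _ (t ^ d)⁻¹ h3
      rwa [smul_smul, inv_mul_cancel₀ (pow_ne_zero d ht), one_smul] at h4
  -- polarization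
  have h1 : ∑ S : Finset (Fin d), (-1 : k) ^ (Sᶜ.card) • ∑ j, ∑ w ∈ W,
      r j w • f d j (PiTensorProduct.tprod k fun i => ∑ l ∈ S, y w i l) ∈ lowSpan R f d N :=
    Submodule.sum_mem _ fun S _ => (lowSpan R f d N).smul_of_tower_mem _ (key S)
  convert h1 using 1
  exact relMap_eq_sum_polarization (f d) r W (fun j => (hW j).2) col N

end Relations

/-! ### Generic freeness -/

section HighPart

lemma sh_ret_stdRep {n : ℕ} {g : GLInf k} (hg : g ∈ GLFrom k n) (v : ℕ →₀ k) :
    sh k n (ret k n (stdRep k g v)) = stdRep k g (sh k n (ret k n v)) := by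
  have h1 : ∀ x : ℕ →₀ k, ∀ j < n, sh k n (ret k n x) j = 0 := fun x j hj => sh_apply_of_lt _ _ hj
  have h2 : ∀ x : ℕ →₀ k, (∀ j < n, x j = 0) → sh k n (ret k n x) = x := by
    intro x hx
    ext j
    by_cases hj : j < n
    · rw [h1 _ _ hj, hx j hj]
    · obtain ⟨i, rfl⟩ : ∃ i, j = i + n := ⟨j - n, by omega⟩
      simp
  have h3 : stdRep k g (v - sh k n (ret k n v)) = v - sh k n (ret k n v) := by
    have := map_eq_zero_of_support (stdRep k g - LinearMap.id) (v - sh k n (ret k n v))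
      fun j hj => ?_
    · simpa [sub_eq_zero] using this
    · have hjn : j < n := by
        by_contra hjn
        obtain ⟨i, rfl⟩ : ∃ i, j = i + n := ⟨j - n, by omega⟩
        simp at hj
      simp [hg.1 j hjn]
  have h4 : stdRep k g v = (v - sh k n (ret k n v)) + stdRep k g (sh k n (ret k n v)) := by
    conv_rhs => rw [← h3]
    rw [← map_add, sub_add_cancel]
  rw [h4, map_add, map_add, ret_sub, map_zero, zero_add]
  exact h2 _ fun j hj => by rw [hg.2 _ j hj, h1 _ j hj]

variable (k) in
/-- The projection of `𝐕^{⊗d}` that kills the words with a letter `< n`. -/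
def highT (n d : ℕ) : Tens k d →ₗ[k] Tens k d :=
  PiTensorProduct.map fun _ => sh k n ∘ₗ ret k n

lemma highT_word (n : ℕ) {d : ℕ} (w : Fin d → ℕ) :
    highT k n d (word k w) = if ∀ i, n ≤ w i then word k w else 0 := by
  rw [highT, word, PiTensorProduct.map_tprod]
  split_ifs with h
  · congr 1
    ext1 i
    obtain ⟨j, hj⟩ : ∃ j, w i = j + n := ⟨w i - n, by have := h i; omega⟩
    rw [hj, LinearMap.comp_apply, ← sh_single, ret_sh]
  · push Not at h
    obtain ⟨i, hi⟩ := h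
    exact (PiTensorProduct.tprod k).map_coord_zero i (by simp [ret_single_of_lt hi])

lemma highT_tensorRep {n d : ℕ} {g : GLInf k} (hg : g ∈ GLFrom k n) (x : Tens k d) :
    highT k n d (tensorRep k (Fin d) g x) = tensorRep k (Fin d) g (highT k n d x) := by
  have : highT k n d ∘ₗ tensorRep k (Fin d) g = tensorRep k (Fin d) g ∘ₗ highT k n d := by
    ext v
    simp [highT, sh_ret_stdRep hg]
  exact LinearMap.congr_fun this x

variable {R : Type v} [CommRing R] [Algebra k R] {α : GLInf k →* (R ≃ₐ[k] R)}

lemma wordCoeff_permT_highT {n d : ℕ} (τ : Equiv.Perm (Fin d)) (w : Fin d → ℕ)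
    (y : R ⊗[k] Tens k d) :
    wordCoeff R w ((permT τ⁻¹ ∘ₗ highT k n d).baseChange R y) =
      if ∀ i, n ≤ w i then wordCoeff R (w ∘ τ) y else 0 := by
  have : wordCoeff R w ∘ₗ (permT τ⁻¹ ∘ₗ highT k n d).baseChange R =
      if ∀ i, n ≤ w i then wordCoeff R (w ∘ τ) else 0 := by
    refine linearMap_ext_baseChange_word fun w' => ?_
    have h1 : w' ∘ ⇑τ⁻¹ = w ↔ w' = w ∘ τ := by
      constructor
      · rintro rfl; ext; simp
      · rintro rfl; ext; simp
    rw [LinearMap.comp_apply, LinearMap.baseChange_tmul, LinearMap.comp_apply, highT_word]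
    by_cases hw' : ∀ i, n ≤ w' i
    · rw [if_pos hw', permT_word, wordCoeff_tmul_word]
      by_cases h : w' = w ∘ τ
      · have hw : ∀ i, n ≤ w i := fun i => by
          have := hw' (τ.symm i)
          simpa [h] using this
        rw [if_pos (h1.2 h), if_pos hw, wordCoeff_tmul_word, if_pos h]
      · rw [if_neg (mt h1.1 h)]
        split_ifs
        · rw [wordCoeff_tmul_word, if_neg h]
        · rfl
    · rw [if_neg hw', map_zero, TensorProduct.tmul_zero, map_zero]
      split_ifs with hw
      · rw [wordCoeff_tmul_word, if_neg]
        rintro rfl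
        exact hw' fun i => hw _
      · rfl
  have h2 := LinearMap.congr_fun this y
  rw [LinearMap.comp_apply] at h2
  rw [h2]
  split_ifs <;> rfl

/-- The map `(x_j) ↦ ∑ λ(τ,j) τ⁻¹ x_j` on the part of `R ⊗ 𝐕^{⊗d}` in the coordinates from `n`
on. -/
def topMap {d : ℕ} {J : Type*} [Fintype J] (n : ℕ) (lam : Equiv.Perm (Fin d) × J → R) :
    (J → R ⊗[k] Tens k d) →ₗ[R] R ⊗[k] Tens k d :=
  ∑ i, lam i • (permT i.1⁻¹ ∘ₗ highT k n d).baseChange R ∘ₗ LinearMap.proj i.2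

lemma topMap_apply {d : ℕ} {J : Type*} [Fintype J] (n : ℕ) (lam : Equiv.Perm (Fin d) × J → R)
    (x : J → R ⊗[k] Tens k d) :
    topMap n lam x = ∑ i, lam i • (permT i.1⁻¹ ∘ₗ highT k n d).baseChange R (x i.2) := by
  simp [topMap]

lemma wordCoeff_topMap {d : ℕ} {J : Type*} [Fintype J] (n : ℕ)
    (lam : Equiv.Perm (Fin d) × J → R) (x : J → R ⊗[k] Tens k d) (w : Fin d → ℕ) :
    wordCoeff R w (topMap n lam x) =
      if ∀ i, n ≤ w i then ∑ i, lam i * wordCoeff R (w ∘ i.1) (x i.2) else 0 := by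
  rw [topMap_apply, map_sum]
  simp_rw [map_smul, wordCoeff_permT_highT]
  split_ifs <;> simp

lemma semiRep_baseChange {P P' : Type*} [AddCommMonoid P] [Module k P] [AddCommMonoid P']
    [Module k P'] (π : Representation k (GLInf k) P) (π' : Representation k (GLInf k) P')
    (A : P →ₗ[k] P') (g : GLInf k) (hA : ∀ x, A (π g x) = π' g (A x)) (x : R ⊗[k] P) :
    A.baseChange R (semiRep α π g x) = semiRep α π' g (A.baseChange R x) := by
  induction x using TensorProduct.induction_on with
  | zero => simp
  | tmul r p => simp [hA]
  | add x y hx hy => simp only [map_add, hx, hy]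

lemma topMap_semiRep {d : ℕ} {J : Type*} [Fintype J] {n : ℕ}
    {lam : Equiv.Perm (Fin d) × J → R} {g : GLInf k} (hg : g ∈ GLFrom k n)
    (hlam : ∀ i, α g (lam i) = lam i) (x : J → R ⊗[k] Tens k d) :
    topMap n lam (fun j => semiRep α (tensorRep k (Fin d)) g (x j)) =
      semiRep α (tensorRep k (Fin d)) g (topMap n lam x) := by
  rw [topMap_apply, topMap_apply, map_sum]
  refine Finset.sum_congr rfl fun i _ => ?_
  rw [semiRep_smul, hlam, semiRep_baseChange (π' := tensorRep k (Fin d))]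
  intro y
  rw [LinearMap.comp_apply, LinearMap.comp_apply, highT_tensorRep hg, permT_tensorRep]

end HighPart

section GenericFreeness

variable {R : Type v} [CommRing R] [Algebra k R] {α : GLInf k →* (R ≃ₐ[k] R)}
  {M : Type w} [AddCommGroup M] [Module k M] [Module R M] [IsScalarTower k R M]
  {ρ : Representation k (GLInf k) M}

lemma liftBaseChange_semiRep (hρ : IsSemilinear α ρ) {P : Type*} [AddCommMonoid P] [Module k P]
    (π : Representation k (GLInf k) P) (f : P →ₗ[k] M) (g : GLInf k)
    (hf : ∀ x, f (π g x) = ρ g (f x)) (x : R ⊗[k] P) :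
    f.liftBaseChange R (semiRep α π g x) = ρ g (f.liftBaseChange R x) := by
  induction x using TensorProduct.induction_on with
  | zero => simp
  | tmul r p => simp [hf, hρ g]
  | add x y hx hy => simp only [map_add, hx, hy]

variable (k) in
/-- Insertion of the tensor factor `e_u` at the position `l`. -/
def insertT {d : ℕ} (l : Fin (d + 1)) (u : ℕ) : Tens k d →ₗ[k] Tens k (d + 1) :=
  PiTensorProduct.lift
    ((PiTensorProduct.tprod k : MultilinearMap k (fun _ : Fin (d + 1) => (ℕ →₀ k))
      (Tens k (d + 1))).curryMid l (Finsupp.single u 1))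

lemma insertT_tprod {d : ℕ} (l : Fin (d + 1)) (u : ℕ) (v : Fin d → ℕ →₀ k) :
    insertT k l u (PiTensorProduct.tprod k v) =
      PiTensorProduct.tprod k (l.insertNth (Finsupp.single u 1) v : Fin (d + 1) → ℕ →₀ k) := by
  rw [insertT, PiTensorProduct.lift.tprod]
  rfl

lemma insertT_tensorRep {d : ℕ} (l : Fin (d + 1)) (u : ℕ) {g : GLInf k}
    (hg : stdRep k g (Finsupp.single u 1) = Finsupp.single u 1) (x : Tens k d) :
    insertT k l u (tensorRep k (Fin d) g x) = tensorRep k (Fin (d + 1)) g (insertT k l u x) := by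
  have : insertT k l u ∘ₗ tensorRep k (Fin d) g =
      tensorRep k (Fin (d + 1)) g ∘ₗ insertT k l u := by
    ext v
    simp only [LinearMap.compMultilinearMap_apply, LinearMap.comp_apply, tensorRep_tprod,
      insertT_tprod]
    congr 1
    ext1 i
    refine Fin.succAboveCases l ?_ (fun j => ?_) i
    · simp [hg]
    · simp
  exact LinearMap.congr_fun this x

/-- The generators of `lowSpan` as maps on tensor powers of lower degree. -/
def lowFamily {ι : ℕ → Type} (f : ∀ e, ι e → Tens k e →ₗ[k] M) (n : ℕ) :
    ∀ e, (ι e ⊕ ι (e + 1) × Fin (e + 1) × Fin n) → Tens k e →ₗ[k] M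
  | e, Sum.inl i => f e i
  | e, Sum.inr (i, l, u) => f (e + 1) i ∘ₗ insertT k l u

lemma lowFamily_equivariant {ι : ℕ → Type} {f : ∀ e, ι e → Tens k e →ₗ[k] M} {n : ℕ}
    (hf : ∀ e i, EquivariantFrom ρ n (f e i)) (e : ℕ) (i) :
    EquivariantFrom ρ n (lowFamily f n e i) := by
  rcases i with i | ⟨i, l, u⟩
  · exact hf e i
  · intro g hg x
    change f (e + 1) i (insertT k l u _) = ρ g (f (e + 1) i (insertT k l u x))
    rw [insertT_tensorRep l _ (hg.1 u u.2), hf _ i g hg]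

lemma lowSpan_le_genSpan {ι : ℕ → Type} (f : ∀ e, ι e → Tens k e →ₗ[k] M) (d n : ℕ) :
    lowSpan R f d n ≤ genSpan R (lowFamily f n) d := by
  refine Submodule.span_le.2 ?_
  rintro _ (⟨e, he, i, x, rfl⟩ | ⟨i, v, ⟨l, u, hu, hv⟩, rfl⟩)
  · exact Submodule.subset_span ⟨e, he, Sum.inl i, x, rfl⟩
  · cases d with
    | zero => exact l.elim0
    | succ e =>
      refine Submodule.subset_span ⟨e, by omega, Sum.inr (i, l, ⟨u, hu⟩),
        PiTensorProduct.tprod k (l.removeNth v), ?_⟩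
      change f (e + 1) i (insertT k l u _) = _
      rw [insertT_tprod, ← hv, Fin.insertNth_self_removeNth]

variable (α ρ) in
/-- Equivariance of a linear map on a submodule for `GL` acting on the coordinates from `n` on.
(The submodule need not be stable.) -/
def EquivariantOn (L : Submodule R M) (n : ℕ) {d : ℕ} (Φ : L →ₗ[R] R ⊗[k] Tens k d) : Prop :=
  ∀ g ∈ GLFrom k n, ∀ x y : L, (y : M) = ρ g x → Φ y = semiRep α (tensorRep k (Fin d)) g (Φ x)

variable (α ρ) in
/-- The submodule `L` embeds into a finite sum of modules `R ⊗ 𝐕^{⊗e}`, equivariantly for `GL`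
acting on the coordinates from `n` on. -/
def Separated (L : Submodule R M) (n : ℕ) : Prop :=
  ∃ (I : Type) (_ : Finite I) (e : I → ℕ) (Φ : ∀ i, L →ₗ[R] R ⊗[k] Tens k (e i)),
    (∀ i, EquivariantOn α ρ L n (Φ i)) ∧ ∀ x, (∀ i, Φ i x = 0) → x = 0

variable [CharZero k] [IsDomain R]

/-- The relations of top degree stabilize, and, once they do, there are an invariant element
`h ≠ 0` and an invariant matrix `p` that is an `h`-fold projection onto them. -/
lemma exists_stable_projection (hρ : IsSemilinear α ρ)
    {ι : ℕ → Type} {f : ∀ e, ι e → Tens k e →ₗ[k] M} {n d : ℕ} [Fintype (ι d)]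
    (hf : ∀ e i, EquivariantFrom ρ n (f e i)) :
    ∃ (N : ℕ) (h : R) (p : Equiv.Perm (Fin d) × ι d → Equiv.Perm (Fin d) × ι d → R),
      n ≤ N ∧ h ≠ 0 ∧ h ∈ fixedSub α N ∧ (∀ i i', p i i' ∈ fixedSub α N) ∧
      (∀ i, relMap (f d) (fun i' => p i' i) (word k fun l => N + l) ∈ lowSpan R f d N) ∧
      (∀ σ i' i, p (σ * i'.1, i'.2) (σ * i.1, i.2) = p i' i) ∧
      ∀ N', N ≤ N' → ∀ c : Equiv.Perm (Fin d) × ι d → R, (∀ i, c i ∈ fixedSub α N') →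
        relMap (f d) c (word k fun l => N' + l) ∈ lowSpan R f d N' →
        ∀ i', ∑ i, p i' i * c i = h * c i' := by
  classical
  let K := FractionRing R
  -- the invariant relations between the values at one tensor of distinct basis vectors
  let rels : ℕ → Set (Equiv.Perm (Fin d) × ι d → R) := fun N =>
    {c | (∀ i, c i ∈ fixedSub α N) ∧
      relMap (f d) c (word k fun l => N + l) ∈ lowSpan R f d N}
  have hmono : ∀ N N', n ≤ N → N ≤ N' → rels N ⊆ rels N' := by
    rintro N N' hN hNN' c ⟨hc, h⟩
    exact ⟨fun i g hg => hc i g (GLFrom_le hNN' hg),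
      lowSpan_mono f d hNN' (relMap_mem_lowSpan hρ hN hf hc h _)⟩
  let toK : (Equiv.Perm (Fin d) × ι d → R) → (Equiv.Perm (Fin d) × ι d → K) :=
    fun c i => algebraMap R K (c i)
  let Q : ℕ →o Submodule K (Equiv.Perm (Fin d) × ι d → K) :=
    ⟨fun m => Submodule.span K (toK '' rels (n + m)), fun a b hab =>
      Submodule.span_mono (Set.image_mono (hmono _ _ (by omega) (by omega)))⟩
  -- the spans over `K` increase in a fixed finite-dimensional space
  obtain ⟨m, hm⟩ := monotone_stabilizes_iff_noetherian.2 inferInstance Q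
  have hchar : CharZero (fixedSub α (n + m)) :=
    charZero_of_injective_algebraMap (algebraMap k _).injective
  let q : Submodule (fixedSub α (n + m)) (Equiv.Perm (Fin d) × ι d → fixedSub α (n + m)) :=
    { carrier := {c | relMap (f d) (fun i => (c i : R)) (word k fun l => (n + m) + l) ∈
        lowSpan R f d (n + m)}
      add_mem' := by
        intro a b ha hb
        have := (lowSpan R f d (n + m)).add_mem ha hb
        simp only [Set.mem_ofPred_eq, relMap_apply, ← Finset.sum_add_distrib, ← add_smul] at this ⊢
        exact this
      zero_mem' := by simp [relMap_apply]
      smul_mem' := by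
        intro s c hc
        have := (lowSpan R f d (n + m)).smul_mem (s : R) hc
        simp only [Set.mem_ofPred_eq, relMap_apply, Finset.smul_sum, smul_smul] at this ⊢
        exact this }
  -- permuting the letters of the word `N, N + 1, …` permutes the relations
  have hq : ∀ c ∈ q, ∀ σ : Equiv.Perm (Fin d), (fun i : _ × ι d => c (σ * i.1, i.2)) ∈ q := by
    intro c hc σ
    have h1 := relMap_mem_lowSpan hρ (Nat.le_add_right n m) hf (fun i => (c i).2) hc
      ((fun l : Fin d => (n + m) + l) ∘ ⇑σ⁻¹)
    change relMap (f d) (fun i => ((c (σ * i.1, i.2) : fixedSub α (n + m)) : R))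
      (word k fun l => (n + m) + l) ∈ lowSpan R f d (n + m)
    rw [relMap_apply] at h1 ⊢
    convert h1 using 1
    refine Fintype.sum_equiv ((Equiv.mulLeft σ).prodCongr (Equiv.refl _)) _ _ fun i => ?_
    rw [permT_word, permT_word]
    congr 3
    ext l
    simp
  obtain ⟨h, p, h0, hp, hpc, hpσ⟩ := exists_projMatrix_equivariant q hq
  refine ⟨n + m, h, fun i i' => p i i', by omega, by simpa using h0, h.2, fun i i' => (p i i').2,
    hp, fun σ i' i => congrArg _ (hpσ σ i' i), fun N' hN' c hc hrel i' => ?_⟩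
  have hcQ : toK c ∈ Q m := by
    obtain ⟨a, rfl⟩ : ∃ a, N' = n + a := ⟨N' - n, by omega⟩
    rw [hm a (by omega)]
    exact Submodule.subset_span ⟨c, ⟨hc, hrel⟩, rfl⟩
  have hK : ∀ x ∈ Q m, ∑ i, algebraMap R K (p i' i) * x i = algebraMap R K h * x i' := by
    intro x hx
    induction hx using Submodule.span_induction with
    | mem x hx =>
      obtain ⟨c, ⟨hc, hrel⟩, rfl⟩ := hx
      have h1 := hpc (fun i => ⟨c i, hc i⟩) hrel i'
      have h2 := congrArg (fun r : fixedSub α (n + m) => algebraMap R K (r : R)) h1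
      simpa [toK] using h2
    | zero => simp
    | add x y _ _ hx hy => simp only [Pi.add_apply, mul_add, Finset.sum_add_distrib, hx, hy]
    | smul a x _ hx =>
      simp only [Pi.smul_apply, smul_eq_mul]
      rw [mul_left_comm, ← hx, Finset.mul_sum]
      exact Finset.sum_congr rfl fun _ _ => by ring
  apply IsFractionRing.injective R K
  have := hK _ hcQ
  simpa [toK] using this

/-- The top-degree part splits off. With `λ = h - p` for the projection `p` onto the relations of
top degree, the maps `topMap λ_j` descend to the module and, together with
`m ↦ h m - ∑ f_j (topMap λ_j m)`, whose values have lower degree, they are jointly injective. -/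
theorem separated_genSpan [Module.IsTorsionFree R M] (hα : IsAlgebraicAction α)
    (hρ : IsSemilinear α ρ) (d : ℕ) :
    ∀ (n : ℕ) (ι : ℕ → Type) (_ : ∀ e, Finite (ι e)) (f : ∀ e, ι e → Tens k e →ₗ[k] M),
      (∀ e i, EquivariantFrom ρ n (f e i)) → ∃ N, n ≤ N ∧ Separated α ρ (genSpan R f d) N := by
  classical
  induction d with
  | zero =>
    intro n ι _ f _
    refine ⟨n, le_rfl, Empty, inferInstance, Empty.elim, fun i => i.elim, fun i => i.elim,
      fun x _ => ?_⟩
    have hx : genSpan R f 0 ≤ ⊥ := Submodule.span_le.2 fun m ⟨e, he, _⟩ => absurd he (by simp)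
    exact Subtype.ext ((Submodule.mem_bot R).1 (hx x.2))
  | succ d ih =>
    intro n ι _ f hf
    have := Fintype.ofFinite (ι d)
    obtain ⟨n₁, h, p, hn₁, h0, hh, hp, hprel, hpσ, hpc⟩ := exists_stable_projection hρ (d := d) hf
    have hf₁ : ∀ e i, EquivariantFrom ρ n₁ (f e i) := fun e i g hg => hf e i g (GLFrom_le hn₁ hg)
    obtain ⟨N, hN, I, _, e, Φ, hΦ, hΦinj⟩ := ih n₁ _ (fun e => inferInstance) (lowFamily f n₁)
      (lowFamily_equivariant hf₁)
    -- the rows of `h - p` with index `(1, j)`: they annihilate every relation of top degree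
    let lam : ι d → Equiv.Perm (Fin d) × ι d → R := fun j i =>
      (if i = (1, j) then h else 0) - p (1, j) i
    have hlam : ∀ j i, lam j i ∈ fixedSub α n₁ := fun j i => by
      refine sub_mem ?_ (hp _ _)
      split_ifs
      · exact hh
      · exact zero_mem _
    -- `F` presents a module containing `genSpan R f (d + 1)`
    let F : (ι d → R ⊗[k] Tens k d) × lowSpan R f d n₁ →ₗ[R] M :=
      (∑ j, (f d j).liftBaseChange R ∘ₗ LinearMap.proj j).coprod (Submodule.subtype _)
    have hF : ∀ x l, F (x, l) = ∑ j, (f d j).liftBaseChange R (x j) + l := by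
      intro x l
      simp [F]
    -- the coefficients of `topMap n₁ (lam j) x` are obtained by applying `lam j` to a relation
    have hker : ∀ j, LinearMap.ker F ≤ LinearMap.ker (topMap n₁ (lam j) ∘ₗ LinearMap.fst R _ _) := by
      rintro j ⟨x, l⟩ hx
      rw [LinearMap.mem_ker, hF] at hx
      rw [LinearMap.mem_ker, LinearMap.comp_apply, LinearMap.fst_apply]
      refine eq_zero_of_wordCoeff _ fun w => ?_
      rw [wordCoeff_topMap]
      split_ifs with hw
      · have hx' : ∑ j, (f d j).liftBaseChange R (x j) ∈ lowSpan R f d n₁ := by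
          rw [eq_neg_of_add_eq_zero_left hx]
          exact neg_mem l.2
        obtain ⟨N₀, hN₀⟩ := relation_mem_lowSpan hα hρ hf₁ x hx' w hw
        obtain ⟨N₁, hN₁⟩ := hα.exists_mem_fixedSub Finset.univ
          fun i : Equiv.Perm (Fin d) × ι d => wordCoeff R (w ∘ i.1) (x i.2)
        have := hpc (n₁ + N₀ + N₁) (by omega) _ (fun i => hN₁ _ (by omega) i (Finset.mem_univ i))
          (hN₀ _ (by omega)) (1, j)
        simp only [lam, sub_mul, Finset.sum_sub_distrib, this, ite_mul, zero_mul,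
          Finset.sum_ite_eq', Finset.mem_univ, if_true, sub_self]
      · rfl
    choose T hT using fun j => exists_comp_rangeRestrict F _ (hker j)
    have hle : genSpan R f (d + 1) ≤ LinearMap.range F := by
      refine Submodule.span_le.2 ?_
      rintro _ ⟨e, he, i, x, rfl⟩
      rcases Nat.lt_succ_iff_lt_or_eq.1 he with he | rfl
      · exact ⟨(0, ⟨_, Submodule.subset_span (Or.inl ⟨e, he, i, x, rfl⟩)⟩), by simp [hF]⟩
      · refine ⟨(Pi.single i (1 ⊗ₜ x), 0), ?_⟩
        rw [hF, Finset.sum_eq_single i]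
        · simp
        · intro j _ hj
          simp [hj]
        · simp
    let Ψ : ∀ j, genSpan R f (d + 1) →ₗ[R] R ⊗[k] Tens k d := fun j =>
      T j ∘ₗ Submodule.inclusion hle
    have hΨ : ∀ j (m : genSpan R f (d + 1)) x l, F (x, l) = m →
        Ψ j m = topMap n₁ (lam j) x := by
      rintro j ⟨m, hm⟩ x l h
      subst h
      exact hT j (x, l)
    have hexists : ∀ m : genSpan R f (d + 1), ∃ x l, F (x, l) = m := fun m => by
      obtain ⟨⟨x, l⟩, hx⟩ := hle m.2
      exact ⟨x, l, hx⟩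
    have hΨeq : ∀ j, EquivariantOn α ρ (genSpan R f (d + 1)) n₁ (Ψ j) := by
      intro j g hg m m' hm
      obtain ⟨x, l, hx⟩ := hexists m
      rw [hΨ j m x l hx, ← topMap_semiRep hg fun i => hlam j i g hg]
      refine hΨ j m' _ ⟨ρ g l, lowSpan_stable hρ le_rfl hf₁ d hg l.2⟩ ?_
      rw [hm, ← hx, hF, hF, map_add, map_sum]
      congr 1
      exact Finset.sum_congr rfl fun j' _ => liftBaseChange_semiRep hρ _ _ g (hf₁ d j' g hg) _
    -- the complementary part has values of lower degree
    let S₀ : genSpan R f (d + 1) →ₗ[R] M :=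
      h • Submodule.subtype _ - ∑ j, (f d j).liftBaseChange R ∘ₗ Ψ j
    have hS₀ : ∀ m, S₀ m = h • (m : M) - ∑ j, (f d j).liftBaseChange R (Ψ j m) := by
      intro m
      simp [S₀]
    -- in top degree, `S₀` is given by the columns of `p`, which are relations modulo `lowSpan`
    let D : (ι d → R ⊗[k] Tens k d) →ₗ[R] M :=
      h • (∑ j, (f d j).liftBaseChange R ∘ₗ LinearMap.proj j) -
        ∑ j, (f d j).liftBaseChange R ∘ₗ topMap n₁ (lam j)
    have hD : ∀ x, D x ∈ lowSpan R f d n₁ := by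
      suffices ∀ j, (lowSpan R f d n₁).mkQ ∘ₗ D ∘ₗ LinearMap.single R _ j = 0 by
        intro x
        have h1 : (lowSpan R f d n₁).mkQ ∘ₗ D = 0 := LinearMap.pi_ext' this
        simpa using LinearMap.congr_fun h1 x
      intro j
      refine linearMap_ext_baseChange_word fun w => ?_
      rw [LinearMap.comp_apply, LinearMap.zero_apply, Submodule.mkQ_apply,
        Submodule.Quotient.mk_eq_zero, LinearMap.comp_apply, LinearMap.coe_single]
      have h1 : ∑ j', (f d j').liftBaseChange R
          ((Pi.single j (1 ⊗ₜ word k w) : ι d → R ⊗[k] Tens k d) j') = f d j (word k w) := by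
        rw [Finset.sum_eq_single j]
        · simp
        · intro j' _ hj
          simp [hj]
        · simp
      have h2 : ∀ j', topMap n₁ (lam j') (Pi.single j ((1 : R) ⊗ₜ word k w)) =
          if ∀ i, n₁ ≤ w i then ∑ τ, lam j' (τ, j) • ((1 : R) ⊗ₜ word k (w ∘ ⇑τ⁻¹)) else 0 := by
        intro j'
        rw [topMap_apply, Fintype.sum_prod_type]
        have h3 : ∀ τ : Equiv.Perm (Fin d), ∑ j'', lam j' (τ, j'') •
            (permT τ⁻¹ ∘ₗ highT k n₁ d).baseChange R
              ((Pi.single j ((1 : R) ⊗ₜ word k w) : ι d → R ⊗[k] Tens k d) j'') =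
            if ∀ i, n₁ ≤ w i then lam j' (τ, j) • ((1 : R) ⊗ₜ word k (w ∘ ⇑τ⁻¹)) else 0 := by
          intro τ
          rw [Finset.sum_eq_single j]
          · rw [Pi.single_eq_same, LinearMap.baseChange_tmul, LinearMap.comp_apply, highT_word]
            split_ifs
            · rw [permT_word]
            · simp
          · intro j'' _ hj
            simp [hj]
          · simp
        simp only [h3]
        split_ifs <;> simp
      simp only [D, LinearMap.sub_apply, LinearMap.smul_apply, LinearMap.sum_apply,
        LinearMap.comp_apply, LinearMap.proj_apply, h1, h2]
      split_ifs with hw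
      · have h4 := relMap_mem_lowSpan hρ hn₁ hf (fun i => hp i (1, j)) (hprel (1, j)) w
        convert h4 using 1
        rw [relMap_apply, Fintype.sum_prod_type, Finset.sum_comm]
        have h5 : ∀ j', (f d j').liftBaseChange R
            (∑ τ, lam j' (τ, j) • ((1 : R) ⊗ₜ word k (w ∘ ⇑τ⁻¹))) =
            (if j' = j then h • f d j (word k w) else 0) -
              ∑ τ : Equiv.Perm (Fin d), p (τ, j') (1, j) • f d j' (permT τ (word k w)) := by
          intro j'
          rw [map_sum]
          simp only [map_smul, LinearMap.liftBaseChange_tmul, one_smul, lam, sub_smul,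
            Finset.sum_sub_distrib, ite_smul, zero_smul, Prod.mk.injEq]
          congr 1
          · split_ifs with hj
            · subst hj
              simp [show ⇑(Equiv.symm (1 : Equiv.Perm (Fin d))) = id from rfl]
            · rw [Finset.sum_eq_zero]
              intro τ _
              rw [if_neg fun h => hj h.2.symm]
          · refine Fintype.sum_equiv (Equiv.inv _) _ _ fun τ => ?_
            rw [permT_word]
            have := hpσ τ⁻¹ (1, j') (τ, j)
            simp only [mul_one, inv_mul_cancel] at this
            rw [← this]
            rfl
        simp only [h5, Finset.sum_sub_distrib, Finset.sum_ite_eq', Finset.mem_univ, if_true]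
        abel
      · simp only [map_zero, Finset.sum_const_zero, sub_zero]
        push Not at hw
        obtain ⟨l, hl⟩ := hw
        exact Submodule.smul_mem _ _ (map_tprod_mem_lowSpan f j _ l (w l) hl rfl)
    have hS₀mem : ∀ m, S₀ m ∈ genSpan R (lowFamily f n₁) d := by
      intro m
      apply lowSpan_le_genSpan
      obtain ⟨x, l, hx⟩ := hexists m
      have h1 : S₀ m = D x + h • (l : M) := by
        rw [hS₀, ← hx, hF]
        simp only [hΨ _ m x l hx, D, LinearMap.sub_apply, LinearMap.smul_apply,
          LinearMap.sum_apply, LinearMap.comp_apply, LinearMap.proj_apply]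
        rw [smul_add]
        abel
      rw [h1]
      exact add_mem (hD x) (Submodule.smul_mem _ _ l.2)
    let S : genSpan R f (d + 1) →ₗ[R] genSpan R (lowFamily f n₁) d := S₀.codRestrict _ hS₀mem
    refine ⟨N, by omega, ι d ⊕ I, inferInstance, Sum.elim (fun _ => d) e,
      Sum.rec (fun j => Ψ j) (fun i => Φ i ∘ₗ S), ?_, ?_⟩
    · rintro (j | i)
      · exact fun g hg => hΨeq j g (GLFrom_le hN hg)
      · intro g hg m m' hm
        refine hΦ i g hg (S m) (S m') ?_
        change S₀ m' = ρ g (S₀ m)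
        rw [hS₀, hS₀, map_sub, map_sum, hm, hρ, hh g (GLFrom_le hN hg)]
        congr 1
        refine Finset.sum_congr rfl fun j _ => ?_
        rw [hΨeq j g (GLFrom_le hN hg) m m' hm]
        exact liftBaseChange_semiRep hρ _ _ g (hf₁ d j g (GLFrom_le hN hg)) _
    · intro m hm
      -- where all `Ψ j` vanish, `S` is multiplication by `h`
      have h1 : ∀ j, Ψ j m = 0 := fun j => hm (Sum.inl j)
      have h2 : S m = 0 := hΦinj _ fun i => hm (Sum.inr i)
      have h3 : S₀ m = 0 := congrArg Subtype.val h2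
      rw [hS₀] at h3
      simp only [h1, map_zero, Finset.sum_const_zero, sub_zero] at h3
      exact Subtype.ext ((smul_eq_zero.1 h3).resolve_left h0)

end GenericFreeness

/-! ### Representations that embed into sums of tensor powers -/

section JointlyInjective

variable {P Q : Type*} [AddCommMonoid P] [Module k P] [AddCommMonoid Q] [Module k Q]

/-- Tensoring with a vector space preserves joint injectivity of (possibly infinite) families. -/
lemma eq_zero_of_lTensor {I : Type*} {Q' : I → Type*} [∀ i, AddCommMonoid (Q' i)]
    [∀ i, Module k (Q' i)] (θ : ∀ i, Q →ₗ[k] Q' i) (hθ : ∀ x, (∀ i, θ i x = 0) → x = 0)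
    (x : P ⊗[k] Q) (h : ∀ i, (θ i).lTensor P x = 0) : x = 0 := by
  classical
  let _ : AddCommGroup P := Module.addCommMonoidToAddCommGroup k
  let b := Basis.ofVectorSpace k P
  apply (TensorProduct.equivFinsuppOfBasisLeft b).injective
  rw [map_zero]
  ext j
  rw [TensorProduct.equivFinsuppOfBasisLeft_apply]
  refine hθ _ fun i => ?_
  have h1 : θ i ∘ₗ (TensorProduct.lid k Q).toLinearMap ∘ₗ (b.coord j).rTensor Q =
      (TensorProduct.lid k (Q' i)).toLinearMap ∘ₗ (b.coord j).rTensor (Q' i) ∘ₗ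
        (θ i).lTensor P := by
    ext p q
    simp
  have h2 := LinearMap.congr_fun h1 x
  simp only [LinearMap.comp_apply, h i, map_zero] at h2
  exact h2

lemma eq_zero_of_map {I J : Type*} {P' : I → Type*} [∀ i, AddCommMonoid (P' i)]
    [∀ i, Module k (P' i)] {Q' : J → Type*} [∀ i, AddCommMonoid (Q' i)]
    [∀ i, Module k (Q' i)] (η : ∀ i, P →ₗ[k] P' i) (hη : ∀ x, (∀ i, η i x = 0) → x = 0)
    (θ : ∀ i, Q →ₗ[k] Q' i) (hθ : ∀ x, (∀ i, θ i x = 0) → x = 0)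
    (x : P ⊗[k] Q) (h : ∀ i j, TensorProduct.map (η i) (θ j) x = 0) : x = 0 := by
  refine eq_zero_of_lTensor θ hθ x fun j => ?_
  apply (TensorProduct.comm k P (Q' j)).injective
  rw [map_zero]
  refine eq_zero_of_lTensor η hη _ fun i => ?_
  have h1 : (η i).lTensor (Q' j) ∘ₗ (TensorProduct.comm k P (Q' j)).toLinearMap ∘ₗ
      (θ j).lTensor P = (TensorProduct.comm k (P' i) (Q' j)).toLinearMap ∘ₗ
        TensorProduct.map (η i) (θ j) := by
    ext p q
    simp
  have h2 := LinearMap.congr_fun h1 x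
  simp only [LinearMap.comp_apply, h i, map_zero] at h2
  exact h2

end JointlyInjective

/-- A representation of `GL` embeds into a direct sum of tensor powers of `𝐕`: it has a locally
finite, jointly injective family of equivariant maps to tensor powers. -/
def EmbedsInTens {P : Type*} [AddCommMonoid P] [Module k P]
    (π : Representation k (GLInf k) P) : Prop :=
  ∃ (I : Type) (d : I → ℕ) (θ : ∀ i, P →ₗ[k] Tens k (d i)),
    (∀ i g x, θ i (π g x) = tensorRep k (Fin (d i)) g (θ i x)) ∧
    (∀ x, {i | θ i x ≠ 0}.Finite) ∧ ∀ x, (∀ i, θ i x = 0) → x = 0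

section Embeds

variable {P Q : Type*} [AddCommMonoid P] [Module k P] [AddCommMonoid Q] [Module k Q]
  {π : Representation k (GLInf k) P} {π' : Representation k (GLInf k) Q}

lemma EmbedsInTens.of_family {J : Type} {Q : J → Type*} [∀ j, AddCommMonoid (Q j)]
    [∀ j, Module k (Q j)] {π' : ∀ j, Representation k (GLInf k) (Q j)}
    (h : ∀ j, EmbedsInTens (π' j)) (χ : ∀ j, P →ₗ[k] Q j)
    (hχ : ∀ j g x, χ j (π g x) = π' j g (χ j x)) (hfin : ∀ x, {j | χ j x ≠ 0}.Finite)
    (hinj : ∀ x, (∀ j, χ j x = 0) → x = 0) : EmbedsInTens π := by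
  choose I d θ h1 h2 h3 using h
  refine ⟨Σ j, I j, fun i => d i.1 i.2, fun i => θ i.1 i.2 ∘ₗ χ i.1, fun i g x => ?_, fun x => ?_,
    fun x hx => hinj x fun j => h3 j _ fun i => hx ⟨j, i⟩⟩
  · rw [LinearMap.comp_apply, hχ, h1]
    rfl
  · refine ((hfin x).biUnion fun j _ => (h2 j (χ j x)).image (Sigma.mk j)).subset ?_
    rintro ⟨j, i⟩ hi
    refine Set.mem_biUnion (x := j) (fun h0 => hi ?_) ⟨i, hi, rfl⟩
    change θ j i (χ j x) = 0
    rw [h0, map_zero]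

lemma EmbedsInTens.of_injective (h : EmbedsInTens π') (χ : P →ₗ[k] Q)
    (hχ : ∀ g x, χ (π g x) = π' g (χ x)) (hinj : ∀ x, χ x = 0 → x = 0) : EmbedsInTens π :=
  EmbedsInTens.of_family (J := Unit) (fun _ => h) (fun _ => χ) (fun _ => hχ)
    (fun _ => Set.toFinite _) fun x hx => hinj x (hx ())

lemma tensorRep_mulEquiv {c d : ℕ} (g : GLInf k) (x : Tens k c ⊗[k] Tens k d) :
    TensorPower.mulEquiv (TensorProduct.map (tensorRep k (Fin c) g) (tensorRep k (Fin d) g) x) =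
      tensorRep k (Fin (c + d)) g (TensorPower.mulEquiv x) := by
  have : TensorPower.mulEquiv.toLinearMap ∘ₗ
      TensorProduct.map (tensorRep k (Fin c) g) (tensorRep k (Fin d) g) =
      tensorRep k (Fin (c + d)) g ∘ₗ TensorPower.mulEquiv.toLinearMap := by
    ext v w
    simp only [TensorProduct.AlgebraTensorModule.curry_apply, LinearMap.compMultilinearMap_apply,
      LinearMap.coe_restrictScalars, TensorProduct.curry_apply, LinearMap.comp_apply,
      TensorProduct.map_tmul, tensorRep_tprod, LinearEquiv.coe_coe]
    rw [← TensorPower.gMul_def, ← TensorPower.gMul_def, TensorPower.tprod_mul_tprod,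
      TensorPower.tprod_mul_tprod, tensorRep_tprod]
    congr 1
    ext1 i
    refine Fin.addCases (fun i => ?_) (fun i => ?_) i <;> simp
  exact LinearMap.congr_fun this x

lemma EmbedsInTens.tprod (h : EmbedsInTens π) (h' : EmbedsInTens π') :
    EmbedsInTens (π.tprod π') := by
  obtain ⟨I, d, θ, h1, h2, h3⟩ := h
  obtain ⟨I', d', θ', h1', h2', h3'⟩ := h'
  refine ⟨I × I', fun i => d i.1 + d' i.2, fun i => TensorPower.mulEquiv.toLinearMap ∘ₗ
    TensorProduct.map (θ i.1) (θ' i.2), fun i g x => ?_, fun x => ?_, fun x hx => ?_⟩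
  · rw [LinearMap.comp_apply, LinearMap.comp_apply, LinearEquiv.coe_coe, ← tensorRep_mulEquiv]
    congr 1
    induction x using TensorProduct.induction_on with
    | zero => simp
    | tmul p q => simp [h1, h1']
    | add x y hx hy => simp only [map_add, hx, hy]
  · induction x using TensorProduct.induction_on with
    | zero => simp
    | tmul p q =>
      refine ((h2 p).prod (h2' q)).subset ?_
      rintro ⟨i, j⟩ hij
      refine ⟨fun h0 => hij ?_, fun h0 => hij ?_⟩ <;> simp [h0]
    | add x y hx hy =>
      refine (hx.union hy).subset fun i hi => ?_
      by_contra hc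
      simp only [Set.mem_union, Set.mem_ofPred_eq, not_or, not_not] at hc
      exact hi (by rw [map_add, hc.1, hc.2, add_zero])
  · refine eq_zero_of_map θ h3 θ' h3' x fun i j => ?_
    have := hx (i, j)
    rw [LinearMap.comp_apply, LinearEquiv.coe_coe, LinearEquiv.map_eq_zero_iff] at this
    exact this

/-- The diagonal action on a tensor power of a representation. -/
def powRep (π : Representation k (GLInf k) P) (I : Type*) :
    Representation k (GLInf k) (⨂[k] _ : I, P) where
  toFun g := PiTensorProduct.map fun _ => π g
  map_one' := by simp only [map_one]; exact PiTensorProduct.map_one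
  map_mul' g h := by
    simp only [map_mul]
    exact PiTensorProduct.map_mul (fun _ => π g) (fun _ => π h)

@[simp] lemma powRep_tprod (π : Representation k (GLInf k) P) {I : Type*} (g : GLInf k)
    (v : I → P) : powRep π I g (PiTensorProduct.tprod k v) =
      PiTensorProduct.tprod k fun i => π g (v i) :=
  PiTensorProduct.map_tprod _ _

lemma embedsInTens_trivial (hπ : ∀ g, π g = 1) (φ : P →ₗ[k] k) (hφ : ∀ x, φ x = 0 → x = 0) :
    EmbedsInTens π := by
  refine ⟨Unit, fun _ => 0, fun _ => (PiTensorProduct.isEmptyEquiv (Fin 0)).symm.toLinearMap ∘ₗ φ,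
    fun _ g x => ?_, fun _ => Set.toFinite _, fun x hx => hφ x ?_⟩
  · rw [hπ]
    have : tensorRep k (Fin 0) g = LinearMap.id := by
      ext v
      simp only [LinearMap.compMultilinearMap_apply, tensorRep_tprod, LinearMap.id_apply]
      congr 1
      ext1 i
      exact i.elim0
    rw [this]
    rfl
  · have := hx ()
    rwa [LinearMap.comp_apply, LinearEquiv.coe_coe, LinearEquiv.map_eq_zero_iff] at this

lemma EmbedsInTens.powRep_fin (h : EmbedsInTens π) (D : ℕ) : EmbedsInTens (powRep π (Fin D)) := by
  induction D with
  | zero =>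
    refine embedsInTens_trivial (fun g => ?_)
      (PiTensorProduct.isEmptyEquiv (Fin 0)).toLinearMap fun x hx => ?_
    · ext v
      simp only [LinearMap.compMultilinearMap_apply, powRep_tprod, Module.End.one_apply]
      congr 1
      ext1 i
      exact i.elim0
    · rwa [LinearEquiv.coe_coe, LinearEquiv.map_eq_zero_iff] at hx
  | succ D ih =>
    let e : (⨂[k] _ : Fin (D + 1), P) ≃ₗ[k] (⨂[k] _ : Fin D, P) ⊗[k] P :=
      (TensorPower.mulEquiv (n := D) (m := 1)).symm.trans
        (TensorProduct.congr (LinearEquiv.refl k _) (PiTensorProduct.subsingletonEquiv (0 : Fin 1)))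
    have he : ∀ (v : Fin D → P) (p : P), e.symm (PiTensorProduct.tprod k v ⊗ₜ p) =
        PiTensorProduct.tprod k (Fin.snoc v p : Fin (D + 1) → P) := by
      intro v p
      simp only [e, LinearEquiv.trans_symm, LinearEquiv.trans_apply, LinearEquiv.symm_symm,
        TensorProduct.congr_symm_tmul, LinearEquiv.refl_symm, LinearEquiv.refl_apply,
        PiTensorProduct.subsingletonEquiv_symm_apply']
      rw [← TensorPower.gMul_def, TensorPower.tprod_mul_tprod]
      congr 1
      ext1 i
      refine Fin.lastCases ?_ (fun i => ?_) i
      · rw [Fin.snoc_last]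
        exact Fin.append_right v _ 0
      · rw [Fin.snoc_castSucc]
        exact Fin.append_left v _ i
    have he' : ∀ g x, e.symm ((powRep π (Fin D)).tprod π g x) = powRep π (Fin (D + 1)) g (e.symm x) := by
      intro g x
      have : e.symm.toLinearMap ∘ₗ (powRep π (Fin D)).tprod π g =
          powRep π (Fin (D + 1)) g ∘ₗ e.symm.toLinearMap := by
        ext v p
        simp only [TensorProduct.AlgebraTensorModule.curry_apply,
          LinearMap.compMultilinearMap_apply, LinearMap.coe_restrictScalars,
          TensorProduct.curry_apply, LinearMap.comp_apply, Representation.tprod_apply,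
          TensorProduct.map_tmul, powRep_tprod, LinearEquiv.coe_coe, he]
        congr 1
        ext1 i
        refine Fin.lastCases ?_ (fun i => ?_) i <;> simp
      exact LinearMap.congr_fun this x
    refine (ih.tprod h).of_injective e.toLinearMap (fun g x => ?_) fun x hx => ?_
    · apply e.symm.injective
      rw [he']
      simp
    · rwa [LinearEquiv.coe_coe, LinearEquiv.map_eq_zero_iff] at hx

lemma EmbedsInTens.powRep (h : EmbedsInTens π) (I : Type*) [Finite I] :
    EmbedsInTens (powRep π I) := by
  obtain ⟨D, ⟨e⟩⟩ := Finite.exists_equiv_fin I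
  refine (h.powRep_fin D).of_injective (PiTensorProduct.reindex k (fun _ => P) e).toLinearMap
    (fun g x => ?_) fun x hx => ?_
  · have : (PiTensorProduct.reindex k (fun _ => P) e).toLinearMap ∘ₗ GLEmbed.powRep π I g =
        GLEmbed.powRep π (Fin D) g ∘ₗ (PiTensorProduct.reindex k (fun _ => P) e).toLinearMap :=
      (PiTensorProduct.map_comp_reindex_eq (fun _ => π g) e).symm
    exact LinearMap.congr_fun this x
  · rwa [LinearEquiv.coe_coe, LinearEquiv.map_eq_zero_iff] at hx

end Embeds

/-! ### Symmetric algebras in characteristic zero -/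

section Symmetrization

variable {W : Type*} [AddCommGroup W] [Module k W]

lemma List.Perm.exists_equiv_get {X : Type*} {l l' : List X} (h : l.Perm l') :
    ∃ e : Fin l.length ≃ Fin l'.length, ∀ i, l'.get (e i) = l.get i := by
  induction h with
  | nil => exact ⟨Equiv.refl _, fun _ => rfl⟩
  | @cons x l l' _ ih =>
    obtain ⟨e, he⟩ := ih
    refine ⟨(finSuccEquiv l.length).trans ((Equiv.optionCongr e).trans
      (finSuccEquiv l'.length).symm), fun i => ?_⟩
    refine Fin.cases ?_ (fun i => ?_) i
    · simp
    · simpa using he i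
  | swap x y l =>
    refine ⟨Equiv.swap (0 : Fin (l.length + 2)) 1, fun i => ?_⟩
    refine Fin.cases ?_ (fun i => Fin.cases ?_ (fun i => ?_) i) i
    · erw [Equiv.swap_apply_left]; rfl
    · erw [Equiv.swap_apply_right]; rfl
    · erw [Equiv.swap_apply_of_ne_of_ne (Fin.succ_ne_zero _)
        (fun h => Fin.succ_ne_zero _ (Fin.succ_injective _ h))]
      rfl
  | trans _ _ ih ih' =>
    obtain ⟨e, he⟩ := ih
    obtain ⟨e', he'⟩ := ih'
    exact ⟨e.trans e', fun i => by simp only [Equiv.trans_apply, he', he]⟩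

variable (k W) in
/-- The symmetrization of the component of degree `n` of an element of the tensor algebra. -/
def symmetrize (n : ℕ) : TensorAlgebra k W →ₗ[k] ⨂[k]^n W :=
  (∑ σ : Equiv.Perm (Fin n), (PiTensorProduct.reindex k (fun _ => W) σ).toLinearMap) ∘ₗ
    DirectSum.component k ℕ (fun n => ⨂[k]^n W) n ∘ₗ TensorAlgebra.toDirectSum.toLinearMap

lemma symmetrize_tprod (n : ℕ) {m : ℕ} (f : Fin m → W) :
    symmetrize k W n (TensorAlgebra.tprod k W m f) =
      ∑ e : Fin n ≃ Fin m, PiTensorProduct.tprod k fun i => f (e i) := by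
  classical
  rw [symmetrize, LinearMap.comp_apply, LinearMap.comp_apply, AlgHom.toLinearMap_apply,
    TensorAlgebra.toDirectSum_tensorPower_tprod]
  by_cases h : m = n
  · subst h
    rw [← DirectSum.lof_eq_of k, DirectSum.component.lof_self, LinearMap.sum_apply]
    refine Fintype.sum_equiv (Equiv.inv _) _ _ fun σ => ?_
    rw [LinearEquiv.coe_coe, PiTensorProduct.reindex_tprod]
    rfl
  · rw [← DirectSum.lof_eq_of k, DirectSum.component.of, dif_neg h, map_zero]
    have : IsEmpty (Fin n ≃ Fin m) := ⟨fun e => h (by simpa using (Fintype.card_congr e).symm)⟩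
    simp

lemma prod_map_ι (l : List W) : (l.map (TensorAlgebra.ι k)).prod =
    TensorAlgebra.tprod k W l.length l.get := by
  rw [TensorAlgebra.tprod_apply]
  congr 1
  rw [← List.ofFn_get (l.map _)]
  refine List.ext_get (by simp) fun i h h' => by simp

lemma symmetrize_perm (n : ℕ) {l l' : List W} (h : l.Perm l') :
    symmetrize k W n (l.map (TensorAlgebra.ι k)).prod =
      symmetrize k W n (l'.map (TensorAlgebra.ι k)).prod := by
  obtain ⟨e, he⟩ := List.Perm.exists_equiv_get h
  rw [prod_map_ι, prod_map_ι, symmetrize_tprod, symmetrize_tprod]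
  refine Fintype.sum_equiv (Equiv.equivCongr (Equiv.refl _) e) _ _ fun e' => ?_
  simp only [Equiv.equivCongr_apply_apply, Equiv.refl_symm, Equiv.refl_apply, he]

lemma mem_span_prod_map_ι (a : TensorAlgebra k W) :
    a ∈ Submodule.span k (Set.range fun l : List W => (l.map (TensorAlgebra.ι k)).prod) := by
  induction a using TensorAlgebra.induction with
  | algebraMap r =>
    rw [Algebra.algebraMap_eq_smul_one]
    exact Submodule.smul_mem _ _ (Submodule.subset_span ⟨[], rfl⟩)
  | ι x => exact Submodule.subset_span ⟨[x], by simp⟩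
  | add a b ha hb => exact add_mem ha hb
  | mul a b ha hb =>
    have := Submodule.mul_mem_mul ha hb
    rw [Submodule.span_mul_span] at this
    refine Submodule.span_mono ?_ this
    rintro _ ⟨_, ⟨l, rfl⟩, _, ⟨l', rfl⟩, rfl⟩
    exact ⟨l ++ l', by simp⟩

lemma symmetrize_mul_swap (n : ℕ) (x y : W) (a b : TensorAlgebra k W) :
    symmetrize k W n (a * (TensorAlgebra.ι k x * TensorAlgebra.ι k y) * b) =
      symmetrize k W n (a * (TensorAlgebra.ι k y * TensorAlgebra.ι k x) * b) := by
  have ha := mem_span_prod_map_ι a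
  have hb := mem_span_prod_map_ι b
  induction ha, hb using Submodule.span_induction₂ with
  | mem_mem _ _ h h' =>
    obtain ⟨l, rfl⟩ := h
    obtain ⟨l', rfl⟩ := h'
    have := symmetrize_perm (k := k) n (l := l ++ ([x, y] ++ l')) (l' := l ++ ([y, x] ++ l'))
      (List.Perm.append_left l (List.Perm.append_right l' (List.Perm.swap _ _ _)))
    simpa [mul_assoc] using this
  | zero_left => simp
  | zero_right => simp
  | add_left _ _ _ _ _ _ h1 h2 => simp only [add_mul, map_add, h1, h2]
  | add_right _ _ _ _ _ _ h1 h2 => simp only [mul_add, map_add, h1, h2]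
  | smul_left r _ _ _ _ h => simp only [smul_mul_assoc, map_smul, h]
  | smul_right r _ _ _ _ h => simp only [mul_smul_comm, map_smul, h]

variable (k W) in
/-- The congruence of equal symmetrization after multiplication with arbitrary elements. -/
def symmetrizeCon : RingCon (TensorAlgebra k W) where
  r a b := ∀ n c d, symmetrize k W n (c * a * d) = symmetrize k W n (c * b * d)
  iseqv := ⟨fun _ _ _ _ => rfl, fun h n c d => (h n c d).symm,
    fun h h' n c d => (h n c d).trans (h' n c d)⟩
  mul' {a b a' b'} h h' n c d := by
    have h1 := h n c (a' * d)
    have h2 := h' n (c * b) d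
    simp only [mul_assoc] at h1 h2 ⊢
    rw [h1, h2]
  add' h h' n c d := by
    simp only [mul_add, add_mul, map_add, h n c d, h' n c d]

lemma symmetrize_eq_of_algHom_eq (n : ℕ) {a b : TensorAlgebra k W}
    (h : SymmetricAlgebra.algHom k W a = SymmetricAlgebra.algHom k W b) :
    symmetrize k W n a = symmetrize k W n b := by
  have h1 : TensorAlgebra.symRingCon k W a b := (RingCon.eq _).1 h
  have h2 : TensorAlgebra.symRingCon k W ≤ symmetrizeCon k W := by
    refine RingCon.ringConGen_le.2 ?_
    rintro _ _ ⟨x, y⟩ n c d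
    exact symmetrize_mul_swap n x y c d
  simpa using h2 h1 n 1 1

variable (k W) in
lemma exists_symCoeff (n : ℕ) : ∃ H : SymmetricAlgebra k W →ₗ[k] ⨂[k]^n W,
    ∀ a, H (SymmetricAlgebra.algHom k W a) = symmetrize k W n a := by
  obtain ⟨s, hs⟩ := (SymmetricAlgebra.algHom k W).toLinearMap.exists_rightInverse_of_surjective
    (LinearMap.range_eq_top.2 (SymmetricAlgebra.algHom_surjective k W))
  refine ⟨symmetrize k W n ∘ₗ s, fun a => symmetrize_eq_of_algHom_eq n ?_⟩
  exact LinearMap.congr_fun hs _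

variable (k W) in
/-- The symmetric tensor of degree `n` that corresponds to an element of the symmetric algebra
(up to the factor `n!`). -/
def symCoeff (n : ℕ) : SymmetricAlgebra k W →ₗ[k] ⨂[k]^n W := (exists_symCoeff k W n).choose

lemma symCoeff_algHom (n : ℕ) (a : TensorAlgebra k W) :
    symCoeff k W n (SymmetricAlgebra.algHom k W a) = symmetrize k W n a :=
  (exists_symCoeff k W n).choose_spec a

lemma algHom_toTensorAlgebra_reindex {n : ℕ} (σ : Equiv.Perm (Fin n)) (x : ⨂[k]^n W) :
    SymmetricAlgebra.algHom k W (TensorPower.toTensorAlgebra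
      (PiTensorProduct.reindex k (fun _ => W) σ x)) =
    SymmetricAlgebra.algHom k W (TensorPower.toTensorAlgebra x) := by
  have : (SymmetricAlgebra.algHom k W).toLinearMap ∘ₗ TensorPower.toTensorAlgebra ∘ₗ
      (PiTensorProduct.reindex k (fun _ => W) σ).toLinearMap =
      (SymmetricAlgebra.algHom k W).toLinearMap ∘ₗ TensorPower.toTensorAlgebra := by
    ext v
    simp only [LinearMap.compMultilinearMap_apply, LinearMap.comp_apply, LinearEquiv.coe_coe,
      PiTensorProduct.reindex_tprod, TensorPower.toTensorAlgebra_tprod, AlgHom.toLinearMap_apply,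
      TensorAlgebra.tprod_apply, map_list_prod, List.map_ofFn, List.prod_ofFn]
    exact Equiv.prod_comp σ.symm fun i =>
      SymmetricAlgebra.algHom k W (TensorAlgebra.ι k (v i))
  exact LinearMap.congr_fun this x

/-- In characteristic zero, an element of the symmetric algebra is determined by its symmetric
tensors: their images in the symmetric algebra are `n!` times its components. -/
lemma eq_zero_of_symCoeff [CharZero k] (y : SymmetricAlgebra k W) (h : ∀ n, symCoeff k W n y = 0) :
    y = 0 := by
  classical
  obtain ⟨a, rfl⟩ := SymmetricAlgebra.algHom_surjective k W y
  rw [← TensorAlgebra.ofDirectSum_toDirectSum a]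
  set z := TensorAlgebra.toDirectSum a with hz
  have hof : ∀ n (x : ⨂[k]^n W), TensorAlgebra.ofDirectSum (DirectSum.of _ n x) =
      TensorPower.toTensorAlgebra x := fun n x =>
    DirectSum.toAddMonoid_of
      (fun _ ↦ LinearMap.toAddMonoidHom TensorPower.toTensorAlgebra) _ _
  rw [← DirectSum.sum_support_of z, map_sum, map_sum]
  refine Finset.sum_eq_zero fun n _ => ?_
  rw [hof]
  have h1 := h n
  rw [symCoeff_algHom, symmetrize, LinearMap.comp_apply, LinearMap.comp_apply,
    AlgHom.toLinearMap_apply, ← hz] at h1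
  change (∑ σ : Equiv.Perm (Fin n), (PiTensorProduct.reindex k (fun _ => W) σ).toLinearMap)
    (z n) = 0 at h1
  have h2 := congrArg (fun x => SymmetricAlgebra.algHom k W (TensorPower.toTensorAlgebra x)) h1
  simp only [LinearMap.sum_apply, LinearEquiv.coe_coe, map_sum, algHom_toTensorAlgebra_reindex,
    map_zero, Finset.sum_const, Finset.card_univ, Fintype.card_perm, Fintype.card_fin] at h2
  have h3 : ((n.factorial : ℕ) : k) • SymmetricAlgebra.algHom k W
      (TensorPower.toTensorAlgebra (z n)) = 0 := by
    rw [Nat.cast_smul_eq_nsmul]; exact h2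
  exact (smul_eq_zero.1 h3).resolve_left (by exact_mod_cast n.factorial_ne_zero)

lemma symCoeff_lift (n : ℕ) (f : W →ₗ[k] W) (y : SymmetricAlgebra k W) :
    symCoeff k W n (SymmetricAlgebra.lift (SymmetricAlgebra.ι k W ∘ₗ f) y) =
      PiTensorProduct.map (fun _ => f) (symCoeff k W n y) := by
  obtain ⟨a, rfl⟩ := SymmetricAlgebra.algHom_surjective k W y
  have ha := mem_span_prod_map_ι a
  induction ha using Submodule.span_induction with
  | mem _ h =>
    obtain ⟨l, rfl⟩ := h
    have h1 : SymmetricAlgebra.lift (SymmetricAlgebra.ι k W ∘ₗ f)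
        (SymmetricAlgebra.algHom k W (l.map (TensorAlgebra.ι k)).prod) =
        SymmetricAlgebra.algHom k W (TensorAlgebra.tprod k W l.length fun i => f (l.get i)) := by
      rw [prod_map_ι, TensorAlgebra.tprod_apply, TensorAlgebra.tprod_apply, map_list_prod,
        map_list_prod, map_list_prod, List.map_ofFn, List.map_ofFn, List.map_ofFn]
      congr 2
      ext1 i
      exact SymmetricAlgebra.lift_ι_apply (SymmetricAlgebra.ι k W ∘ₗ f) _
    beta_reduce
    rw [h1, symCoeff_algHom, symCoeff_algHom, prod_map_ι, symmetrize_tprod, symmetrize_tprod,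
      map_sum]
    simp only [PiTensorProduct.map_tprod]
  | zero => simp
  | add _ _ _ _ h1 h2 => simp only [map_add, h1, h2]
  | smul r _ _ h => simp only [map_smul, h]

/-- An action on an algebra, as a representation. -/
def algRep {R : Type*} [CommRing R] [Algebra k R] (α : GLInf k →* (R ≃ₐ[k] R)) :
    Representation k (GLInf k) R where
  toFun g := (α g).toLinearMap
  map_one' := by ext; simp
  map_mul' g h := by ext; simp

/-- In characteristic zero, `Sym(W)` embeds into the sum of the tensor powers of `W`. -/
lemma EmbedsInTens.symAction [CharZero k] {π : Representation k (GLInf k) W}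
    (h : EmbedsInTens π) : EmbedsInTens (algRep (symAction π)) := by
  refine EmbedsInTens.of_family (fun n => h.powRep_fin n) (fun n => symCoeff k W n)
    (fun n g x => symCoeff_lift n (π g) x) (fun y => ?_) eq_zero_of_symCoeff
  obtain ⟨a, rfl⟩ := SymmetricAlgebra.algHom_surjective k W y
  refine (DFinsupp.finite_support (TensorAlgebra.toDirectSum a)).subset fun n hn h0 => hn ?_
  rw [symCoeff_algHom, symmetrize, LinearMap.comp_apply, LinearMap.comp_apply,
    AlgHom.toLinearMap_apply]
  exact (congrArg _ h0).trans (map_zero _)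

end Symmetrization

/-! ### Functoriality of `k^{⊕λ}` and of its symmetric algebra -/

section Functoriality

/-- The functoriality of tensor powers of `𝐕`, for all endomorphisms of `𝐕`. -/
def tensMap (I : Type v) (h : (ℕ →₀ k) →ₗ[k] (ℕ →₀ k)) :
    (⨂[k] _ : I, (ℕ →₀ k)) →ₗ[k] (⨂[k] _ : I, (ℕ →₀ k)) :=
  PiTensorProduct.map fun _ => h

lemma tensMap_comp {I : Type v} (h h' : (ℕ →₀ k) →ₗ[k] (ℕ →₀ k)) :
    tensMap I (h ∘ₗ h') = tensMap I h ∘ₗ tensMap I h' :=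
  PiTensorProduct.map_comp _ _

lemma tensMap_id {I : Type v} : tensMap (k := k) I LinearMap.id = LinearMap.id :=
  PiTensorProduct.map_id

lemma exists_tensMap_eq {I : Type v} [Finite I] (x : ⨂[k] _ : I, (ℕ →₀ k)) :
    ∃ N, ∀ h h' : (ℕ →₀ k) →ₗ[k] (ℕ →₀ k),
      (∀ i < N, h (Finsupp.single i 1) = h' (Finsupp.single i 1)) →
      tensMap I h x = tensMap I h' x := by
  have := Fintype.ofFinite I
  induction x using PiTensorProduct.induction_on with
  | smul_tprod r v =>
    refine ⟨Finset.univ.sup fun i => (v i).support.sup id + 1, fun h h' hh => ?_⟩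
    rw [map_smul, map_smul, tensMap, tensMap, PiTensorProduct.map_tprod, PiTensorProduct.map_tprod]
    congr 2
    ext1 i
    rw [← sub_eq_zero, ← LinearMap.sub_apply]
    refine map_eq_zero_of_support _ _ fun j hj => ?_
    rw [LinearMap.sub_apply, sub_eq_zero]
    refine hh j ?_
    have h1 : j ≤ (v i).support.sup id := Finset.le_sup (f := id) (by simpa using hj)
    have h2 := Finset.le_sup (f := fun i => (v i).support.sup id + 1) (Finset.mem_univ i)
    exact (Nat.lt_succ_of_le h1).trans_le h2
  | add x y hx hy =>
    obtain ⟨N, hN⟩ := hx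
    obtain ⟨N', hN'⟩ := hy
    refine ⟨max N N', fun h h' hh => ?_⟩
    rw [map_add, map_add, hN h h' fun i hi => hh i (lt_max_of_lt_left hi),
      hN' h h' fun i hi => hh i (lt_max_of_lt_right hi)]

lemma permMap_tensMap {I : Type v} (p : Equiv.Perm I) (h : (ℕ →₀ k) →ₗ[k] (ℕ →₀ k))
    (x : ⨂[k] _ : I, (ℕ →₀ k)) :
    permMap k I p (tensMap I h x) = tensMap I h (permMap k I p x) :=
  (LinearMap.congr_fun
    (PiTensorProduct.map_comp_reindex_eq (fun _ : I => h) p) x).symm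

variable (k) in
lemma smul_permMap_apply {I : Type v} (p : Equiv.Perm I) (c : k) (x : ⨂[k] _ : I, (ℕ →₀ k)) :
    (c • permMap k I p) x = c • permMap k I p x := rfl

lemma tensMap_mem_schur (l : YoungDiagram) (h : (ℕ →₀ k) →ₗ[k] (ℕ →₀ k))
    {x : ⨂[k] _ : l.cells, (ℕ →₀ k)} (hx : x ∈ (schur k l).toSubmodule) :
    tensMap l.cells h x ∈ (schur k l).toSubmodule := by
  obtain ⟨y, rfl⟩ := hx
  refine ⟨tensMap l.cells h y, ?_⟩
  have h1 : ∀ z, rowSymmetrizer k l (tensMap l.cells h z) =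
      tensMap l.cells h (rowSymmetrizer k l z) := by
    intro z
    simp only [rowSymmetrizer, Representation.IntertwiningMap.sum_apply, map_sum, permMap_tensMap]
  have h2 : ∀ z, columnAntisymmetrizer k l (tensMap l.cells h z) =
      tensMap l.cells h (columnAntisymmetrizer k l z) := by
    intro z
    simp only [columnAntisymmetrizer, Representation.IntertwiningMap.sum_apply, map_sum,
      smul_permMap_apply, permMap_tensMap, map_smul]
  change columnAntisymmetrizer k l (rowSymmetrizer k l _) =
    tensMap l.cells h (columnAntisymmetrizer k l (rowSymmetrizer k l y))
  rw [h1, h2]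

variable {r : ℕ} (s : Fin r → YoungDiagram)

/-- The functoriality of `k^{⊕λ}`, for all endomorphisms of `𝐕`. -/
def tupleMap (h : (ℕ →₀ k) →ₗ[k] (ℕ →₀ k)) : TupleSpace k s →ₗ[k] TupleSpace k s :=
  DirectSum.lmap fun i => (tensMap (s i).cells h).restrict fun _ => tensMap_mem_schur (s i) h

variable (k) in
/-- The component of index `i`, as a map to a tensor power. -/
def tupleProj (i : Fin r) : TupleSpace k s →ₗ[k] ⨂[k] _ : (s i).cells, (ℕ →₀ k) :=
  (schur k (s i)).toSubmodule.subtype ∘ₗ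
    DirectSum.component k (Fin r) (fun i => (schur k (s i)).toSubmodule) i

lemma tupleProj_tupleMap (i : Fin r) (h : (ℕ →₀ k) →ₗ[k] (ℕ →₀ k)) (x : TupleSpace k s) :
    tupleProj k s i (tupleMap s h x) = tensMap _ h (tupleProj k s i x) := rfl

variable {s} in
lemma tuple_ext {x y : TupleSpace k s} (h : ∀ i, tupleProj k s i x = tupleProj k s i y) :
    x = y :=
  DFinsupp.ext fun i => Subtype.ext (h i)

lemma tupleRep_eq_tupleMap (g : GLInf k) : tupleRep k s g = tupleMap s (stdRep k g) := rfl

lemma tupleMap_comp_apply (h h' : (ℕ →₀ k) →ₗ[k] (ℕ →₀ k)) (x : TupleSpace k s) :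
    tupleMap s h (tupleMap s h' x) = tupleMap s (h ∘ₗ h') x :=
  tuple_ext fun i => by simp only [tupleProj_tupleMap, tensMap_comp, LinearMap.comp_apply]

lemma tupleMap_id_apply (x : TupleSpace k s) : tupleMap s LinearMap.id x = x :=
  tuple_ext fun i => by rw [tupleProj_tupleMap, tensMap_id, LinearMap.id_apply]

lemma exists_tupleMap_eq (x : TupleSpace k s) :
    ∃ N, ∀ h h' : (ℕ →₀ k) →ₗ[k] (ℕ →₀ k),
      (∀ i < N, h (Finsupp.single i 1) = h' (Finsupp.single i 1)) →
      tupleMap s h x = tupleMap s h' x := by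
  choose N hN using fun i => exists_tensMap_eq (tupleProj k s i x)
  refine ⟨Finset.univ.sup N, fun h h' hh => tuple_ext fun i => hN i h h' fun j hj => hh j ?_⟩
  exact hj.trans_le (Finset.le_sup (f := N) (Finset.mem_univ i))

/-- The functoriality of `Sym(k^{⊕λ})`, for all endomorphisms of `𝐕`. -/
def symMap (h : (ℕ →₀ k) →ₗ[k] (ℕ →₀ k)) :
    SymmetricAlgebra k (TupleSpace k s) →ₐ[k] SymmetricAlgebra k (TupleSpace k s) :=
  SymmetricAlgebra.lift (SymmetricAlgebra.ι k _ ∘ₗ tupleMap s h)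

@[simp] lemma symMap_ι (h : (ℕ →₀ k) →ₗ[k] (ℕ →₀ k)) (x : TupleSpace k s) :
    symMap s h (SymmetricAlgebra.ι k _ x) = SymmetricAlgebra.ι k _ (tupleMap s h x) :=
  SymmetricAlgebra.lift_ι_apply _ _

lemma symAction_eq_symMap (g : GLInf k) (x : SymmetricAlgebra k (TupleSpace k s)) :
    symAction (tupleRep k s) g x = symMap s (stdRep k g) x := rfl

lemma symAction_apply {V : Type*} [AddCommGroup V] [Module k V]
    (π : Representation k (GLInf k) V) (g : GLInf k) (x : SymmetricAlgebra k V) :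
    symAction π g x = SymmetricAlgebra.lift (SymmetricAlgebra.ι k V ∘ₗ π g) x := rfl

@[simp] lemma symAction_ι {V : Type*} [AddCommGroup V] [Module k V]
    (π : Representation k (GLInf k) V) (g : GLInf k) (x : V) :
    symAction π g (SymmetricAlgebra.ι k _ x) = SymmetricAlgebra.ι k _ (π g x) :=
  SymmetricAlgebra.lift_ι_apply _ _

lemma exists_symMap_eq (x : SymmetricAlgebra k (TupleSpace k s)) :
    ∃ N, ∀ h h' : (ℕ →₀ k) →ₗ[k] (ℕ →₀ k),
      (∀ i < N, h (Finsupp.single i 1) = h' (Finsupp.single i 1)) →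
      symMap s h x = symMap s h' x := by
  induction x using SymmetricAlgebra.induction with
  | algebraMap r => exact ⟨0, fun h h' _ => by simp⟩
  | ι x =>
    obtain ⟨N, hN⟩ := exists_tupleMap_eq s x
    exact ⟨N, fun h h' hh => by rw [symMap_ι, symMap_ι, hN h h' hh]⟩
  | mul x y hx hy =>
    obtain ⟨N, hN⟩ := hx
    obtain ⟨N', hN'⟩ := hy
    refine ⟨max N N', fun h h' hh => ?_⟩
    rw [map_mul, map_mul, hN h h' fun i hi => hh i (lt_max_of_lt_left hi),
      hN' h h' fun i hi => hh i (lt_max_of_lt_right hi)]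
  | add x y hx hy =>
    obtain ⟨N, hN⟩ := hx
    obtain ⟨N', hN'⟩ := hy
    refine ⟨max N N', fun h h' hh => ?_⟩
    rw [map_add, map_add, hN h h' fun i hi => hh i (lt_max_of_lt_left hi),
      hN' h h' fun i hi => hh i (lt_max_of_lt_right hi)]

end Functoriality

section Embedding

variable (k) in
/-- The identification of `𝐕` with its first tensor power. -/
def tensOne : (ℕ →₀ k) ≃ₗ[k] Tens k 1 :=
  (PiTensorProduct.subsingletonEquiv (R := k) (s := fun _ : Fin 1 => (ℕ →₀ k)) 0).symm

lemma tensOne_apply (x : ℕ →₀ k) : tensOne k x = PiTensorProduct.tprod k fun _ => x :=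
  PiTensorProduct.subsingletonEquiv_symm_apply' _ _

lemma tensOne_stdRep (g : GLInf k) (x : ℕ →₀ k) :
    tensOne k (stdRep k g x) = tensorRep k (Fin 1) g (tensOne k x) := by
  rw [tensOne_apply, tensOne_apply, tensorRep_tprod]

lemma embedsInTens_stdRep : EmbedsInTens (stdRep k) :=
  ⟨Unit, fun _ => 1, fun _ => (tensOne k).toLinearMap, fun _ g x => tensOne_stdRep g x,
    fun _ => Set.toFinite _, fun _ hx => (tensOne k).map_eq_zero_iff.1 (hx ())⟩

/-- Under the copy of `GL` that acts on the coordinates from `n` on, the representation `𝐕` is the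
sum of a trivial representation and of `𝐕`. -/
lemma embedsInTens_stdRep_up (n : ℕ) : EmbedsInTens ((stdRep k).comp (up k n)) := by
  have h0 : ∀ j : Fin n, EmbedsInTens (1 : Representation k (GLInf k) k) := fun _ =>
    embedsInTens_trivial (fun _ => rfl) LinearMap.id fun _ h => h
  choose I d θ h1 h2 h3 using h0
  refine ⟨Unit ⊕ Σ j, I j, Sum.elim (fun _ => 1) fun i => d i.1 i.2,
    Sum.rec (fun _ => (tensOne k).toLinearMap ∘ₗ ret k n)
      (fun i => θ i.1 i.2 ∘ₗ Finsupp.lapply (i.1 : ℕ)), ?_, fun x => ?_, fun x hx => ?_⟩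
  · rintro (_ | ⟨j, i⟩) g x
    · change tensOne k (ret k n (stdRep k (up k n g) x)) = _
      rw [ret_stdRep_up, tensOne_stdRep]
      rfl
    · change θ j i (stdRep k (up k n g) x j) = tensorRep k _ g (θ j i (x j))
      rw [(up_mem_GLFrom n g).2 x j j.2, ← h1]
      rfl
  · refine Set.Finite.subset (((Set.finite_range Sum.inl)).union (Set.finite_iUnion fun j =>
      (h2 j (x j)).image fun i => Sum.inr ⟨j, i⟩)) ?_
    rintro (_ | ⟨j, i⟩) hi
    · exact Or.inl ⟨_, rfl⟩
    · exact Or.inr (Set.mem_iUnion.2 ⟨j, i, hi, rfl⟩)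
  · ext j
    by_cases hj : j < n
    · exact h3 ⟨j, hj⟩ (x j) fun i => hx (Sum.inr ⟨⟨j, hj⟩, i⟩)
    · obtain ⟨i, rfl⟩ : ∃ i, j = i + n := ⟨j - n, by omega⟩
      have h4 : ret k n x = 0 := (tensOne k).map_eq_zero_iff.1 (hx (Sum.inl ()))
      rw [← ret_apply, h4]
      rfl

variable {r : ℕ} (s : Fin r → YoungDiagram)

lemma EmbedsInTens.tupleRep (φ : GLInf k →* GLInf k) (h : EmbedsInTens ((stdRep k).comp φ)) :
    EmbedsInTens ((tupleRep k s).comp φ) :=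
  EmbedsInTens.of_family (fun i => h.powRep (s i).cells) (fun i => tupleProj k s i)
    (fun _ _ _ => rfl) (fun _ => Set.toFinite _) fun x hx => tuple_ext fun i => by
      rw [hx i, map_zero]

lemma EmbedsInTens.symAction_tupleRep [CharZero k] (φ : GLInf k →* GLInf k)
    (h : EmbedsInTens ((stdRep k).comp φ)) :
    EmbedsInTens (algRep ((GLEmbed.symAction (GLEmbed.tupleRep k s)).comp φ)) := by
  refine (h.tupleRep s φ).symAction.of_injective LinearMap.id (fun g x => ?_) fun _ hx => hx
  change GLEmbed.symAction (GLEmbed.tupleRep k s) (φ g) x =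
    GLEmbed.symAction ((GLEmbed.tupleRep k s).comp φ) g x
  rw [symAction_apply, symAction_apply]
  rfl

end Embedding

/-! ### Shifting the coordinates of the coefficient ring -/

section Algebraic

lemma exists_comp_eq_id {P Q : Type*} [AddCommGroup P] [Module k P] [AddCommMonoid Q] [Module k Q]
    (f : P →ₗ[k] Q) (hf : LinearMap.ker f = ⊥) : ∃ g : Q →ₗ[k] P, g ∘ₗ f = LinearMap.id :=
  let _ : AddCommGroup Q := Module.addCommMonoidToAddCommGroup k
  f.exists_leftInverse_of_injective hf

lemma polyFuns_tensorRep {d : ℕ} {η : (ℕ →₀ k) →ₗ[k] (ℕ →₀ k)} (hη : IsSqZero η) (x : Tens k d) :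
    (fun t => tensorRep k (Fin d) (unip (t • η) (hη.smul t)) x) ∈ polyFuns k (Tens k d) := by
  induction x using PiTensorProduct.induction_on with
  | smul_tprod r v =>
    have := (polyFuns k (Tens k d)).smul_mem r
      (polyFuns_multilinear (PiTensorProduct.tprod k (s := fun _ : Fin d => (ℕ →₀ k))) v
        (fun i => η (v i)))
    convert this using 1
    ext1 t
    simp
  | add x y hx hy =>
    convert (polyFuns k (Tens k d)).add_mem hx hy using 1
    ext1 t
    simp

/-- One-parameter unipotent subgroups act polynomially: this holds on tensor powers and is carried
over by a linear retraction of the embedding. -/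
lemma EmbedsInTens.polyFuns_mem {P : Type*} [AddCommGroup P] [Module k P]
    {π : Representation k (GLInf k) P} (h : EmbedsInTens π) {η : (ℕ →₀ k) →ₗ[k] (ℕ →₀ k)}
    (hη : IsSqZero η) (x : P) : (fun t => π (unip (t • η) (hη.smul t)) x) ∈ polyFuns k P := by
  classical
  obtain ⟨I, d, θ, h1, h2, h3⟩ := h
  let j : P →ₗ[k] (∀ i, Tens k (d i)) := LinearMap.pi θ
  have hj : LinearMap.ker j = ⊥ := LinearMap.ker_eq_bot'.2 fun x hx => h3 x fun i => congrFun hx i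
  obtain ⟨L, hL⟩ := exists_comp_eq_id j hj
  have h4 : (fun t => π (unip (t • η) (hη.smul t)) x) = fun t =>
      ∑ i ∈ (h2 x).toFinset, (L ∘ₗ LinearMap.single k (fun i => Tens k (d i)) i)
        (tensorRep k (Fin (d i)) (unip (t • η) (hη.smul t)) (θ i x)) := by
    ext1 t
    simp only [LinearMap.comp_apply]
    rw [← map_sum, ← LinearMap.id_apply (R := k) (π _ x), ← hL, LinearMap.comp_apply]
    congr 1
    ext1 i
    change θ i _ = _
    rw [h1, Finset.sum_apply]
    by_cases hi : θ i x = 0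
    · rw [hi, map_zero, Finset.sum_eq_zero]
      intro i' hi'
      rw [LinearMap.single_apply, Pi.single_eq_of_ne]
      rintro rfl
      exact (h2 x).mem_toFinset.1 hi' hi
    · rw [Finset.sum_eq_single i]
      · simp
      · intro i' _ hi'
        simp [hi'.symm]
      · intro hi'
        exact absurd ((h2 x).mem_toFinset.2 hi) hi'
  rw [h4]
  exact polyFuns_sum _ fun i _ => polyFuns_map _ (polyFuns_tensorRep hη _)

variable {R : Type v} [CommRing R] [Algebra k R] {α : GLInf k →* (R ≃ₐ[k] R)}
  {A : Type w} [CommRing A] [Algebra k A] {β : GLInf k →* (A ⊗[k] R ≃ₐ[k] A ⊗[k] R)}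

lemma IsAlgebraicAction.baseChange (hα : IsAlgebraicAction α)
    (hβ : ∀ g a r, β g (a ⊗ₜ r) = a ⊗ₜ α g r) : IsAlgebraicAction β where
  poly η hη x := by
    induction x using TensorProduct.induction_on with
    | zero => simpa using const_mem_polyFuns (k := k) (0 : A ⊗[k] R)
    | tmul a r =>
      simp only [hβ]
      exact polyFuns_map (TensorProduct.mk k A R a) (hα.poly η hη r)
    | add x y hx hy =>
      convert (polyFuns k _).add_mem hx hy using 1
      ext1 t
      simp
  finitary x := by
    induction x using TensorProduct.induction_on with
    | zero => exact ⟨0, fun g _ => map_zero _⟩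
    | tmul a r =>
      obtain ⟨N, hN⟩ := hα.finitary r
      exact ⟨N, fun g hg => by rw [hβ, hN g hg]⟩
    | add x y hx hy =>
      obtain ⟨N, hN⟩ := hx
      obtain ⟨N', hN'⟩ := hy
      refine ⟨max N N', fun g hg => ?_⟩
      rw [map_add, hN g fun i hi => hg i (lt_max_of_lt_left hi),
        hN' g fun i hi => hg i (lt_max_of_lt_right hi)]

variable (α) in
/-- For every `n`, the shift `e_i ↦ e_{i+n}` of the coefficient ring is split off by a homomorphism
`δ` to a tensor product `R ⊗ S` with a ring of polynomial functions on a representation, compatibly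
with the isomorphism of `GL` with its copy that acts on the coordinates from `n` on. The shift of
`r` is encoded as the action of `shiftElt n N` for large `N`. -/
def IsShiftable : Prop :=
  ∀ n : ℕ, ∃ (S : Type u) (_ : CommRing S) (_ : Algebra k S) (σ : GLInf k →* (S ≃ₐ[k] S))
    (δ : R →ₐ[k] R ⊗[k] S), EmbedsInTens (algRep σ) ∧ Function.Injective δ ∧
    (∀ g r, δ (α (up k n g) r) =
      Algebra.TensorProduct.map (α g).toAlgHom (σ g).toAlgHom (δ r)) ∧
    ∀ r, ∃ N, ∀ N', N ≤ N' → δ (α (shiftElt k n N') r) = r ⊗ₜ 1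

lemma IsShiftable.baseChange (hα : IsShiftable α)
    (hβ : ∀ g a r, β g (a ⊗ₜ r) = a ⊗ₜ α g r) : IsShiftable β := by
  intro n
  obtain ⟨S, _, _, σ, δ, hσ, hδ, h1, h2⟩ := hα n
  let e := (Algebra.TensorProduct.assoc k k k A R S).symm
  let δ' : A ⊗[k] R →ₐ[k] (A ⊗[k] R) ⊗[k] S :=
    e.toAlgHom.comp (Algebra.TensorProduct.map (AlgHom.id k A) δ)
  have hδ' : ∀ a r, δ' (a ⊗ₜ r) = e (a ⊗ₜ δ r) := fun _ _ => rfl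
  refine ⟨S, _, _, σ, δ', hσ, ?_, fun g x => ?_, fun x => ?_⟩
  · refine e.injective.comp ?_
    exact Module.Flat.lTensor_preserves_injective_linearMap (M := A) δ.toLinearMap hδ
  · have h3 : ∀ (a : A) (y : R ⊗[k] S),
        e (a ⊗ₜ Algebra.TensorProduct.map (α g).toAlgHom (σ g).toAlgHom y) =
          Algebra.TensorProduct.map (β g).toAlgHom (σ g).toAlgHom (e (a ⊗ₜ y)) := by
      intro a y
      induction y using TensorProduct.induction_on with
      | zero => simp
      | tmul r s =>
        change (a ⊗ₜ[k] α g r) ⊗ₜ[k] σ g s = (β g (a ⊗ₜ[k] r)) ⊗ₜ[k] σ g s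
        rw [hβ]
      | add x y hx hy => simp only [map_add, TensorProduct.tmul_add, hx, hy]
    induction x using TensorProduct.induction_on with
    | zero => simp
    | tmul a r => rw [hβ, hδ', hδ', h1, h3]
    | add x y hx hy => simp only [map_add, hx, hy]
  · induction x using TensorProduct.induction_on with
    | zero => exact ⟨0, fun _ _ => by simp⟩
    | tmul a r =>
      obtain ⟨N, hN⟩ := h2 r
      refine ⟨N, fun N' hN' => ?_⟩
      rw [hβ, hδ', hN N' hN']
      rfl
    | add x y hx hy =>
      obtain ⟨N, hN⟩ := hx
      obtain ⟨N', hN'⟩ := hy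
      refine ⟨max N N', fun N'' h => ?_⟩
      rw [map_add, map_add, hN _ (le_of_max_le_left h), hN' _ (le_of_max_le_right h),
        TensorProduct.add_tmul]

end Algebraic

section Sym

variable {r : ℕ} (s : Fin r → YoungDiagram)

lemma isAlgebraicAction_symAction [CharZero k] :
    IsAlgebraicAction (symAction (tupleRep k s)) where
  poly η hη x := (embedsInTens_stdRep.symAction_tupleRep s (MonoidHom.id _)).polyFuns_mem hη x
  finitary x := by
    obtain ⟨N, hN⟩ := exists_symMap_eq s x
    refine ⟨N, fun g hg => ?_⟩
    rw [symAction_eq_symMap, hN _ LinearMap.id fun i hi => hg i hi]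
    have : symMap s LinearMap.id = AlgHom.id k _ := by
      refine SymmetricAlgebra.algHom_ext (LinearMap.ext fun y => ?_)
      simp [tupleMap_id_apply]
    rw [this, AlgHom.id_apply]

variable (k) in
/-- The homomorphism `Sym(W) → Sym(W) ⊗ Sym(W)` for `W = k^{⊕λ}` with
`w ↦ ret w ⊗ 1 + 1 ⊗ (w - sh (ret w))`. -/
def splitShift (n : ℕ) : SymmetricAlgebra k (TupleSpace k s) →ₐ[k]
    SymmetricAlgebra k (TupleSpace k s) ⊗[k] SymmetricAlgebra k (TupleSpace k s) :=
  SymmetricAlgebra.lift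
    ((TensorProduct.mk k _ _).flip 1 ∘ₗ SymmetricAlgebra.ι k _ ∘ₗ tupleMap s (ret k n) +
      TensorProduct.mk k _ _ 1 ∘ₗ SymmetricAlgebra.ι k _ ∘ₗ
        (LinearMap.id - tupleMap s (sh k n) ∘ₗ tupleMap s (ret k n)))

lemma splitShift_ι (n : ℕ) (x : TupleSpace k s) :
    splitShift k s n (SymmetricAlgebra.ι k _ x) =
      SymmetricAlgebra.ι k _ (tupleMap s (ret k n) x) ⊗ₜ 1 +
        1 ⊗ₜ SymmetricAlgebra.ι k _ (x - tupleMap s (sh k n) (tupleMap s (ret k n) x)) :=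
  SymmetricAlgebra.lift_ι_apply _ _

lemma ret_comp_sh (n : ℕ) : ret k n ∘ₗ sh k n = LinearMap.id :=
  LinearMap.ext fun v => ret_sh n v

lemma isShiftable_symAction [CharZero k] : IsShiftable (symAction (tupleRep k s)) := by
  intro n
  refine ⟨SymmetricAlgebra k (TupleSpace k s), inferInstance, inferInstance,
    (symAction (tupleRep k s)).comp (up k n), splitShift k s n,
    (embedsInTens_stdRep_up n).symAction_tupleRep s (up k n), ?_, fun g => ?_, fun x => ?_⟩
  -- multiplication, after the shift of the first factor, is a left inverse
  · have h : (Algebra.TensorProduct.productMap (symMap s (sh k n)) (AlgHom.id k _)).comp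
        (splitShift k s n) = AlgHom.id k _ := by
      refine SymmetricAlgebra.algHom_ext (LinearMap.ext fun x => ?_)
      simp [splitShift_ι]
    exact Function.LeftInverse.injective (g := Algebra.TensorProduct.productMap (symMap s (sh k n))
      (AlgHom.id k _)) fun x => AlgHom.congr_fun h x
  · have h : (splitShift k s n).comp (symAction (tupleRep k s) (up k n g)).toAlgHom =
        (Algebra.TensorProduct.map (symAction (tupleRep k s) g).toAlgHom
          (symAction (tupleRep k s) (up k n g)).toAlgHom).comp (splitShift k s n) := by
      refine SymmetricAlgebra.algHom_ext (LinearMap.ext fun x => ?_)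
      have h1 : ret k n ∘ₗ stdRep k (up k n g) = stdRep k g ∘ₗ ret k n :=
        LinearMap.ext fun v => ret_stdRep_up n g v
      have h2 : stdRep k (up k n g) ∘ₗ sh k n = sh k n ∘ₗ stdRep k g :=
        LinearMap.ext fun v => stdRep_up_sh n g v
      change splitShift k s n (symAction (tupleRep k s) (up k n g) (SymmetricAlgebra.ι k _ x)) =
        Algebra.TensorProduct.map _ _ (splitShift k s n (SymmetricAlgebra.ι k _ x))
      rw [symAction_ι, splitShift_ι, splitShift_ι, map_add, Algebra.TensorProduct.map_tmul,
        Algebra.TensorProduct.map_tmul, map_one, map_one]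
      change _ = symAction (tupleRep k s) g _ ⊗ₜ 1 + 1 ⊗ₜ symAction (tupleRep k s) (up k n g) _
      rw [symAction_ι, symAction_ι]
      have h3 : stdRep k (up k n g) ∘ₗ (sh k n ∘ₗ ret k n) = sh k n ∘ₗ (stdRep k g ∘ₗ ret k n) := by
        rw [← LinearMap.comp_assoc, h2, LinearMap.comp_assoc]
      have h4 : tupleMap s (ret k n) (tupleRep k s (up k n g) x) =
          tupleRep k s g (tupleMap s (ret k n) x) := by
        simp only [tupleRep_eq_tupleMap, tupleMap_comp_apply, h1]
      have h5 : tupleMap s (sh k n) (tupleRep k s g (tupleMap s (ret k n) x)) =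
          tupleRep k s (up k n g) (tupleMap s (sh k n) (tupleMap s (ret k n) x)) := by
        simp only [tupleRep_eq_tupleMap, tupleMap_comp_apply, h3]
      rw [h4, h5, ← map_sub]
    exact fun x => AlgHom.congr_fun h x
  · obtain ⟨N, hN⟩ := exists_symMap_eq s x
    refine ⟨N, fun N' hN' => ?_⟩
    rw [symAction_eq_symMap, hN _ (sh k n) fun i hi => ?_]
    · have h : (splitShift k s n).comp (symMap s (sh k n)) =
          Algebra.TensorProduct.includeLeft := by
        refine SymmetricAlgebra.algHom_ext (LinearMap.ext fun x => ?_)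
        simp [splitShift_ι, tupleMap_comp_apply, ret_comp_sh, tupleMap_id_apply]
      exact AlgHom.congr_fun h x
    · rw [stdRep_shiftElt (by omega), sh_single]

end Sym

/-! ### From equivariance in the coordinates from `n` on to equivariance -/

section ShiftVector

variable {M : Type w} [AddCommGroup M] [Module k M] {ρ : Representation k (GLInf k) M}

variable (ρ) in
/-- `GL` acts on `M` finitarily: each vector is fixed by all elements that fix `e_i` for `i < N`,
for some `N`. -/
def IsFinitary : Prop :=
  ∀ m, ∃ N : ℕ, ∀ g : GLInf k,
    (∀ i < N, stdRep k g (Finsupp.single i 1) = Finsupp.single i 1) → ρ g m = m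

lemma stdRep_inv_apply_eq {g : GLInf k} {v w : ℕ →₀ k} (h : stdRep k g v = w) :
    stdRep k g⁻¹ w = v := by
  rw [← h, ← Module.End.mul_apply, ← map_mul, inv_mul_cancel, map_one, Module.End.one_apply]

/-- The action on a finitary vector depends on the images of finitely many `e_i` only. -/
lemma IsFinitary.exists_apply_eq (h : IsFinitary ρ) (m : M) : ∃ N : ℕ, ∀ g g' : GLInf k,
    (∀ i < N, stdRep k g (Finsupp.single i 1) = stdRep k g' (Finsupp.single i 1)) →
    ρ g m = ρ g' m := by
  obtain ⟨N, hN⟩ := h m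
  refine ⟨N, fun g g' hg => ?_⟩
  have h1 : ρ (g'⁻¹ * g) m = m := hN _ fun i hi => by
    rw [map_mul, Module.End.mul_apply, hg i hi]
    exact stdRep_inv_apply_eq rfl
  conv_rhs => rw [← h1]
  rw [← Module.End.mul_apply, ← map_mul, mul_inv_cancel_left]

variable (ρ) in
/-- The shift of a finitary vector by `n` coordinates. -/
def shiftVec (n : ℕ) (h : IsFinitary ρ) (m : M) : M :=
  ρ (shiftElt k n (h.exists_apply_eq m).choose) m

lemma shiftVec_spec (n : ℕ) (h : IsFinitary ρ) (m : M) :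
    ∃ N, ∀ N', N ≤ N' → ρ (shiftElt k n N') m = shiftVec ρ n h m := by
  refine ⟨(h.exists_apply_eq m).choose, fun N' hN' => ?_⟩
  refine (h.exists_apply_eq m).choose_spec _ _ fun i hi => ?_
  rw [stdRep_shiftElt (by omega), stdRep_shiftElt hi]

lemma shiftVec_apply (n : ℕ) (h : IsFinitary ρ) (g : GLInf k) (m : M) :
    shiftVec ρ n h (ρ g m) = ρ (up k n g) (shiftVec ρ n h m) := by
  obtain ⟨N₁, hN₁⟩ := shiftVec_spec n h (ρ g m)
  obtain ⟨N₂, hN₂⟩ := shiftVec_spec n h m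
  obtain ⟨N₃, hN₃⟩ := h.exists_apply_eq m
  let N₄ := (Finset.range N₃).sup fun i => (stdRep k g (Finsupp.single i 1)).support.sup id + 1
  let N := max (max N₁ N₂) (max N₃ N₄)
  rw [← hN₁ N (by simp [N]), ← hN₂ N (by simp [N]), ← Module.End.mul_apply, ← map_mul,
    ← Module.End.mul_apply, ← map_mul]
  refine hN₃ _ _ fun i hi => ?_
  have hiN : i < N := hi.trans_le (by simp [N])
  rw [map_mul, Module.End.mul_apply, map_mul, Module.End.mul_apply, stdRep_shiftElt hiN,
    ← sh_single, stdRep_up_sh, ← sub_eq_zero, ← LinearMap.sub_apply]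
  refine map_eq_zero_of_support _ _ fun j hj => ?_
  have h1 : j ≤ (stdRep k g (Finsupp.single i 1)).support.sup id :=
    Finset.le_sup (f := id) (by simpa using hj)
  have h2 : (stdRep k g (Finsupp.single i 1)).support.sup id + 1 ≤ N₄ :=
    Finset.le_sup (f := fun i => (stdRep k g (Finsupp.single i 1)).support.sup id + 1)
      (Finset.mem_range.2 hi)
  have h3 : N₄ ≤ N := by simp [N]
  rw [LinearMap.sub_apply, stdRep_shiftElt (by omega), sh_single, sub_self]

lemma eq_zero_of_shiftVec (n : ℕ) (h : IsFinitary ρ) {m : M} (hm : shiftVec ρ n h m = 0) :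
    m = 0 := by
  obtain ⟨N, hN⟩ := shiftVec_spec n h m
  rw [← hN N le_rfl] at hm
  have := congrArg (ρ (shiftElt k n N)⁻¹) hm
  rwa [map_zero, ← Module.End.mul_apply, ← map_mul, inv_mul_cancel, map_one,
    Module.End.one_apply] at this

lemma shiftVec_add (n : ℕ) (h : IsFinitary ρ) (m m' : M) :
    shiftVec ρ n h (m + m') = shiftVec ρ n h m + shiftVec ρ n h m' := by
  obtain ⟨N₁, hN₁⟩ := shiftVec_spec n h m
  obtain ⟨N₂, hN₂⟩ := shiftVec_spec n h m'
  obtain ⟨N₃, hN₃⟩ := shiftVec_spec n h (m + m')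
  let N := max (max N₁ N₂) N₃
  rw [← hN₁ N (by simp [N]), ← hN₂ N (by simp [N]), ← hN₃ N (by simp [N]), map_add]

end ShiftVector

section Globalize

variable {R : Type v} [CommRing R] [Algebra k R] {α : GLInf k →* (R ≃ₐ[k] R)}
  {M : Type w} [AddCommGroup M] [Module k M] [Module R M] [IsScalarTower k R M]
  {ρ : Representation k (GLInf k) M}

lemma IsFinitary.of_span (hα : IsAlgebraicAction α) (hρ : IsSemilinear α ρ) {s : Set M}
    (hs : Submodule.span R s = ⊤)
    (h : ∀ m ∈ s, ∃ N : ℕ, ∀ g : GLInf k,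
      (∀ i < N, stdRep k g (Finsupp.single i 1) = Finsupp.single i 1) → ρ g m = m) :
    IsFinitary ρ := by
  intro m
  have hm : m ∈ Submodule.span R s := by rw [hs]; trivial
  induction hm using Submodule.span_induction with
  | mem m hm => exact h m hm
  | zero => exact ⟨0, fun g _ => map_zero _⟩
  | add x y _ _ hx hy =>
    obtain ⟨N, hN⟩ := hx
    obtain ⟨N', hN'⟩ := hy
    refine ⟨max N N', fun g hg => ?_⟩
    rw [map_add, hN g fun i hi => hg i (lt_max_of_lt_left hi),
      hN' g fun i hi => hg i (lt_max_of_lt_right hi)]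
  | smul r x _ hx =>
    obtain ⟨N, hN⟩ := hx
    obtain ⟨N', hN'⟩ := hα.finitary r
    refine ⟨max N N', fun g hg => ?_⟩
    rw [hρ, hN g fun i hi => hg i (lt_max_of_lt_left hi),
      hN' g fun i hi => hg i (lt_max_of_lt_right hi)]

/-- If `Φ` is equivariant for `GL` acting on the coordinates from `n` on, then
`m ↦ (δ ⊗ 1) (Φ (shift m))` is equivariant for `GL`; it is `R`-linear because `δ` splits off the
shift of `R`. -/
lemma exists_equivariant_of_equivariantFrom {S : Type*} [CommRing S] [Algebra k S]
    {σ : GLInf k →* (S ≃ₐ[k] S)} {δ : R →ₐ[k] R ⊗[k] S} {n : ℕ} (hδ : Function.Injective δ)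
    (hσ : ∀ g r, δ (α (up k n g) r) =
      Algebra.TensorProduct.map (α g).toAlgHom (σ g).toAlgHom (δ r))
    (hsh : ∀ r, ∃ N, ∀ N', N ≤ N' → δ (α (shiftElt k n N') r) = r ⊗ₜ 1)
    (hρ : IsSemilinear α ρ) (hfin : IsFinitary ρ) {d : ℕ} (Φ : M →ₗ[R] R ⊗[k] Tens k d)
    (hΦ : ∀ g ∈ GLFrom k n, ∀ m, Φ (ρ g m) = semiRep α (tensorRep k (Fin d)) g (Φ m)) :
    ∃ Ψ : M →ₗ[R] R ⊗[k] (S ⊗[k] Tens k d),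
      (∀ g m, Ψ (ρ g m) =
        semiRep α ((algRep σ).tprod ((tensorRep k (Fin d)).comp (up k n))) g (Ψ m)) ∧
      ∀ m, Ψ m = 0 → Φ (shiftVec ρ n hfin m) = 0 := by
  -- `D` is semilinear along `δ`, and `δ` carries shifted scalars to scalars
  let D : R ⊗[k] Tens k d →ₗ[k] (R ⊗[k] S) ⊗[k] Tens k d := δ.toLinearMap.rTensor (Tens k d)
  have : Module.Free k (Tens k d) := .of_basis (wordBasis k d)
  have hD : Function.Injective D :=
    Module.Flat.rTensor_preserves_injective_linearMap (M := Tens k d) δ.toLinearMap hδ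
  let e := TensorProduct.AlgebraTensorModule.assoc k k R R S (Tens k d)
  have hDsmul : ∀ (r : R) y, δ r • D y = D (r • y) := by
    intro r y
    induction y using TensorProduct.induction_on with
    | zero => simp
    | tmul r' x =>
      simp only [D, LinearMap.rTensor_tmul, TensorProduct.smul_tmul', AlgHom.toLinearMap_apply,
        smul_eq_mul, map_mul]
    | add x y hx hy => simp only [smul_add, map_add, hx, hy]
  have hsmul : ∀ (r : R) (z : (R ⊗[k] S) ⊗[k] Tens k d),
      (r ⊗ₜ[k] (1 : S)) • z = r • z := by
    intro r z
    induction z using TensorProduct.induction_on with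
    | zero => simp
    | tmul y x =>
      rw [TensorProduct.smul_tmul', TensorProduct.smul_tmul']
      congr 1
      induction y using TensorProduct.induction_on with
      | zero => simp
      | tmul r' s => simp [TensorProduct.smul_tmul']
      | add x y hx hy => simp only [smul_add, hx, hy]
    | add x y hx hy => simp only [smul_add, hx, hy]
  have hDg : ∀ g y, e (D (semiRep α (tensorRep k (Fin d)) (up k n g) y)) =
      semiRep α ((algRep σ).tprod ((tensorRep k (Fin d)).comp (up k n))) g (e (D y)) := by
    intro g y
    induction y using TensorProduct.induction_on with
    | zero => simp
    | tmul r x =>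
      simp only [D, semiRep_tmul, LinearMap.rTensor_tmul, AlgHom.toLinearMap_apply, hσ]
      generalize δ r = z
      induction z using TensorProduct.induction_on with
      | zero => simp
      | tmul r s => rfl
      | add x y hx hy => simp only [map_add, TensorProduct.add_tmul, hx, hy]
    | add x y hx hy => simp only [map_add, hx, hy]
  refine ⟨⟨⟨fun m => e (D (Φ (shiftVec ρ n hfin m))), fun m m' => ?_⟩, fun r m => ?_⟩,
    fun g m => ?_, fun m hm => ?_⟩
  · rw [shiftVec_add, map_add, map_add, map_add]
  · obtain ⟨N₁, hN₁⟩ := shiftVec_spec n hfin m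
    obtain ⟨N₂, hN₂⟩ := shiftVec_spec n hfin (r • m)
    obtain ⟨N₃, hN₃⟩ := hsh r
    let N := max (max N₁ N₂) N₃
    dsimp only [RingHom.id_apply]
    rw [← hN₁ N (by simp [N]), ← hN₂ N (by simp [N]), hρ, map_smul, ← hDsmul,
      hN₃ N (by simp [N]), hsmul, map_smul]
  · change e (D (Φ (shiftVec ρ n hfin (ρ g m)))) =
      semiRep α _ g (e (D (Φ (shiftVec ρ n hfin m))))
    rw [shiftVec_apply, hΦ _ (up_mem_GLFrom n g), hDg]
  · change e (D (Φ (shiftVec ρ n hfin m))) = 0 at hm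
    rw [LinearEquiv.map_eq_zero_iff] at hm
    exact hD (hm.trans (map_zero _).symm)

/-- A torsion-free module that is generated by the images of finitely many tensor powers embeds
into a finite sum of modules `R ⊗ 𝐕^{⊗e}`. -/
theorem exists_equivariant_family [CharZero k] [IsDomain R] [Module.IsTorsionFree R M]
    (hα : IsAlgebraicAction α) (hsh : IsShiftable α) (hρ : IsSemilinear α ρ)
    {ι : ℕ → Type} [∀ e, Finite (ι e)] (f : ∀ e, ι e → Tens k e →ₗ[k] M)
    (hf : ∀ e i g x, f e i (tensorRep k (Fin e) g x) = ρ g (f e i x)) {d : ℕ}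
    (hd : genSpan R f d = ⊤) (hM : IsFinitelyGLGenerated R ρ) :
    ∃ (J : Type) (_ : Finite J) (e : J → ℕ) (Ψ : ∀ j, M →ₗ[R] R ⊗[k] Tens k (e j)),
      (∀ j g m, Ψ j (ρ g m) = semiRep α (tensorRep k (Fin (e j))) g (Ψ j m)) ∧
      ∀ m, (∀ j, Ψ j m = 0) → m = 0 := by
  classical
  obtain ⟨n, -, I, _, c, Φ, hΦ, hΦinj⟩ := separated_genSpan hα hρ d 0 ι inferInstance f
    fun e i g _ x => hf e i g x
  have hfin : IsFinitary ρ := by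
    refine IsFinitary.of_span hα hρ hd ?_
    rintro _ ⟨e, _, i, x, rfl⟩
    obtain ⟨N, hN⟩ := exists_tensMap_eq x
    refine ⟨N, fun g hg => ?_⟩
    rw [← hf]
    have := hN (stdRep k g) LinearMap.id hg
    rw [tensMap_id] at this
    exact congrArg (f e i) this
  let T : M →ₗ[R] genSpan R f d := LinearMap.id.codRestrict _ fun m => by rw [hd]; trivial
  obtain ⟨S, _, _, σ, δ, hσ, hδ, h1, h2⟩ := hsh n
  choose Ψ hΨ hΨ0 using fun i => exists_equivariant_of_equivariantFrom hδ h1 h2 hρ hfin (Φ i ∘ₗ T)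
    fun g hg m => hΦ i g hg (T m) (T (ρ g m)) rfl
  have hinj : ∀ m, (∀ i, Ψ i m = 0) → m = 0 := fun m hm => by
    refine eq_zero_of_shiftVec n hfin ?_
    exact congrArg Subtype.val (hΦinj (T (shiftVec ρ n hfin m)) fun i => hΨ0 i m (hm i))
  have hemb : ∀ i, EmbedsInTens ((algRep σ).tprod ((tensorRep k (Fin (c i))).comp (up k n))) :=
    fun i => hσ.tprod (((embedsInTens_stdRep_up n).powRep_fin (c i)).of_injective LinearMap.id
      (fun _ _ => rfl) fun _ h => h)
  choose K b θ hθ hθfin hθinj using hemb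
  obtain ⟨G, hG⟩ := hM
  have hfinR : ∀ i (y : R ⊗[k] (S ⊗[k] Tens k (c i))),
      {κ | (θ i κ).baseChange R y ≠ 0}.Finite := by
    intro i y
    induction y using TensorProduct.induction_on with
    | zero => simp
    | tmul r x =>
      refine (hθfin i x).subset fun κ hκ h0 => hκ ?_
      rw [LinearMap.baseChange_tmul, h0, TensorProduct.tmul_zero]
    | add x y hx hy =>
      refine (hx.union hy).subset fun i hi => ?_
      by_contra hc
      simp only [Set.mem_union, Set.mem_ofPred_eq, not_or, not_not] at hc
      exact hi (by rw [map_add, hc.1, hc.2, add_zero])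
  -- the maps that do not vanish at the finitely many generators; the others vanish identically
  let J : Set (Σ i, K i) := ⋃ i, ⋃ m ∈ G, Sigma.mk i '' {κ | (θ i κ).baseChange R (Ψ i m) ≠ 0}
  have hJ : J.Finite := Set.finite_iUnion fun i => G.finite_toSet.biUnion fun m _ =>
    (hfinR i _).image _
  have heq : ∀ i κ g m, (θ i κ).baseChange R (Ψ i (ρ g m)) =
      semiRep α (tensorRep k (Fin (b i κ))) g ((θ i κ).baseChange R (Ψ i m)) := by
    intro i κ g m
    rw [hΨ, semiRep_baseChange (π' := tensorRep k (Fin (b i κ)))]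
    exact fun x => hθ i κ g x
  refine ⟨J, hJ.to_subtype, fun j => b j.1.1 j.1.2, fun j => (θ j.1.1 j.1.2).baseChange R ∘ₗ
    Ψ j.1.1, fun j g m => heq _ _ g m, fun m hm => hinj m fun i => ?_⟩
  refine eq_zero_of_lTensor (θ i) (hθinj i) _ fun κ => ?_
  change (θ i κ).baseChange R (Ψ i m) = 0
  by_cases hκ : (⟨i, κ⟩ : Σ i, K i) ∈ J
  · exact hm ⟨_, hκ⟩
  · have h0 : (θ i κ).baseChange R ∘ₗ Ψ i = 0 := by
      refine LinearMap.ext_on hG ?_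
      rintro _ ⟨g, m, hm, rfl⟩
      rw [LinearMap.comp_apply, heq, LinearMap.zero_apply]
      have : (θ i κ).baseChange R (Ψ i m) = 0 := by
        by_contra hne
        exact hκ (Set.mem_iUnion.2 ⟨i, Set.mem_biUnion hm ⟨κ, hne, rfl⟩⟩)
      rw [this, map_zero]
    exact LinearMap.congr_fun h0 m

end Globalize

/-! ### Polynomial representations are generated by images of tensor powers -/

section PolynomialReps

section Span

variable {X : Type*} [AddCommMonoid X] [Module k X] {π : Representation k (GLInf k) X}

variable (π) in
/-- The span of the images of the equivariant maps from tensor powers of `𝐕` to `X` with values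
in `N`. -/
def equivariantSpan (N : Submodule k X) : Submodule k X :=
  Submodule.span k {m | ∃ (e : ℕ) (f : Tens k e →ₗ[k] X) (x : Tens k e),
    (∀ g y, f (tensorRep k (Fin e) g y) = π g (f y)) ∧ (∀ y, f y ∈ N) ∧ f x = m}

lemma map_mem_equivariantSpan {Y : Type*} [AddCommMonoid Y] [Module k Y]
    {π' : Representation k (GLInf k) Y} {N : Submodule k X} (φ : N →ₗ[k] Y)
    (hN : ∀ g, ∀ m ∈ N, π g m ∈ N) (hφ : ∀ g (m : N), φ ⟨π g m, hN g m m.2⟩ = π' g (φ m)) {m : N}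
    (hm : (m : X) ∈ equivariantSpan π N) : φ m ∈ equivariantSpan π' ⊤ := by
  suffices ∀ x ∈ equivariantSpan π N, ∃ h : x ∈ N, φ ⟨x, h⟩ ∈ equivariantSpan π' ⊤ from
    (this m hm).2
  intro x hx
  induction hx using Submodule.span_induction with
  | mem x hx =>
    obtain ⟨e, f, y, hf, hfN, rfl⟩ := hx
    refine ⟨hfN y, Submodule.subset_span ⟨e, φ ∘ₗ f.codRestrict N hfN, y, fun g z => ?_,
      fun _ => trivial, rfl⟩⟩
    rw [LinearMap.comp_apply, LinearMap.comp_apply, ← hφ]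
    congr 1
    exact Subtype.ext (hf g z)
  | zero => exact ⟨N.zero_mem, by rw [show (⟨0, N.zero_mem⟩ : N) = 0 from rfl, map_zero]; simp⟩
  | add x y _ _ hx hy =>
    obtain ⟨hx, hx'⟩ := hx
    obtain ⟨hy, hy'⟩ := hy
    refine ⟨N.add_mem hx hy, ?_⟩
    rw [show (⟨x + y, N.add_mem hx hy⟩ : N) = ⟨x, hx⟩ + ⟨y, hy⟩ from rfl, map_add]
    exact add_mem hx' hy'
  | smul r x _ hx =>
    obtain ⟨hx, hx'⟩ := hx
    refine ⟨N.smul_mem r hx, ?_⟩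
    rw [show (⟨r • x, N.smul_mem r hx⟩ : N) = r • ⟨x, hx⟩ from rfl, map_smul]
    exact Submodule.smul_mem _ _ hx'

end Span

section Group

variable {X : Type*} [AddCommGroup X] [Module k X] {π : Representation k (GLInf k) X}

lemma map_smul_one_add {e : ℕ} (η : (ℕ →₀ k) →ₗ[k] (ℕ →₀ k)) (hη : IsSqZero η) {t : k}
    (ht : t ≠ 0) (x : Tens k e) :
    PiTensorProduct.map (fun _ => t • LinearMap.id + η) x =
      t ^ e • tensorRep k (Fin e) (unip _ (hη.smul t⁻¹)) x := by
  have : PiTensorProduct.map (fun _ => t • LinearMap.id + η) =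
      t ^ e • tensorRep k (Fin e) (unip _ (hη.smul t⁻¹)) := by
    ext v
    have h := (PiTensorProduct.tprod k (s := fun _ : Fin e => (ℕ →₀ k))).map_smul_univ
      (fun _ => t) fun i => stdRep k (unip _ (hη.smul t⁻¹)) (v i)
    rw [Finset.prod_const, Finset.card_univ, Fintype.card_fin] at h
    simp only [LinearMap.compMultilinearMap_apply, PiTensorProduct.map_tprod,
      LinearMap.smul_apply, tensorRep_tprod]
    rw [← h]
    congr 1
    ext1 i
    simp [smul_smul, ht]
  rw [this]
  rfl

lemma polyFuns_map_smul_one_add {e : ℕ} (η : (ℕ →₀ k) →ₗ[k] (ℕ →₀ k)) (x : Tens k e) :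
    (fun t : k => PiTensorProduct.map (fun _ => t • LinearMap.id + η) x) ∈
      polyFuns k (Tens k e) := by
  induction x using PiTensorProduct.induction_on with
  | smul_tprod r v =>
    have := (polyFuns k (Tens k e)).smul_mem r
      (polyFuns_multilinear (PiTensorProduct.tprod k (s := fun _ : Fin e => (ℕ →₀ k)))
        (fun i => η (v i)) v)
    convert this using 1
    ext1 t
    simp [PiTensorProduct.map_tprod, add_comm]
  | add x y hx hy =>
    convert (polyFuns k (Tens k e)).add_mem hx hy using 1
    ext1 t
    simp

variable [CharZero k]

/-- The part of top degree of an element of `N`, after a substitution of letters: it is the limit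
`t → 0` of `t^d (1 + t⁻¹ η)`. -/
lemma sum_map_mem {N : Submodule k X} (hN : ∀ g, ∀ m ∈ N, π g m ∈ N) {ι : ℕ → Type*}
    [∀ e, Fintype (ι e)] {f : ∀ e, ι e → Tens k e →ₗ[k] X}
    (hf : ∀ e i g y, f e i (tensorRep k (Fin e) g y) = π g (f e i y)) {d : ℕ}
    (x : ∀ e, ι e → Tens k e) (hx : ∑ e ∈ Finset.range (d + 1), ∑ i, f e i (x e i) ∈ N)
    {η : (ℕ →₀ k) →ₗ[k] (ℕ →₀ k)} (hη : IsSqZero η) :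
    ∑ i, f d i (PiTensorProduct.map (fun _ => η) (x d i)) ∈ N := by
  let F : k → X := fun t => ∑ e ∈ Finset.range (d + 1), ∑ i,
    t ^ (d - e) • f e i (PiTensorProduct.map (fun _ => t • LinearMap.id + η) (x e i))
  have hF : F ∈ polyFuns k X := by
    refine polyFuns_sum _ fun e _ => polyFuns_sum _ fun i _ => ?_
    have h1 := monomial_mem_polyFuns (k := k) (d - e) (1 : k)
    have h2 := polyFuns_bilin (LinearMap.lsmul k X) h1
      (polyFuns_map (f e i) (polyFuns_map_smul_one_add η (x e i)))
    simpa using h2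
  have h0 := polyFuns_zero_mem hF N fun t ht => ?_
  · convert h0 using 1
    change _ = ∑ e ∈ Finset.range (d + 1), ∑ i,
      (0 : k) ^ (d - e) • f e i (PiTensorProduct.map (fun _ => (0 : k) • LinearMap.id + η) (x e i))
    symm
    rw [Finset.sum_range_succ, Finset.sum_eq_zero (s := Finset.range d), zero_add]
    · simp
    · intro e he
      rw [Finset.mem_range] at he
      simp [zero_pow (show d - e ≠ 0 by omega)]
  · have h1 : F t = t ^ d • π (unip _ (hη.smul t⁻¹))
        (∑ e ∈ Finset.range (d + 1), ∑ i, f e i (x e i)) := by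
      simp only [F, map_sum, Finset.smul_sum]
      refine Finset.sum_congr rfl fun e he => Finset.sum_congr rfl fun i _ => ?_
      rw [map_smul_one_add η hη ht, map_smul, hf, smul_smul, ← pow_add]
      congr 2
      rw [Finset.mem_range] at he
      omega
    rw [h1]
    exact N.smul_mem _ (hN _ _ hx)

/-- The part of top degree `d` of an element of `N` is, up to the factor `d!`, the sum of the
values at the words `col` of the maps `∑ c(col ∘ τ) f ∘ τ`, which have values in `N`. -/
lemma sum_range_mem_equivariantSpan {N : Submodule k X} (hN : ∀ g, ∀ m ∈ N, π g m ∈ N) (d : ℕ) :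
    ∀ {ι : ℕ → Type*} [∀ e, Fintype (ι e)] {f : ∀ e, ι e → Tens k e →ₗ[k] X}
      (_ : ∀ e i g y, f e i (tensorRep k (Fin e) g y) = π g (f e i y))
      (x : ∀ e, ι e → Tens k e), ∑ e ∈ Finset.range d, ∑ i, f e i (x e i) ∈ N →
        ∑ e ∈ Finset.range d, ∑ i, f e i (x e i) ∈ equivariantSpan π N := by
  classical
  induction d with
  | zero => simp
  | succ d ih =>
    intro ι _ f hf x hx
    let c : ι d → (Fin d → ℕ) → k := fun i => (wordBasis k d).repr (x d i)
    let W : Finset (Fin d → ℕ) := Finset.univ.biUnion fun i => ((wordBasis k d).repr (x d i)).support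
    have hW : ∀ i w, w ∉ W → c i w = 0 := by
      intro i w hw
      simp only [W, Finset.mem_biUnion, Finset.mem_univ, true_and, not_exists,
        Finsupp.mem_support_iff, not_not] at hw
      exact hw i
    have hxW : ∀ i, x d i = ∑ w ∈ W, c i w • word k w := by
      intro i
      conv_lhs => rw [← (wordBasis k d).linearCombination_repr (x d i)]
      rw [Finsupp.linearCombination_apply, Finsupp.sum_of_support_subset (s := W)]
      · simp [c, wordBasis_apply]
      · intro w hw
        exact Finset.mem_biUnion.2 ⟨i, Finset.mem_univ i, hw⟩
      · simp
    -- the equivariant maps whose values add up to the part of top degree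
    let F : (Fin d → ℕ) → Tens k d →ₗ[k] X := fun col =>
      relMap (f d) fun i => c i.2 (col ∘ i.1)
    have hFeq : ∀ col g y, F col (tensorRep k (Fin d) g y) = π g (F col y) := by
      intro col g y
      rw [relMap_apply, relMap_apply, map_sum]
      simp only [permT_tensorRep, hf, map_smul]
    -- by density it suffices to test one tensor of distinct basis vectors, at which the value is a
    -- combination of substitutions of the part of top degree
    have hFN : ∀ col y, F col y ∈ N := by
      intro col
      obtain ⟨M, hM⟩ : ∃ M, ∀ l, col l < M :=
        ⟨Finset.univ.sup col + 1, fun l => Nat.lt_succ_of_le (Finset.le_sup (Finset.mem_univ l))⟩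
      have h1 : F col (word k fun i => M + i) ∈ N := by
        rw [relMap_eq_sum_polarization (f d) c W hW col M]
        refine N.sum_mem fun S _ => N.smul_mem _ ?_
        convert sum_map_mem hN hf x hx (isSqZero_spread hM S) using 1
        refine Finset.sum_congr rfl fun i _ => ?_
        conv_rhs => rw [hxW i]
        simp only [map_sum, map_smul, word, PiTensorProduct.map_tprod, spread_single]
      have h2 : ∀ v, F col (PiTensorProduct.tprod k v) ∈ N := fun v =>
        map_tprod_mem_of_single (n := 0) N (F col) (fun g _ y hy => by
          rw [hFeq]; exact hN g _ hy) (a := fun i : Fin d => M + i)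
          (fun i j hij => by simpa [Fin.ext_iff] using hij) (fun _ => Nat.zero_le _) h1 v
          fun _ _ h => absurd h (Nat.not_lt_zero _)
      intro y
      induction y using PiTensorProduct.induction_on with
      | smul_tprod r v => rw [map_smul]; exact N.smul_mem _ (h2 v)
      | add x y hx hy => rw [map_add]; exact N.add_mem hx hy
    have hFspan : ∀ col y, F col y ∈ equivariantSpan π N := fun col y =>
      Submodule.subset_span ⟨d, F col, y, hFeq col, hFN col, rfl⟩
    -- all words that are rearrangements of words of `W`
    let W' : Finset (Fin d → ℕ) :=
      Finset.univ.biUnion fun τ : Equiv.Perm (Fin d) => W.image fun w => w ∘ ⇑τ⁻¹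
    -- each permutation contributes the part of top degree once
    have htop : (d.factorial : k) • ∑ i, f d i (x d i) = ∑ col ∈ W', F col (word k col) := by
      have h1 : ∀ i (τ : Equiv.Perm (Fin d)),
          ∑ col ∈ W', c i (col ∘ τ) • f d i (word k (col ∘ τ)) = f d i (x d i) := by
        intro i τ
        rw [hxW i, map_sum]
        simp only [map_smul]
        symm
        refine Finset.sum_of_injOn (fun w => w ∘ ⇑τ⁻¹) ?_ ?_ ?_ ?_
        · intro w _ w' _ h
          ext l
          simpa using congrFun h (τ l)
        · intro w hw
          exact Finset.mem_biUnion.2 ⟨τ, Finset.mem_univ τ, Finset.mem_image_of_mem _ hw⟩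
        · intro col _ hcol
          rw [hW i, zero_smul]
          intro hmem
          refine hcol ⟨col ∘ τ, hmem, ?_⟩
          ext l
          simp
        · intro w _
          have : (w ∘ ⇑τ⁻¹) ∘ ⇑τ = w := by ext l; simp
          rw [this]
      simp only [F, relMap_apply, permT_word]
      rw [Finset.sum_comm, Fintype.sum_prod_type]
      simp only [h1, Finset.sum_const, Finset.card_univ, Fintype.card_perm, Fintype.card_fin]
      rw [Nat.cast_smul_eq_nsmul]
    have htop' : ∑ i, f d i (x d i) ∈ equivariantSpan π N ⊓ N := by
      have h0 : (d.factorial : k) ≠ 0 := by exact_mod_cast d.factorial_ne_zero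
      rw [← inv_smul_smul₀ h0 (∑ i, f d i (x d i)), htop]
      exact Submodule.smul_mem _ _ (Submodule.sum_mem _ fun col _ => ⟨hFspan _ _, hFN _ _⟩)
    rw [Finset.sum_range_succ] at hx ⊢
    refine add_mem (ih hf x ?_) htop'.1
    have := N.sub_mem hx htop'.2
    rwa [add_sub_cancel_right] at this

end Group

lemma sum_range_mem_equivariantSpan' [CharZero k] {X : Type*} [AddCommMonoid X] [Module k X]
    {π : Representation k (GLInf k) X} {N : Submodule k X} (hN : ∀ g, ∀ m ∈ N, π g m ∈ N) (d : ℕ)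
    {ι : ℕ → Type*} [∀ e, Fintype (ι e)] {f : ∀ e, ι e → Tens k e →ₗ[k] X}
    (hf : ∀ e i g y, f e i (tensorRep k (Fin e) g y) = π g (f e i y))
    (x : ∀ e, ι e → Tens k e) (hx : ∑ e ∈ Finset.range d, ∑ i, f e i (x e i) ∈ N) :
    ∑ e ∈ Finset.range d, ∑ i, f e i (x e i) ∈ equivariantSpan π N :=
  let _ : AddCommGroup X := Module.addCommMonoidToAddCommGroup k
  sum_range_mem_equivariantSpan hN d hf x hx

variable [CharZero k] {X : Type*} [AddCommGroup X] [Module k X] {π : Representation k (GLInf k) X}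

lemma tensorRep_cast {d e : ℕ} (h : d = e) (g : GLInf k) (x : Tens k d) :
    TensorPower.cast k (ℕ →₀ k) h (tensorRep k (Fin d) g x) =
      tensorRep k (Fin e) g (TensorPower.cast k (ℕ →₀ k) h x) := by
  subst h
  rw [TensorPower.cast_refl]
  rfl

/-- A polynomial representation is spanned by the images of tensor powers: this is proved for a lift
of the given element to a subrepresentation of a sum of tensor powers. -/
lemma IsPolynomial.mem_equivariantSpan (h : IsPolynomial π) (m : X) :
    m ∈ equivariantSpan π ⊤ := by
  classical
  obtain ⟨J, d, N, q, hq⟩ := h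
  obtain ⟨u, rfl⟩ := hq m
  refine map_mem_equivariantSpan (π := Representation.directSum fun j : J =>
    tensorRep k (Fin (d j))) (N := N.toSubmodule) (π' := π) q.toLinearMap
    (fun g m hm => N.apply_mem_toSubmodule g hm)
    (fun g m => Representation.IntertwiningMap.isIntertwining _ _ q g m) (m := u) ?_
  let v : ⨁ j, Tens k (d j) := u
  let ι : ℕ → Type _ := fun e => {j : v.support // d j = e}
  let f : ∀ e, ι e → Tens k e →ₗ[k] ⨁ j, Tens k (d j) := fun e i =>
    DirectSum.lof k J (fun j => Tens k (d j)) i.1 ∘ₗ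
      (TensorPower.cast k (ℕ →₀ k) i.2.symm).toLinearMap
  let x : ∀ e, ι e → Tens k e := fun e i => TensorPower.cast k (ℕ →₀ k) i.2 (v i.1)
  have hv : ∑ e ∈ Finset.range (v.support.sup d + 1), ∑ i, f e i (x e i) = v := by
    have h1 : ∀ e (i : ι e), f e i (x e i) = DirectSum.lof k J (fun j => Tens k (d j)) i.1
        (v i.1) := by
      intro e i
      simp only [f, x, LinearMap.comp_apply, LinearEquiv.coe_coe, TensorPower.cast_cast,
        TensorPower.cast_refl, LinearEquiv.refl_apply]
    simp only [h1]
    conv_rhs => rw [← DirectSum.sum_support_of v, ← Finset.sum_coe_sort]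
    rw [← Finset.sum_fiberwise_of_maps_to (s := (Finset.univ : Finset v.support))
      (t := Finset.range (v.support.sup d + 1)) (g := fun j => d j)]
    · refine Finset.sum_congr rfl fun e _ => ?_
      symm
      exact Finset.sum_subtype _ (fun j => by simp) fun j : v.support =>
        DirectSum.of (fun j => Tens k (d j)) j (v j)
    · intro j _
      exact Finset.mem_range.2 (Nat.lt_succ_of_le (Finset.le_sup j.2))
  have h2 := sum_range_mem_equivariantSpan' (π := Representation.directSum fun j : J =>
    tensorRep k (Fin (d j))) (N := N.toSubmodule) (fun g m hm => N.apply_mem_toSubmodule g hm)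
    (v.support.sup d + 1) (ι := ι) (f := f) (fun e i g y => ?_) x (by rw [hv]; exact u.2)
  · rw [hv] at h2
    exact h2
  · simp only [f, LinearMap.comp_apply, LinearEquiv.coe_coe, tensorRep_cast]
    change _ = DirectSum.lmap _ _
    rw [DirectSum.lmap_lof]

lemma mem_orbitSpan (m : X) : m ∈ (orbitSpan π m).toSubmodule :=
  Submodule.subset_span ⟨1, by simp⟩

lemma IsPolynomialElement.map_mem_equivariantSpan {Y : Type*} [AddCommMonoid Y] [Module k Y]
    {π' : Representation k (GLInf k) Y} {m : X} (h : IsPolynomialElement π m)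
    (φ : (orbitSpan π m).toSubmodule →ₗ[k] Y)
    (hφ : ∀ g x, φ ((orbitSpan π m).toRepresentation g x) = π' g (φ x)) :
    φ ⟨m, mem_orbitSpan m⟩ ∈ equivariantSpan π' ⊤ := by
  have h1 := IsPolynomial.mem_equivariantSpan h ⟨m, mem_orbitSpan m⟩
  exact GLEmbed.map_mem_equivariantSpan (π := (orbitSpan π m).toRepresentation) (π' := π') (φ ∘ₗ (⊤ : Submodule k _).subtype)
    (fun _ _ _ => trivial) (fun g x => hφ g x.1) (m := ⟨⟨m, mem_orbitSpan m⟩, trivial⟩) h1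

/-- Finitely many elements of `equivariantSpan π ⊤` involve finitely many equivariant maps. -/
lemma exists_family_of_mem_equivariantSpan (R : Type*) [CommRing R] [Module R X]
    [SMul k R] [IsScalarTower k R X]
    (G : Finset X) (hG : ∀ m ∈ G, m ∈ equivariantSpan π ⊤) :
    ∃ (ι : ℕ → Type) (_ : ∀ e, Finite (ι e)) (f : ∀ e, ι e → Tens k e →ₗ[k] X) (d : ℕ),
      (∀ e i g x, f e i (tensorRep k (Fin e) g x) = π g (f e i x)) ∧
      ∀ m ∈ G, m ∈ genSpan R f d := by
  classical
  choose T hT hmT using fun m : G => Submodule.mem_span_finite_of_mem_span (hG m m.2)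
  let U : Finset X := Finset.univ.biUnion T
  have hU : ∀ u : U, ∃ (e : ℕ) (f : Tens k e →ₗ[k] X) (x : Tens k e),
      (∀ g y, f (tensorRep k (Fin e) g y) = π g (f y)) ∧ f x = u := by
    intro u
    obtain ⟨m, -, hm⟩ := Finset.mem_biUnion.1 u.2
    obtain ⟨e, f, x, h1, -, h2⟩ := hT m hm
    exact ⟨e, f, x, h1, h2⟩
  choose e f x hf hx using hU
  let a := U.equivFin
  refine ⟨fun c => {i : Fin U.card // e (a.symm i) = c}, fun c => inferInstance,
    fun c i => f (a.symm i.1) ∘ₗ (TensorPower.cast k (ℕ →₀ k) i.2.symm).toLinearMap,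
    Finset.univ.sup e + 1, fun c i g y => ?_, fun m hm => ?_⟩
  · rw [LinearMap.comp_apply, LinearMap.comp_apply, LinearEquiv.coe_coe, tensorRep_cast, hf]
  · have h1 : Submodule.span k (T ⟨m, hm⟩ : Set X) ≤
        (genSpan R (fun c (i : {i : Fin U.card // e (a.symm i) = c}) => f (a.symm i.1) ∘ₗ
          (TensorPower.cast k (ℕ →₀ k) i.2.symm).toLinearMap)
          (Finset.univ.sup e + 1)).restrictScalars k := by
      refine Submodule.span_le.2 fun u hu => ?_
      have huU : u ∈ U := Finset.mem_biUnion.2 ⟨⟨m, hm⟩, Finset.mem_univ _, hu⟩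
      refine Submodule.subset_span ⟨e ⟨u, huU⟩,
        Nat.lt_succ_of_le (Finset.le_sup (f := e) (Finset.mem_univ _)), ⟨a ⟨u, huU⟩, by simp⟩,
        x ⟨u, huU⟩, ?_⟩
      have h2 : ∀ (u' : U) (_ : u' = ⟨u, huU⟩) (h : e u' = e ⟨u, huU⟩),
          f u' (TensorPower.cast k (ℕ →₀ k) h.symm (x ⟨u, huU⟩)) = u := by
        rintro _ rfl h
        rw [TensorPower.cast_refl]
        exact hx ⟨u, huU⟩
      exact h2 _ (a.symm_apply_apply _) (by rw [a.symm_apply_apply])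
    exact h1 (hmT ⟨m, hm⟩)

end PolynomialReps

/-! ### Young symmetrizers in the group algebra -/

section Diagrams

/-- The weight `i - λ'_j` of a cell `(i, j)`, where `λ'_j` is the length of the column `j`, is
negative exactly on the diagram; sums of weights compare other sets of cells with the diagram. -/
lemma mem_cells_iff_weight_neg (l : YoungDiagram) (c : ℕ × ℕ) :
    c ∈ l.cells ↔ (c.1 : ℤ) - l.colLen c.2 < 0 := by
  rw [sub_neg, Nat.cast_lt, ← YoungDiagram.mem_iff_lt_colLen]
  rfl

variable {X : Type*} [Fintype X]

lemma sum_equiv_cells {l : YoungDiagram} (e : X ≃ l.cells) (f : ℕ × ℕ → ℤ) :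
    ∑ x, f (e x).1 = ∑ c ∈ l.cells, f c := by
  rw [Equiv.sum_comp e (fun c => f c.1), Finset.sum_coe_sort l.cells f]

/-- If the cells of `l` are moved within their columns to distinct places, in rows given by `ρ`, then
the sum of the row indices does not decrease, and it is unchanged only if the cells of `l` are
permuted. -/
lemma sum_row_le {l : YoungDiagram} (e : X ≃ l.cells) (ρ : X → ℕ)
    (hinj : Function.Injective fun x => (ρ x, (e x).1.2)) :
    ∑ x, (e x).1.1 ≤ ∑ x, ρ x ∧
      (∑ x, ρ x ≤ ∑ x, (e x).1.1 → Finset.univ.map ⟨_, hinj⟩ = l.cells) := by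
  classical
  set S : Finset (ℕ × ℕ) := Finset.univ.map ⟨_, hinj⟩ with hS
  -- both sets of cells have the same columns, so their weights differ by the sums of the rows
  set W : ℕ × ℕ → ℤ := fun c => (c.1 : ℤ) - l.colLen c.2 with hW
  have h1 : ∑ c ∈ S, W c = ∑ x, (ρ x : ℤ) - ∑ x, (l.colLen (e x).1.2 : ℤ) := by
    rw [hS, Finset.sum_map, ← Finset.sum_sub_distrib]
    rfl
  have h2 : ∑ c ∈ l.cells, W c = ∑ x, ((e x).1.1 : ℤ) - ∑ x, (l.colLen (e x).1.2 : ℤ) := by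
    rw [← sum_equiv_cells e W, ← Finset.sum_sub_distrib]
  have h3 : ∑ c ∈ S \ l.cells, W c + ∑ c ∈ S ∩ l.cells, W c = ∑ c ∈ S, W c := by
    rw [add_comm]; exact Finset.sum_inter_add_sum_sdiff S l.cells W
  have h4 : ∑ c ∈ l.cells \ S, W c + ∑ c ∈ S ∩ l.cells, W c = ∑ c ∈ l.cells, W c := by
    rw [add_comm, Finset.inter_comm]; exact Finset.sum_inter_add_sum_sdiff l.cells S W
  have h5 : 0 ≤ ∑ c ∈ S \ l.cells, W c := by
    refine Finset.sum_nonneg fun c hc => ?_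
    have := (Finset.mem_sdiff.1 hc).2
    rw [mem_cells_iff_weight_neg] at this
    exact not_lt.1 this
  have h6 : ∀ c ∈ l.cells \ S, W c < 0 := fun c hc =>
    (mem_cells_iff_weight_neg l c).1 (Finset.mem_sdiff.1 hc).1
  have h7 : ∑ c ∈ l.cells \ S, W c ≤ 0 := Finset.sum_nonpos fun c hc => (h6 c hc).le
  refine ⟨by zify; linarith, fun hle => ?_⟩
  zify at hle
  have h8 : l.cells \ S = ∅ := by
    by_contra hne
    have := Finset.sum_neg h6 (Finset.nonempty_iff_ne_empty.2 hne)
    linarith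
  refine (Finset.eq_of_subset_of_card_le (Finset.sdiff_eq_empty_iff_subset.1 h8) ?_).symm
  rw [hS, Finset.card_map, Finset.card_univ, Fintype.card_congr e, Fintype.card_coe]

/-- If there are labellings such that each row of `m` meets each column of `l` at most once, and
labellings such that each row of `l` meets each column of `m` at most once, then the diagrams agree:
both row sums are equal, so the cells of `l` have the row lengths of `m`. -/
lemma eq_of_transversal {l m : YoungDiagram} (e e' : X ≃ l.cells) (f f' : X ≃ m.cells)
    (h : Function.Injective fun x => ((f x).1.1, (e x).1.2))
    (h' : Function.Injective fun x => ((e' x).1.1, (f' x).1.2)) : m = l := by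
  classical
  have hrow : ∀ {n : YoungDiagram} (g g' : X ≃ n.cells), ∑ x, (g x).1.1 = ∑ x, (g' x).1.1 := by
    intro n g g'
    rw [← Equiv.sum_comp (g.trans g'.symm) (fun x => (g' x).1.1)]
    simp
  have h1 := sum_row_le e _ h
  have h2 := sum_row_le f' _ h'
  have h3 := h1.2 (by rw [hrow f f', hrow e e']; exact h2.1)
  have hlen : ∀ i, m.rowLen i = l.rowLen i := by
    intro i
    rw [YoungDiagram.rowLen_eq_card, YoungDiagram.rowLen_eq_card, YoungDiagram.row,
      YoungDiagram.row, ← h3, Finset.filter_map, Finset.card_map]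
    have : m.cells = Finset.univ.map (f.toEmbedding.trans (Function.Embedding.subtype _)) := by
      ext c
      simp only [Finset.mem_map, Finset.mem_univ, true_and]
      exact ⟨fun hc => ⟨f.symm ⟨c, hc⟩, by simp⟩, by rintro ⟨x, rfl⟩; exact (f x).2⟩
    have hcard : ({c ∈ m.cells | c.1 = i} : Finset _).card =
        (Finset.univ.filter fun x => (f x).1.1 = i).card := by
      refine (congrArg (fun s : Finset (ℕ × ℕ) => (s.filter fun c => c.1 = i).card) this).trans ?_
      rw [Finset.filter_map, Finset.card_map]
      rfl
    rw [hcard]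
    rfl
  ext ⟨i, j⟩
  exact YoungDiagram.mem_iff_lt_rowLen.trans
    ((hlen i).symm ▸ YoungDiagram.mem_iff_lt_rowLen.symm)

/-- If the rows, permuted by `y`, still meet each column at most once, then they arise from the
original rows by a permutation preserving the columns. -/
lemma exists_perm_of_transversal {l : YoungDiagram} (e : X ≃ l.cells) (y : Equiv.Perm X)
    (h : Function.Injective fun x => ((e (y x)).1.1, (e x).1.2)) :
    ∃ q : Equiv.Perm X, (∀ x, (e (q x)).1.2 = (e x).1.2) ∧
      ∀ x, (e (q x)).1.1 = (e (y x)).1.1 := by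
  classical
  have h1 := (sum_row_le e (fun x => (e (y x)).1.1) h).2
    (Equiv.sum_comp y (fun x => (e x).1.1)).le
  have hmem : ∀ x, ((e (y x)).1.1, (e x).1.2) ∈ l.cells := fun x =>
    h1.le (Finset.mem_map_of_mem _ (Finset.mem_univ x))
  let F : X → X := fun x => e.symm ⟨_, hmem x⟩
  have hF : Function.Injective F := fun x x' hx => h (by
    simpa using e.symm.injective hx)
  refine ⟨Equiv.ofBijective F (Finite.injective_iff_bijective.1 hF), fun x => ?_, fun x => ?_⟩ <;>
  simp [F]

end Diagrams

section GroupAlgebra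

lemma eq_zero_of_eq_neg [CharZero k] {V : Type*} [AddCommGroup V] [Module k V] {v : V}
    (h : v = -v) : v = 0 := by
  have h2 : (2 : k) • v = 0 := by
    rw [two_smul]
    nth_rewrite 1 [h]
    exact neg_add_cancel v
  exact (smul_eq_zero.1 h2).resolve_left two_ne_zero

variable (k) {X : Type*} [Fintype X] [DecidableEq X]

local notation "𝔸" => MonoidAlgebra k (Equiv.Perm X)

/-- The sum of the permutations preserving the fibres of `r`. -/
def symSum (r : X → ℕ) : 𝔸 :=
  ∑ p : Equiv.Perm X with ∀ x, r (p x) = r x, MonoidAlgebra.of k _ p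

/-- The signed sum of the permutations preserving the fibres of `c`. -/
def altSum (c : X → ℕ) : 𝔸 :=
  ∑ p : Equiv.Perm X with ∀ x, c (p x) = c x,
    ((Equiv.Perm.sign p : ℤ) : k) • MonoidAlgebra.of k _ p

variable {k}

lemma sign_mul_self (q : Equiv.Perm X) :
    ((Equiv.Perm.sign q : ℤ) : k) * ((Equiv.Perm.sign q : ℤ) : k) = 1 := by
  rcases Int.units_eq_one_or (Equiv.Perm.sign q) with h | h <;> simp [h]

lemma preserves_inv {r : X → ℕ} {q : Equiv.Perm X} (hq : ∀ x, r (q x) = r x) (x : X) :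
    r (q⁻¹ x) = r x :=
  (hq (q⁻¹ x)).symm.trans (congrArg r (q.apply_symm_apply x))

lemma preserves_mul_right_iff {r : X → ℕ} {p q : Equiv.Perm X} (hq : ∀ x, r (q x) = r x) :
    (∀ x, r (p (q x)) = r x) ↔ ∀ x, r (p x) = r x := by
  refine ⟨fun h x => ?_, fun h x => by rw [h, hq]⟩
  have := h (q⁻¹ x)
  rwa [preserves_inv hq, show q (q⁻¹ x) = x from q.apply_symm_apply x] at this

lemma of_mul_symSum {r : X → ℕ} {q : Equiv.Perm X} (hq : ∀ x, r (q x) = r x) :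
    MonoidAlgebra.of k _ q * symSum k r = symSum k r := by
  rw [symSum, Finset.mul_sum]
  simp only [← map_mul]
  refine Finset.sum_equiv (Equiv.mulLeft q) (fun p => ?_) (fun _ _ => rfl)
  simp [hq]

lemma symSum_mul_of {r : X → ℕ} {q : Equiv.Perm X} (hq : ∀ x, r (q x) = r x) :
    symSum k r * MonoidAlgebra.of k _ q = symSum k r := by
  rw [symSum, Finset.sum_mul]
  simp only [← map_mul]
  refine Finset.sum_equiv (Equiv.mulRight q) (fun p => ?_) (fun _ _ => rfl)
  simpa using (preserves_mul_right_iff hq).symm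

lemma altSum_mul_of {c : X → ℕ} {q : Equiv.Perm X} (hq : ∀ x, c (q x) = c x) :
    altSum k c * MonoidAlgebra.of k _ q = ((Equiv.Perm.sign q : ℤ) : k) • altSum k c := by
  rw [altSum, Finset.sum_mul, Finset.smul_sum]
  refine Finset.sum_equiv (Equiv.mulRight q) (fun p => ?_) (fun p _ => ?_)
  · simpa using (preserves_mul_right_iff hq).symm
  · rw [smul_mul_assoc, ← map_mul, smul_smul, Equiv.coe_mulRight, Equiv.Perm.sign_mul]
    push_cast
    rw [mul_left_comm, sign_mul_self, mul_one]

lemma of_mul_altSum {c : X → ℕ} {q : Equiv.Perm X} (hq : ∀ x, c (q x) = c x) :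
    MonoidAlgebra.of k _ q * altSum k c = ((Equiv.Perm.sign q : ℤ) : k) • altSum k c := by
  rw [altSum, Finset.mul_sum, Finset.smul_sum]
  refine Finset.sum_equiv (Equiv.mulLeft q) (fun p => ?_) (fun p _ => ?_)
  · simp [hq]
  · rw [mul_smul_comm, ← map_mul, smul_smul, Equiv.coe_mulLeft, Equiv.Perm.sign_mul]
    push_cast
    rw [← mul_assoc, sign_mul_self, one_mul]

lemma swap_preserves {r : X → ℕ} {i j : X} (h : r i = r j) (x : X) :
    r (Equiv.swap i j x) = r x := by
  by_cases hi : x = i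
  · subst hi; simp [h]
  · by_cases hj : x = j
    · subst hj; simp [h]
    · rw [Equiv.swap_apply_of_ne_of_ne hi hj]

/-- A row symmetrizer and a conjugated column antisymmetrizer annihilate each other if a
transposition preserves both families of fibres. -/
lemma symSum_mul_of_mul_altSum [CharZero k] {r c : X → ℕ} (y : Equiv.Perm X)
    (h : symSum k r * MonoidAlgebra.of k _ y * altSum k c ≠ 0) :
    Function.Injective fun x => (r (y x), c x) := by
  intro i j hij
  by_contra hne
  simp only [Prod.mk.injEq] at hij
  apply h
  have h1 : MonoidAlgebra.of k _ (Equiv.swap (y i) (y j)) * MonoidAlgebra.of k _ y =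
      MonoidAlgebra.of k _ y * MonoidAlgebra.of k _ (Equiv.swap i j) := by
    rw [← map_mul, ← map_mul]
    congr 1
    ext x
    simp [Equiv.swap_apply_apply]
  have h2 : symSum k r * MonoidAlgebra.of k _ y * altSum k c =
      -(symSum k r * MonoidAlgebra.of k _ y * altSum k c) := by
    conv_lhs => rw [← symSum_mul_of (swap_preserves hij.1), mul_assoc (symSum k r), h1,
      ← mul_assoc, mul_assoc, of_mul_altSum (swap_preserves hij.2), Equiv.Perm.sign_swap hne]
    simp
  exact eq_zero_of_eq_neg (k := k) h2

lemma altSum_mul_of_mul_symSum [CharZero k] {r c : X → ℕ} (y : Equiv.Perm X)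
    (h : altSum k c * MonoidAlgebra.of k _ y * symSum k r ≠ 0) :
    Function.Injective fun x => (r x, c (y x)) := by
  intro i j hij
  by_contra hne
  simp only [Prod.mk.injEq] at hij
  apply h
  have hne' : y i ≠ y j := fun h => hne (y.injective h)
  have h1 : MonoidAlgebra.of k _ (Equiv.swap (y i) (y j)) * MonoidAlgebra.of k _ y =
      MonoidAlgebra.of k _ y * MonoidAlgebra.of k _ (Equiv.swap i j) := by
    rw [← map_mul, ← map_mul]
    congr 1
    ext x
    simp [Equiv.swap_apply_apply]
  have h2 : altSum k c * MonoidAlgebra.of k _ y * symSum k r =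
      -(altSum k c * MonoidAlgebra.of k _ y * symSum k r) := by
    conv_lhs => rw [← of_mul_symSum (swap_preserves hij.1), ← mul_assoc, mul_assoc (altSum k c),
      ← h1, ← mul_assoc, altSum_mul_of (swap_preserves hij.2), Equiv.Perm.sign_swap hne']
    simp
  exact eq_zero_of_eq_neg (k := k) h2

lemma exists_of_mul_ne_zero {a b : 𝔸} (z : 𝔸) (h : a * z * b ≠ 0) :
    ∃ y, a * MonoidAlgebra.of k _ y * b ≠ 0 := by
  by_contra! h0
  apply h
  induction z using MonoidAlgebra.induction_on with
  | of y => exact h0 y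
  | add f g hf hg =>
    by_cases h1 : a * f * b = 0 <;> by_cases h2 : a * g * b = 0
    · rw [mul_add, add_mul, h1, h2, add_zero]
    · exact absurd (hg h2) h2
    · exact absurd (hf h1) h1
    · exact absurd (hf h1) h1
  | smul r f hf =>
    by_cases h1 : a * f * b = 0
    · rw [mul_smul_comm, smul_mul_assoc, h1, smul_zero]
    · exact absurd (hf h1) h1

variable (k) in
/-- The Young symmetrizer of a Young diagram whose cells are labelled by `X`, as an element of the
group algebra of the permutations of `X`. -/
def youngSymmetrizer {l : YoungDiagram} (e : X ≃ l.cells) : 𝔸 :=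
  altSum k (fun x => (e x).1.2) * symSum k (fun x => (e x).1.1)

/-- Young symmetrizers of different shapes annihilate each other through the whole algebra. -/
lemma youngSymmetrizer_mul_mul_eq_zero [CharZero k] {l m : YoungDiagram} (e : X ≃ l.cells)
    (f : X ≃ m.cells) (hlm : m ≠ l) (z : 𝔸) :
    youngSymmetrizer k f * z * youngSymmetrizer k e = 0 := by
  by_contra hne
  have h1 : altSum k (fun x => (f x).1.2) *
      (symSum k (fun x => (f x).1.1) * z * altSum k (fun x => (e x).1.2)) *
        symSum k (fun x => (e x).1.1) ≠ 0 := by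
    simpa only [youngSymmetrizer, mul_assoc] using hne
  have h2 : symSum k (fun x => (f x).1.1) * z * altSum k (fun x => (e x).1.2) ≠ 0 := by
    intro h0
    rw [h0, mul_zero, zero_mul] at h1
    exact h1 rfl
  obtain ⟨y, hy⟩ := exists_of_mul_ne_zero _ h2
  obtain ⟨y', hy'⟩ := exists_of_mul_ne_zero _ h1
  exact hlm (eq_of_transversal e e (y.trans f) (y'.trans f)
    (symSum_mul_of_mul_altSum y hy) (altSum_mul_of_mul_symSum y' hy'))

/-- Only the trivial product of a column permutation and a row permutation is the identity. -/
lemma youngSymmetrizer_coeff_one {l : YoungDiagram} (e : X ≃ l.cells) :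
    (youngSymmetrizer k e).coeff 1 = 1 := by
  have h : youngSymmetrizer k e =
      ∑ q : Equiv.Perm X with ∀ x, (e (q x)).1.2 = (e x).1.2,
        ∑ p : Equiv.Perm X with ∀ x, (e (p x)).1.1 = (e x).1.1,
          ((Equiv.Perm.sign q : ℤ) : k) • MonoidAlgebra.single (q * p) (1 : k) := by
    rw [youngSymmetrizer, altSum, symSum, Finset.sum_mul_sum]
    simp
  rw [h, MonoidAlgebra.coeff_sum, Finsupp.finsetSum_apply, Finset.sum_eq_single 1]
  · rw [MonoidAlgebra.coeff_sum, Finsupp.finsetSum_apply, Finset.sum_eq_single 1]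
    · simp
    · intro p _ hp
      simp [hp]
    · simp
  · intro q hq hq1
    rw [MonoidAlgebra.coeff_sum, Finsupp.finsetSum_apply]
    refine Finset.sum_eq_zero fun p hp => ?_
    have hqp : q * p ≠ 1 := by
      intro hqp
      apply hq1
      simp only [Finset.mem_filter, Finset.mem_univ, true_and] at hq hp
      ext x
      have hp' : p = q⁻¹ := eq_inv_of_mul_eq_one_right hqp
      have h1 := hp (q x)
      rw [hp', show q⁻¹ (q x) = x from q.symm_apply_apply x] at h1
      have : e (q x) = e x := Subtype.ext (Prod.ext h1.symm (hq x))
      rw [e.injective this, Equiv.Perm.one_apply]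
    simp [hqp]
  · simp

/-- The key property of a Young symmetrizer: `c z c` is always a multiple of `c`. -/
lemma youngSymmetrizer_mul_mul_self [CharZero k] {l : YoungDiagram} (e : X ≃ l.cells) (z : 𝔸) :
    youngSymmetrizer k e * z * youngSymmetrizer k e =
      (youngSymmetrizer k e * z * youngSymmetrizer k e).coeff 1 • youngSymmetrizer k e := by
  set b := altSum k (fun x => (e x).1.2) with hb
  set a := symSum k (fun x => (e x).1.1) with ha
  have key : ∀ z : 𝔸, ∃ t : k, b * z * a = t • (b * a) := by
    intro z
    induction z using MonoidAlgebra.induction_on with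
    | of y =>
      -- a nonzero product forces `y` to be a column permutation times a row permutation
      by_cases h : b * MonoidAlgebra.of k _ y * a = 0
      · exact ⟨0, by rw [h, zero_smul]⟩
      · have hinj := altSum_mul_of_mul_symSum y h
        have hinj' : Function.Injective fun x => ((e (y⁻¹ x)).1.1, (e x).1.2) := by
          intro x x' hx
          apply (y⁻¹).injective
          apply hinj
          simpa using hx
        obtain ⟨q, hq, hqy⟩ := exists_perm_of_transversal e y⁻¹ hinj'
        have hq' : ∀ x, (e (q⁻¹ x)).1.2 = (e x).1.2 :=
          preserves_inv (r := fun x => (e x).1.2) hq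
        have hp : ∀ x, (e ((q * y) x)).1.1 = (e x).1.1 := fun x => by
          rw [Equiv.Perm.mul_apply, hqy, show y⁻¹ (y x) = x from y.symm_apply_apply x]
        have hy : MonoidAlgebra.of k _ y = MonoidAlgebra.of k _ q⁻¹ * MonoidAlgebra.of k _ (q * y) := by
          rw [← map_mul, inv_mul_cancel_left]
        refine ⟨((Equiv.Perm.sign q⁻¹ : ℤ) : k), ?_⟩
        rw [hy, ← mul_assoc, hb, ha, altSum_mul_of (c := fun x => (e x).1.2) hq', mul_assoc,
          of_mul_symSum (r := fun x => (e x).1.1) hp, smul_mul_assoc]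
    | add f g hf hg =>
      obtain ⟨t, ht⟩ := hf
      obtain ⟨t', ht'⟩ := hg
      exact ⟨t + t', by rw [mul_add, add_mul, ht, ht', add_smul]⟩
    | smul r f hf =>
      obtain ⟨t, ht⟩ := hf
      exact ⟨r * t, by rw [mul_smul_comm, smul_mul_assoc, ht, mul_smul]⟩
  obtain ⟨t, ht⟩ := key (a * z * b)
  have h1 : youngSymmetrizer k e * z * youngSymmetrizer k e = t • youngSymmetrizer k e := by
    rw [youngSymmetrizer, ← hb, ← ha, ← ht]
    simp only [mul_assoc]
  rw [h1, MonoidAlgebra.coeff_smul_apply, youngSymmetrizer_coeff_one, smul_eq_mul, mul_one]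

instance : Module.Finite k 𝔸 := Module.Finite.of_basis (MonoidAlgebra.basis (Equiv.Perm X) k)

/-- A Young symmetrizer is quasi-idempotent with nonzero constant: right multiplication by it has
nonzero trace, hence is not nilpotent. -/
lemma youngSymmetrizer_sq_coeff_ne_zero [CharZero k] {l : YoungDiagram} (e : X ≃ l.cells) :
    (youngSymmetrizer k e * youngSymmetrizer k e).coeff 1 ≠ 0 := by
  set c := youngSymmetrizer k e with hc
  intro h0
  have hcc : c * c = 0 := by
    have := youngSymmetrizer_mul_mul_self e (1 : 𝔸)
    rw [mul_one, ← hc, h0, zero_smul] at this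
    exact this
  have hnil : IsNilpotent (LinearMap.mulRight k c) := ⟨2, by
    ext x
    simp [pow_two, mul_assoc, hcc]⟩
  have h1 := (LinearMap.isNilpotent_trace_of_isNilpotent hnil).eq_zero
  rw [LinearMap.trace_eq_matrix_trace k (MonoidAlgebra.basis (Equiv.Perm X) k), Matrix.trace] at h1
  have h2 : ∀ g : Equiv.Perm X, (LinearMap.toMatrix (MonoidAlgebra.basis (Equiv.Perm X) k)
      (MonoidAlgebra.basis (Equiv.Perm X) k) (LinearMap.mulRight k c)).diag g = 1 := by
    intro g
    rw [Matrix.diag_apply, LinearMap.toMatrix_apply, MonoidAlgebra.basis_apply,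
      LinearMap.mulRight_apply]
    change (MonoidAlgebra.single g 1 * c).coeff g = 1
    rw [MonoidAlgebra.coeff_single_mul_apply, inv_mul_cancel, one_mul, hc,
      youngSymmetrizer_coeff_one]
  simp only [h2, Finset.sum_const, Finset.card_univ, nsmul_eq_mul, mul_one] at h1
  exact Fintype.card_ne_zero (Nat.cast_eq_zero.1 h1)

end GroupAlgebra

/-! ### Young symmetrizers detect every vector -/

section Traces

variable (k) in
/-- The linear forms `f` on an algebra with `f (x * y) = f (y * x)`. -/
def traceForms (A : Type*) [Semiring A] [Algebra k A] : Submodule k (A →ₗ[k] k) where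
  carrier := {f | ∀ x y, f (x * y) = f (y * x)}
  add_mem' hf hg x y := by simp [hf x y, hg x y]
  zero_mem' x y := rfl
  smul_mem' c f hf x y := by simp [hf x y]

/-- The trace form of a module, twisted by an endomorphism. -/
def twistedTrace {A : Type*} [Semiring A] [Algebra k A] {W : Type*} [AddCommGroup W] [Module k W]
    [Module A W] [IsScalarTower k A W] (C : W →ₗ[A] W) : traceForms k A :=
  ⟨{ toFun := fun z => LinearMap.trace k W (C.restrictScalars k ∘ₗ Algebra.lsmul k k W z)
     map_add' := fun x y => by rw [map_add, LinearMap.comp_add, map_add]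
     map_smul' := fun c x => by rw [map_smul, LinearMap.comp_smul, map_smul]; rfl }, by
    intro x y
    change LinearMap.trace k W _ = LinearMap.trace k W _
    have h : ∀ x y : A, C.restrictScalars k ∘ₗ Algebra.lsmul k k W (x * y) =
        (C.restrictScalars k ∘ₗ Algebra.lsmul k k W x) * Algebra.lsmul k k W y := by
      intro x y
      rw [map_mul]
      rfl
    have h' : C.restrictScalars k ∘ₗ Algebra.lsmul k k W (y * x) =
        Algebra.lsmul k k W y * (C.restrictScalars k ∘ₗ Algebra.lsmul k k W x) := by
      ext w
      simp
    rw [h, LinearMap.trace_mul_comm, h']⟩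

lemma twistedTrace_apply {A : Type*} [Semiring A] [Algebra k A] {W : Type*} [AddCommGroup W]
    [Module k W] [Module A W] [IsScalarTower k A W] (C : W →ₗ[A] W) (z : A) :
    (twistedTrace (k := k) C : A →ₗ[k] k) z =
      LinearMap.trace k W (C.restrictScalars k ∘ₗ Algebra.lsmul k k W z) := rfl

end Traces

section Detect

/-- The Young diagram whose row lengths are the parts of a partition. -/
def partitionDiagram {n : ℕ} (p : n.Partition) : YoungDiagram :=
  YoungDiagram.ofRowLens (p.parts.sort (· ≥ ·)) (Multiset.pairwise_sort _ _).sortedGE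

lemma rowLens_partitionDiagram {n : ℕ} (p : n.Partition) :
    (partitionDiagram p).rowLens = p.parts.sort (· ≥ ·) :=
  YoungDiagram.rowLens_ofRowLens_eq_self fun x hx => p.parts_pos (by simpa using hx)

lemma partitionDiagram_injective {n : ℕ} :
    Function.Injective (partitionDiagram : n.Partition → YoungDiagram) := by
  intro p q h
  have h1 := congrArg (fun l => (YoungDiagram.rowLens l : Multiset ℕ)) h
  simp only [rowLens_partitionDiagram, Multiset.sort_eq] at h1
  exact Nat.Partition.ext h1

lemma card_cellsOfRowLens (w : List ℕ) : (YoungDiagram.cellsOfRowLens w).card = w.sum := by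
  induction w with
  | nil => rfl
  | cons a w ih =>
    rw [YoungDiagram.cellsOfRowLens, Finset.card_union_of_disjoint, Finset.card_map, ih]
    · simp
    · rw [Finset.disjoint_left]
      rintro ⟨i, j⟩ h1 h2
      simp only [Finset.mem_product, Finset.mem_singleton] at h1
      obtain ⟨⟨i', j'⟩, _, h3⟩ := Finset.mem_map.1 h2
      have := congrArg Prod.fst h3
      simp [h1.1] at this

lemma card_partitionDiagram {n : ℕ} (p : n.Partition) : (partitionDiagram p).cells.card = n := by
  have : (partitionDiagram p).cells = YoungDiagram.cellsOfRowLens (p.parts.sort (· ≥ ·)) := rfl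
  rw [this, card_cellsOfRowLens, ← Multiset.sum_coe, Multiset.sort_eq, p.parts_sum]

variable (X : Type*) [Fintype X] [DecidableEq X]

/-- A labelling of the cells of the diagram of a partition of `|X|` by the elements of `X`. -/
def partitionLabelling (p : (Fintype.card X).Partition) : X ≃ (partitionDiagram p).cells :=
  Fintype.equivOfCardEq (by rw [Fintype.card_coe, card_partitionDiagram])

local notation "𝔸" => MonoidAlgebra k (Equiv.Perm X)

/-- A trace form on the group algebra is determined by its values at one permutation of each cycle
type. -/
lemma finrank_traceForms_le :
    finrank k (traceForms k 𝔸) ≤ Fintype.card (Fintype.card X).Partition := by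
  classical
  let _ : AddCommGroup (traceForms k 𝔸) := Module.addCommMonoidToAddCommGroup k
  let ev : traceForms k 𝔸 →ₗ[k] ((Fintype.card X).Partition → k) :=
    LinearMap.pi fun p => if h : ∃ σ : Equiv.Perm X, σ.partition = p then
      LinearMap.applyₗ (MonoidAlgebra.of k _ h.choose) ∘ₗ (traceForms k 𝔸).subtype else 0
  have hev : Function.Injective ev := by
    rw [← LinearMap.ker_eq_bot, LinearMap.ker_eq_bot']
    rintro ⟨f, hf⟩ h
    have key : ∀ σ : Equiv.Perm X, f (MonoidAlgebra.of k _ σ) = 0 := by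
      intro σ
      have hex : ∃ τ : Equiv.Perm X, τ.partition = σ.partition := ⟨σ, rfl⟩
      have h1 := congrFun h σ.partition
      simp only [ev, LinearMap.pi_apply, dif_pos hex] at h1
      obtain ⟨c, hc⟩ := isConj_iff.1 (Equiv.Perm.partition_eq_of_isConj.2 hex.choose_spec)
      rw [← hc, mul_assoc, map_mul, hf, ← map_mul, inv_mul_cancel_right]
      exact h1
    exact Subtype.ext (LinearMap.ext fun z => by
      induction z using MonoidAlgebra.induction_on with
      | of y => exact key y
      | add f g hf hg => rw [map_add, hf, hg, map_add]
      | smul r f hf => rw [map_smul, hf, map_smul])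
  simpa using LinearMap.finrank_le_finrank_of_injective hev

variable [CharZero k]

/-- A trace form on the group algebra of a symmetric group vanishing at all Young symmetrizers is
zero: the values at the Young symmetrizers can be prescribed, and the number of partitions bounds
the dimension. -/
lemma traceForms_eq_zero (f : traceForms k 𝔸)
    (hf : ∀ p, (f : 𝔸 →ₗ[k] k) (youngSymmetrizer k (partitionLabelling X p)) = 0) : f = 0 := by
  classical
  let _ : AddCommGroup (traceForms k 𝔸) := Module.addCommMonoidToAddCommGroup k
  set c : (Fintype.card X).Partition → 𝔸 :=
    fun p => youngSymmetrizer k (partitionLabelling X p) with hc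
  let ev : traceForms k 𝔸 →ₗ[k] ((Fintype.card X).Partition → k) :=
    LinearMap.pi fun p => LinearMap.applyₗ (c p) ∘ₗ (traceForms k 𝔸).subtype
  have hsurj : Function.Surjective ev := by
    rw [← LinearMap.range_eq_top, eq_top_iff, ← (Pi.basisFun k _).span_eq, Submodule.span_le]
    rintro _ ⟨p, rfl⟩
    rw [SetLike.mem_coe, Pi.basisFun_apply]
    set n := (c p * c p).coeff 1 with hn
    have hn0 : n ≠ 0 := youngSymmetrizer_sq_coeff_ne_zero _
    have hcc : c p * c p = n • c p := by
      have := youngSymmetrizer_mul_mul_self (partitionLabelling X p) (1 : 𝔸)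
      rwa [mul_one] at this
    -- the form `z ↦ tr(y ↦ z y c)` for the Young symmetrizer `c` of `p` vanishes at the others
    have hval : ev (twistedTrace (LinearMap.toSpanSingleton 𝔸 𝔸 (c p))) =
        (n * n) • Pi.single p (1 : k) := by
      funext q
      change LinearMap.trace k 𝔸 _ = _
      by_cases hqp : q = p
      · subst hqp
        -- `y ↦ c y c` has rank one, with image spanned by `c`
        have : (LinearMap.toSpanSingleton 𝔸 𝔸 (c q)).restrictScalars k ∘ₗ
            Algebra.lsmul k k 𝔸 (c q) =
            (Finsupp.lapply (1 : Equiv.Perm X) ∘ₗ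
              (MonoidAlgebra.basis (Equiv.Perm X) k).repr.toLinearMap ∘ₗ
              LinearMap.mulRight k (c q) ∘ₗ LinearMap.mulLeft k (c q)).smulRight (c q) := by
          refine LinearMap.ext fun y => ?_
          exact youngSymmetrizer_mul_mul_self (partitionLabelling X q) y
        rw [this, LinearMap.trace_smulRight]
        change (c q * c q * c q).coeff 1 = _
        rw [hcc, smul_mul_assoc, hcc, smul_smul, MonoidAlgebra.coeff_smul_apply,
          youngSymmetrizer_coeff_one]
        simp
      · have : (LinearMap.toSpanSingleton 𝔸 𝔸 (c p)).restrictScalars k ∘ₗ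
            Algebra.lsmul k k 𝔸 (c q) = 0 := by
          refine LinearMap.ext fun y => ?_
          exact youngSymmetrizer_mul_mul_eq_zero _ _
            (fun h => hqp (partitionDiagram_injective h)) y
        rw [this, map_zero]
        simp [hqp]
    refine ⟨(n * n)⁻¹ • twistedTrace (LinearMap.toSpanSingleton 𝔸 𝔸 (c p)), ?_⟩
    rw [map_smul, hval, smul_smul, inv_mul_cancel₀ (mul_ne_zero hn0 hn0), one_smul]
  have hrank : finrank k (traceForms k 𝔸) = finrank k ((Fintype.card X).Partition → k) := by
    refine le_antisymm ?_ (LinearMap.finrank_le_finrank_of_surjective hsurj)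
    simpa using finrank_traceForms_le X
  have hinj := (LinearMap.injective_iff_surjective_of_finrank_eq_finrank hrank).2 hsurj
  exact hinj (by rw [map_zero]; exact funext hf)

/-- In a representation of a symmetric group, a vector is zero if all Young symmetrizers annihilate
its whole orbit: the character of the module it generates vanishes. -/
lemma eq_zero_of_youngSymmetrizer {V : Type*} [AddCommGroup V] [Module k V] [Module 𝔸 V]
    [IsScalarTower k 𝔸 V] (x : V)
    (h : ∀ p (z : 𝔸), youngSymmetrizer k (partitionLabelling X p) • z • x = 0 ) : x = 0 := by
  let W := Submodule.span 𝔸 {x}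
  have : Module.Finite k W := Module.Finite.trans 𝔸 W
  have h0 := traceForms_eq_zero X (twistedTrace (k := k) (LinearMap.id : W →ₗ[𝔸] W)) (by
    intro p
    rw [twistedTrace_apply]
    refine (congrArg (LinearMap.trace k W) ?_).trans (map_zero _)
    refine LinearMap.ext fun w => Subtype.ext ?_
    obtain ⟨z, hz⟩ := Submodule.mem_span_singleton.1 w.2
    have := h p z
    rw [hz] at this
    exact this)
  have h1 := LinearMap.congr_fun (congrArg Subtype.val h0) (1 : 𝔸)
  rw [twistedTrace_apply, map_one] at h1
  have h2 : (LinearMap.restrictScalars k (LinearMap.id : W →ₗ[𝔸] W)) ∘ₗ (1 : Module.End k W) = 1 :=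
    rfl
  rw [h2, LinearMap.trace_one] at h1
  have h3 : finrank k W = 0 := by exact Nat.cast_eq_zero (R := k).1 h1
  have h4 : Subsingleton W := finrank_zero_iff.1 h3
  exact congrArg Subtype.val (Subsingleton.elim (⟨x, Submodule.mem_span_singleton_self x⟩ : W) 0)

end Detect

section Family

lemma permMap_tprod {I : Type v} (p : Equiv.Perm I) (x : I → (ℕ →₀ k)) :
    permMap k I p (PiTensorProduct.tprod k x) = PiTensorProduct.tprod k fun i => x (p.symm i) :=
  PiTensorProduct.reindex_tprod p x

variable (k) in
/-- The place permutations on a tensor power. -/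
def placeRep (I : Type v) : Equiv.Perm I →* Module.End k (⨂[k] _ : I, (ℕ →₀ k)) where
  toFun p := (permMap k I p).toLinearMap
  map_one' := by
    ext x
    exact PiTensorProduct.reindex_tprod _ _
  map_mul' p q := by
    ext x
    change permMap k I (p * q) (PiTensorProduct.tprod k x) =
      permMap k I p (permMap k I q (PiTensorProduct.tprod k x))
    rw [permMap_tprod, permMap_tprod, permMap_tprod]
    rfl

/-- Relabelling the tensor factors turns the place permutation `p` into its conjugate. -/
lemma permMap_reindex {I : Type v} {I' : Type w} (e : I ≃ I') (p : Equiv.Perm I)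
    (x : ⨂[k] _ : I, (ℕ →₀ k)) :
    permMap k I' (e.permCongr p) (PiTensorProduct.reindex k (fun _ => ℕ →₀ k) e x) =
      PiTensorProduct.reindex k (fun _ => ℕ →₀ k) e (permMap k I p x) := by
  have : (permMap k I' (e.permCongr p)).toLinearMap ∘ₗ
      (PiTensorProduct.reindex k (fun _ : I => ℕ →₀ k) e).toLinearMap =
      (PiTensorProduct.reindex k (fun _ : I => ℕ →₀ k) e).toLinearMap ∘ₗ
        (permMap k I p).toLinearMap := by
    ext x
    have h : ∀ y : I → (ℕ →₀ k), PiTensorProduct.reindex k (fun _ : I => ℕ →₀ k) e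
        (PiTensorProduct.tprod k y) = PiTensorProduct.tprod k fun i => y (e.symm i) :=
      fun y => PiTensorProduct.reindex_tprod e y
    change permMap k I' (e.permCongr p) (PiTensorProduct.reindex k (fun _ : I => ℕ →₀ k) e
        (PiTensorProduct.tprod k x)) = PiTensorProduct.reindex k (fun _ : I => ℕ →₀ k) e
        (permMap k I p (PiTensorProduct.tprod k x))
    rw [permMap_tprod, h, h, permMap_tprod]
    congr 1
    funext i
    exact congrArg x (e.symm_apply_apply _)
  exact LinearMap.congr_fun this x

lemma rowSymmetrizer_reindex {I : Type} [Fintype I] [DecidableEq I] {l : YoungDiagram}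
    (e : I ≃ l.cells) (x : ⨂[k] _ : I, (ℕ →₀ k)) :
    rowSymmetrizer k l (PiTensorProduct.reindex k (fun _ => ℕ →₀ k) e x) =
      PiTensorProduct.reindex k (fun _ => ℕ →₀ k) e
        (MonoidAlgebra.lift k _ _ (placeRep k I) (symSum k fun i => (e i).1.1) x) := by
  rw [rowSymmetrizer, Representation.IntertwiningMap.sum_apply, symSum, map_sum,
    LinearMap.sum_apply, map_sum]
  refine (Finset.sum_equiv e.permCongr (fun p => ?_) (fun p _ => ?_)).symm
  · simp only [Finset.mem_filter, Finset.mem_univ, true_and]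
    exact ⟨fun h c => by simpa using h (e.symm c), fun h i => by simpa using h (e i)⟩
  · rw [MonoidAlgebra.lift_of, permMap_reindex]
    rfl

lemma columnAntisymmetrizer_reindex {I : Type} [Fintype I] [DecidableEq I] {l : YoungDiagram}
    (e : I ≃ l.cells) (x : ⨂[k] _ : I, (ℕ →₀ k)) :
    columnAntisymmetrizer k l (PiTensorProduct.reindex k (fun _ => ℕ →₀ k) e x) =
      PiTensorProduct.reindex k (fun _ => ℕ →₀ k) e
        (MonoidAlgebra.lift k _ _ (placeRep k I) (altSum k fun i => (e i).1.2) x) := by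
  rw [columnAntisymmetrizer, Representation.IntertwiningMap.sum_apply, altSum, map_sum,
    LinearMap.sum_apply, map_sum]
  refine (Finset.sum_equiv e.permCongr (fun p => ?_) (fun p _ => ?_)).symm
  · simp only [Finset.mem_filter, Finset.mem_univ, true_and]
    exact ⟨fun h c => by simpa using h (e.symm c), fun h i => by simpa using h (e i)⟩
  · rw [map_smul, MonoidAlgebra.lift_of, smul_permMap_apply, permMap_reindex,
      Equiv.Perm.sign_permCongr, LinearMap.smul_apply, map_smul]
    rfl

/-- The projection of a tensor power onto a Schur functor, for a labelling of the cells. -/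
def schurProj {I : Type} {l : YoungDiagram} (e : I ≃ l.cells) :
    (⨂[k] _ : I, (ℕ →₀ k)) →ₗ[k] (schur k l).toSubmodule :=
  ((columnAntisymmetrizer k l).comp (rowSymmetrizer k l)).toLinearMap.rangeRestrict ∘ₗ
    (PiTensorProduct.reindex k (fun _ => ℕ →₀ k) e).toLinearMap

lemma schurProj_coe {I : Type} {l : YoungDiagram} (e : I ≃ l.cells)
    (x : ⨂[k] _ : I, (ℕ →₀ k)) : (schurProj e x : ⨂[k] _ : l.cells, (ℕ →₀ k)) =
      columnAntisymmetrizer k l (rowSymmetrizer k l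
        (PiTensorProduct.reindex k (fun _ => ℕ →₀ k) e x)) := rfl

lemma schurProj_tensorRep {I : Type} {l : YoungDiagram} (e : I ≃ l.cells) (g : GLInf k)
    (x : ⨂[k] _ : I, (ℕ →₀ k)) :
    schurProj e (tensorRep k I g x) = (schur k l).toRepresentation g (schurProj e x) := by
  refine Subtype.ext ?_
  have h : PiTensorProduct.reindex k (fun _ => ℕ →₀ k) e (tensorRep k I g x) =
      tensorRep k l.cells g (PiTensorProduct.reindex k (fun _ => ℕ →₀ k) e x) :=
    (LinearMap.congr_fun
      (PiTensorProduct.map_comp_reindex_eq (fun _ : I => stdRep k g) e) x).symm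
  rw [schurProj_coe, h, Representation.IntertwiningMap.isIntertwining _ _ (rowSymmetrizer k l),
    Representation.IntertwiningMap.isIntertwining _ _ (columnAntisymmetrizer k l)]
  rfl

/-- A tensor power embeds equivariantly into a finite direct sum of Schur functors. -/
theorem exists_schur_family [CharZero k] (d : ℕ) :
    ∃ (J : Type) (_ : Finite J) (l : J → YoungDiagram)
      (χ : ∀ a, Tens k d →ₗ[k] (schur k (l a)).toSubmodule),
      (∀ a g x, χ a (tensorRep k (Fin d) g x) = (schur k (l a)).toRepresentation g (χ a x)) ∧
      ∀ x, (∀ a, χ a x = 0) → x = 0 := by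
  classical
  refine ⟨(Fintype.card (Fin d)).Partition × Equiv.Perm (Fin d), inferInstance,
    fun a => partitionDiagram a.1, fun a => schurProj (partitionLabelling (Fin d) a.1) ∘ₗ
      (permMap k (Fin d) a.2).toLinearMap, fun a g x => ?_, fun x hx => ?_⟩
  · refine Eq.trans ?_ (schurProj_tensorRep _ g (permMap k (Fin d) a.2 x))
    exact congrArg (schurProj (partitionLabelling (Fin d) a.1)) (Representation.IntertwiningMap.isIntertwining _ _ (permMap k (Fin d) a.2) g x)
  · let _ : AddCommGroup (Tens k d) := Module.addCommMonoidToAddCommGroup k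
    let ψ := MonoidAlgebra.lift k (Module.End k (Tens k d)) _ (placeRep k (Fin d))
    let _ : Module (MonoidAlgebra k (Equiv.Perm (Fin d))) (Tens k d) :=
      Module.compHom _ ψ.toRingHom
    have : IsScalarTower k (MonoidAlgebra k (Equiv.Perm (Fin d))) (Tens k d) :=
      ⟨fun c z y => by
        change ψ (c • z) y = c • ψ z y
        rw [map_smul, LinearMap.smul_apply]⟩
    refine eq_zero_of_youngSymmetrizer (k := k) (Fin d) x fun p z => ?_
    change ψ (youngSymmetrizer k (partitionLabelling (Fin d) p)) (ψ z x) = 0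
    induction z using MonoidAlgebra.induction_on with
    | of σ =>
      have h := congrArg Subtype.val (hx (p, σ))
      change columnAntisymmetrizer k _ (rowSymmetrizer k _
        (PiTensorProduct.reindex k (fun _ => ℕ →₀ k) (partitionLabelling (Fin d) p)
          (permMap k (Fin d) σ x))) = 0 at h
      rw [rowSymmetrizer_reindex, columnAntisymmetrizer_reindex, LinearEquiv.map_eq_zero_iff] at h
      rw [youngSymmetrizer, map_mul]
      simp only [ψ, MonoidAlgebra.lift_of]
      exact h
    | add f g hf hg => rw [map_add, LinearMap.add_apply, map_add, hf, hg, add_zero]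
    | smul r f hf => rw [map_smul, LinearMap.smul_apply, map_smul, hf, smul_zero]

end Family

/-! ### Embeddings into free modules -/

section Core

variable {R : Type v} [CommRing R] [Algebra k R] {α : GLInf k →* (R ≃ₐ[k] R)}
  {M : Type w} [AddCommGroup M] [Module k M] [Module R M] [IsScalarTower k R M]
  {ρ : Representation k (GLInf k) M}

/-- A finite, jointly injective family of equivariant maps to modules `R ⊗ 𝐒_λ(𝐕)` combines to an
embedding into a free module. -/
lemma EmbedsInFree.of_family {T : Type} [Finite T] (l : T → YoungDiagram)
    (Θ : ∀ t, M →ₗ[R] R ⊗[k] (schur k (l t)).toSubmodule)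
    (hΘ : ∀ t g m, Θ t (ρ g m) = semiRep α (schur k (l t)).toRepresentation g (Θ t m))
    (hinj : ∀ m, (∀ t, Θ t m = 0) → m = 0) : EmbedsInFree α ρ := by
  classical
  let a := Finite.equivFin T
  let l' : Fin (Nat.card T) → YoungDiagram := fun i => l (a.symm i)
  let inj : ∀ i, (schur k (l' i)).toSubmodule →ₗ[k] TupleSpace k l' := fun i =>
    DirectSum.lof k (Fin (Nat.card T)) (fun i => (schur k (l' i)).toSubmodule) i
  let pr : ∀ i, TupleSpace k l' →ₗ[k] (schur k (l' i)).toSubmodule := fun i =>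
    DirectSum.component k (Fin (Nat.card T)) (fun i => (schur k (l' i)).toSubmodule) i
  have hpr : ∀ i i' x, i ≠ i' → pr i (inj i' x) = 0 := fun i i' x h =>
    DFinsupp.single_eq_of_ne h
  have hpr' : ∀ i x, pr i (inj i x) = x := fun i x => DFinsupp.single_eq_same
  let j : M →ₗ[R] R ⊗[k] TupleSpace k l' :=
    ∑ i, (inj i).baseChange R ∘ₗ Θ (a.symm i)
  have hj : ∀ m, j m = ∑ i, (inj i).baseChange R (Θ (a.symm i) m) := fun m => by
    simp only [j, LinearMap.sum_apply, LinearMap.comp_apply]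
  have hcomp : ∀ i m, (pr i).baseChange R (j m) = Θ (a.symm i) m := by
    intro i m
    rw [hj, map_sum, Finset.sum_eq_single i]
    · rw [← LinearMap.comp_apply, ← LinearMap.baseChange_comp,
        show pr i ∘ₗ inj i = LinearMap.id from LinearMap.ext (hpr' i), LinearMap.baseChange_id]
      rfl
    · intro i' _ hi'
      rw [← LinearMap.comp_apply, ← LinearMap.baseChange_comp,
        show pr i ∘ₗ inj i' = 0 from LinearMap.ext fun x => hpr i i' x hi'.symm,
        LinearMap.baseChange_zero]
      rfl
    · simp
  refine ⟨Nat.card T, l', j, (injective_iff_map_eq_zero j).2 fun m hm => hinj m fun t => ?_,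
    fun g m => ?_⟩
  · obtain ⟨i, rfl⟩ := a.symm.surjective t
    rw [← hcomp i m, hm, map_zero]
  · change j (ρ g m) = semiRep α (tupleRep k l') g (j m)
    rw [hj, hj, map_sum]
    refine Finset.sum_congr rfl fun i _ => ?_
    rw [hΘ, semiRep_baseChange (π' := tupleRep k l')]
    intro x
    exact (DirectSum.lmap_lof
      (fun i => (schur k (l' i)).toRepresentation g) i x).symm

/-- A torsion-free module generated by the orbits of finitely many elements lying in images of
tensor powers embeds into a free module. -/
theorem embedsInFree_of_generators [CharZero k] [IsDomain R] [Module.IsTorsionFree R M]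
    (hα : IsAlgebraicAction α) (hsh : IsShiftable α) (hρ : IsSemilinear α ρ) (G : Finset M)
    (hG : ∀ m ∈ G, m ∈ equivariantSpan ρ ⊤)
    (hspan : Submodule.span R {y : M | ∃ g, ∃ x ∈ G, y = ρ g x} = ⊤) : EmbedsInFree α ρ := by
  obtain ⟨ι, _, f, d, hf, hGf⟩ := exists_family_of_mem_equivariantSpan R G hG
  have hd : genSpan R f d = ⊤ := by
    rw [eq_top_iff, ← hspan, Submodule.span_le]
    rintro _ ⟨g, x, hx, rfl⟩
    exact genSpan_stable (n := 0) hρ (fun e i g _ y => hf e i g y) d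
      ⟨fun _ h => absurd h (Nat.not_lt_zero _), fun _ _ h => absurd h (Nat.not_lt_zero _)⟩ (hGf x hx)
  obtain ⟨J, _, e, Ψ, hΨ, hinj⟩ := exists_equivariant_family hα hsh hρ f hf hd ⟨G, hspan⟩
  choose J' hJ' l χ hχ hχinj using fun d => exists_schur_family (k := k) d
  refine EmbedsInFree.of_family (T := Σ j, J' (e j)) (fun t => l (e t.1) t.2)
    (fun t => (χ (e t.1) t.2).baseChange R ∘ₗ Ψ t.1) (fun t g m => ?_) fun m hm => ?_
  · rw [LinearMap.comp_apply, hΨ, semiRep_baseChange (hA := fun x => hχ _ _ g x)]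
    rfl
  · refine hinj m fun j => ?_
    exact eq_zero_of_lTensor (χ (e j)) (hχinj (e j)) _ fun a => hm ⟨j, a⟩

end Core

section Localization

variable {R : Type v} [CommRing R] [IsDomain R] [Algebra k R] {α : GLInf k →* (R ≃ₐ[k] R)}
  {K : Type v} [Field K] [Algebra k K] [Algebra R K] [IsScalarTower k R K] [IsFractionRing R K]
  {β : GLInf k →* (K ≃ₐ[k] K)}
  {M : Type w} [AddCommGroup M] [Module k M] [Module R M] [IsScalarTower k R M]
  [Module K M] [IsScalarTower R K M] [IsScalarTower k K M]
  {ρ : Representation k (GLInf k) M}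

/-- The action on a stable `R`-submodule. -/
def restrictRep (ρ : Representation k (GLInf k) M) (N : Submodule R M)
    (hN : ∀ g, ∀ m ∈ N, ρ g m ∈ N) : Representation k (GLInf k) N where
  toFun g := (ρ g).restrict (p := N.restrictScalars k) (q := N.restrictScalars k) (hN g)
  map_one' := by
    ext x
    exact LinearMap.congr_fun (map_one ρ) (x : M)
  map_mul' g h := by
    ext x
    exact LinearMap.congr_fun (map_mul ρ g h) (x : M)

/-- An embedding of a stable `R`-lattice into a free module extends to the `K`-vector space it
spans, where `K` is the fraction field of `R`. -/
lemma EmbedsInFree.of_lattice (hβ : ∀ g r, β g (algebraMap R K r) = algebraMap R K (α g r))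
    (hρ : IsSemilinear β ρ) (N : Submodule R M) (hN : ∀ g, ∀ m ∈ N, ρ g m ∈ N)
    (hspan : ∀ m : M, ∃ r : R, r ≠ 0 ∧ r • m ∈ N)
    (h : EmbedsInFree α (restrictRep ρ N hN)) : EmbedsInFree β ρ := by
  obtain ⟨r, l, j, hj, hjρ⟩ := h
  let S := nonZeroDivisors R
  have hunit : ∀ s : S, IsUnit (algebraMap R (Module.End R M) s) := fun s => by
    rw [← (Algebra.lsmul R R M : K →ₐ[R] Module.End R M).commutes]
    exact (IsLocalization.map_units K s).map _
  have hunit' : ∀ s : S, IsUnit (algebraMap R (Module.End R (K ⊗[k] TupleSpace k l)) s) :=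
    fun s => by
      rw [← (Algebra.lsmul R R (K ⊗[k] TupleSpace k l) : K →ₐ[R] Module.End R _).commutes]
      exact (IsLocalization.map_units K s).map _
  have hloc : IsLocalizedModule S N.subtype :=
    { map_units := hunit
      surj := fun m => by
        obtain ⟨r, hr, hm⟩ := hspan m
        exact ⟨⟨⟨r • m, hm⟩, ⟨r, mem_nonZeroDivisors_of_ne_zero hr⟩⟩, rfl⟩
      exists_of_eq := fun {x y} h => ⟨1, by rw [Subtype.ext h]⟩ }
  -- the inclusion of the free `R`-module in the free `K`-module
  let θ : R ⊗[k] TupleSpace k l →ₗ[R] K ⊗[k] TupleSpace k l :=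
    TensorProduct.AlgebraTensorModule.map (Algebra.linearMap R K) LinearMap.id
  have hθ : Function.Injective θ :=
    Module.Flat.rTensor_preserves_injective_linearMap (M := TupleSpace k l)
      ((Algebra.linearMap R K).restrictScalars k) (IsFractionRing.injective R K)
  have hθρ : ∀ g x, θ (freeRep α l g x) = freeRep β l g (θ x) := by
    intro g x
    induction x using TensorProduct.induction_on with
    | zero => simp only [map_zero]
    | tmul a w =>
      change algebraMap R K (α g a) ⊗ₜ[k] _ = β g (algebraMap R K a) ⊗ₜ[k] _
      rw [hβ]
      rfl
    | add x y hx hy => simp only [map_add, hx, hy]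
  let J₀ : M →ₗ[R] K ⊗[k] TupleSpace k l := IsLocalizedModule.lift S N.subtype (θ ∘ₗ j) hunit'
  have hJ₀ : ∀ x : N, J₀ x = θ (j x) := fun x =>
    IsLocalizedModule.lift_apply S N.subtype (θ ∘ₗ j) hunit' x
  let J : M →ₗ[K] K ⊗[k] TupleSpace k l := J₀.extendScalarsOfIsLocalization S K
  have hJ : ∀ (a : R) (m : M) (h : a • m ∈ N), algebraMap R K a • J m = θ (j ⟨a • m, h⟩) := by
    intro a m h
    rw [← map_smul, algebraMap_smul]
    exact hJ₀ ⟨a • m, h⟩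
  refine ⟨r, l, J, (injective_iff_map_eq_zero J).2 fun m hm => ?_, fun g m => ?_⟩
  · obtain ⟨a, ha, ham⟩ := hspan m
    have h1 := hJ a m ham
    rw [hm, smul_zero] at h1
    have h2 : j ⟨a • m, ham⟩ = 0 := hθ (by rw [← h1, map_zero])
    have h3 : a • m = 0 := congrArg Subtype.val (hj (h2.trans (map_zero j).symm))
    rw [← algebraMap_smul K a m] at h3
    exact (smul_eq_zero.1 h3).resolve_left ((map_ne_zero_iff _ (IsFractionRing.injective R K)).2 ha)
  · obtain ⟨a, ha, ham⟩ := hspan m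
    have ha' : algebraMap R K (α g a) ≠ 0 :=
      (map_ne_zero_iff _ (IsFractionRing.injective R K)).2 ((map_ne_zero_iff _ (α g).injective).2 ha)
    have h1 : α g a • ρ g m = ρ g (a • m) := by
      rw [← algebraMap_smul K (α g a), ← hβ, ← hρ, algebraMap_smul]
    have h2 : α g a • ρ g m ∈ N := h1 ▸ hN g _ ham
    have hsemi : ∀ (b : K) x, freeRep β l g (b • x) = β g b • freeRep β l g x := fun b x =>
      semiRep_smul β _ g b x
    refine smul_right_injective _ ha' ?_
    change algebraMap R K (α g a) • J (ρ g m) = algebraMap R K (α g a) • freeRep β l g (J m)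
    rw [hJ _ _ h2, ← hβ, ← hsemi, hJ a m ham, ← hθρ, ← hjρ]
    congr 2
    exact Subtype.ext h1

end Localization

section Applications

variable [CharZero k] {r : ℕ} (s : Fin r → YoungDiagram)

lemma isDomain_polyRing (A : Type v) [CommRing A] [IsDomain A] [Algebra k A] :
    IsDomain (PolyRing (k := k) A s) := by
  let b := Basis.ofVectorSpace k (TupleSpace k s)
  let e : PolyRing (k := k) A s ≃+* MvPolynomial _ A :=
    (Algebra.TensorProduct.congr (AlgEquiv.refl (R := k) (A₁ := A))
      (SymmetricAlgebra.equivMvPolynomial b)).toRingEquiv.trans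
      (MvPolynomial.algebraTensorAlgEquiv k A).toRingEquiv
  exact e.toMulEquiv.isDomain _

instance isDomain_symmetricAlgebra : IsDomain (SymmetricAlgebra k (TupleSpace k s)) :=
  (SymmetricAlgebra.equivMvPolynomial
    (Basis.ofVectorSpace k (TupleSpace k s))).toMulEquiv.isDomain _

lemma polyRingAction_tmul (A : Type v) [CommRing A] [Algebra k A] (g : GLInf k) (a : A)
    (x : SymmetricAlgebra k (TupleSpace k s)) :
    polyRingAction (k := k) A s g (a ⊗ₜ[k] x) = a ⊗ₜ[k] symAction (tupleRep k s) g x := rfl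

theorem embedsInFree_of_isGLModule (A : Type v) [CommRing A] [IsDomain A] [Algebra k A]
    {M : Type w} [AddCommGroup M] [Module k M] [Module (PolyRing (k := k) A s) M]
    [IsScalarTower k (PolyRing (k := k) A s) M] {ρ : Representation k (GLInf k) M}
    (hρ : IsGLModule (polyRingAction A s) ρ)
    (hM : IsFinitelyGLGenerated (PolyRing (k := k) A s) ρ)
    [Module.IsTorsionFree (PolyRing (k := k) A s) M] :
    EmbedsInFree (polyRingAction A s) ρ := by
  have := isDomain_polyRing (k := k) s A
  obtain ⟨G, hG⟩ := hM
  exact embedsInFree_of_generators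
    ((isAlgebraicAction_symAction s).baseChange (polyRingAction_tmul s A))
    ((isShiftable_symAction s).baseChange (polyRingAction_tmul s A)) hρ.semilinear G
    (fun m _ => hρ.polynomial.mem_equivariantSpan m) hG

lemma ratFieldAction_algebraMap (g : GLInf k) (x : SymmetricAlgebra k (TupleSpace k s)) :
    ratFieldAction k s g (algebraMap _ (RatField k s) x) =
      algebraMap _ (RatField k s) (symAction (tupleRep k s) g x) :=
  IsFractionRing.fieldEquivOfAlgEquiv_algebraMap _ _ _ _ _

/-- The module is spanned by the lattice over `Sym(k^{⊕σ})` that the polynomial parts of the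
generators generate, and the embedding of the lattice extends. -/
theorem embedsInFree_of_isGLFieldModule
    {M : Type w} [AddCommGroup M] [Module k M] [Module (RatField k s) M]
    [IsScalarTower k (RatField k s) M] {ρ : Representation k (GLInf k) M}
    (hρ : IsGLFieldModule (ratFieldAction k s) ρ)
    (hM : IsFinitelyGLGenerated (RatField k s) ρ) :
    EmbedsInFree (ratFieldAction k s) ρ := by
  classical
  let R := SymmetricAlgebra k (TupleSpace k s)
  let K := RatField k s
  let α := symAction (tupleRep k s)
  let _ : Module R M := Module.compHom M (algebraMap R K)
  have : IsScalarTower R K M := ⟨fun a b m => by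
    change (a • b) • m = algebraMap R K a • b • m
    rw [Algebra.smul_def, mul_smul]⟩
  have : IsScalarTower k R M := ⟨fun c a m => by
    change algebraMap R K (c • a) • m = c • algebraMap R K a • m
    rw [← smul_assoc c (algebraMap R K a) m]
    exact congrArg (· • m) (map_smul (IsScalarTower.toAlgHom k R K) c a)⟩
  have hR : ∀ (g : GLInf k) (a : R) (m : M), ρ g (a • m) = α g a • ρ g m := fun g a m => by
    rw [← algebraMap_smul K a m, hρ.semilinear, ratFieldAction_algebraMap, algebraMap_smul]
  obtain ⟨S, hS⟩ := hM
  choose c x hx hcx using hρ.polynomial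
  -- the lattice generated by the orbits of the polynomial parts of the generators
  let N : Submodule R M := Submodule.span R {y : M | ∃ g, ∃ m ∈ S, y = ρ g (x m)}
  have hgen : ∀ g, ∀ m ∈ S, ρ g (x m) ∈ N := fun g m hm => Submodule.subset_span ⟨g, m, hm, rfl⟩
  have hN : ∀ g, ∀ m ∈ N, ρ g m ∈ N := by
    intro g m hm
    refine span_stable (α := α) hR g ?_ hm
    rintro _ ⟨h, m, hm, rfl⟩
    rw [← Module.End.mul_apply, ← map_mul]
    exact hgen _ m hm
  have hspan : ∀ m : M, ∃ a : R, a ≠ 0 ∧ a • m ∈ N := by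
    intro m
    have hm : m ∈ Submodule.span K {y : M | ∃ g, ∃ m ∈ S, y = ρ g m} := hS ▸ Submodule.mem_top
    have hscale : ∀ (b : K) (m : M), (∃ a : R, a ≠ 0 ∧ a • m ∈ N) →
        ∃ a : R, a ≠ 0 ∧ a • b • m ∈ N := by
      rintro b m ⟨a, ha, ham⟩
      obtain ⟨p, q, hq, rfl⟩ := IsFractionRing.div_surjective (A := R) b
      refine ⟨a * q, mul_ne_zero ha (nonZeroDivisors.ne_zero hq), ?_⟩
      have hq' : algebraMap R K q ≠ 0 :=
        (map_ne_zero_iff _ (IsFractionRing.injective R K)).2 (nonZeroDivisors.ne_zero hq)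
      have : (a * q) • (algebraMap R K p / algebraMap R K q) • m = p • a • m := by
        rw [← algebraMap_smul K (a * q), ← algebraMap_smul K p, ← algebraMap_smul K a,
          smul_smul, smul_smul, map_mul]
        congr 1
        rw [mul_assoc, mul_div_cancel₀ _ hq', mul_comm]
      rw [this]
      exact N.smul_mem p ham
    induction hm using Submodule.span_induction with
    | mem y hy =>
      obtain ⟨g, m, hm, rfl⟩ := hy
      rw [hcx m, hρ.semilinear]
      exact hscale _ _ ⟨1, one_ne_zero, by rw [one_smul]; exact hgen g m hm⟩
    | zero => exact ⟨1, one_ne_zero, by rw [smul_zero]; exact N.zero_mem⟩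
    | add y z _ _ hy hz =>
      obtain ⟨a, ha, hay⟩ := hy
      obtain ⟨b, hb, hbz⟩ := hz
      refine ⟨a * b, mul_ne_zero ha hb, ?_⟩
      rw [smul_add]
      exact N.add_mem (by rw [mul_comm, mul_smul]; exact N.smul_mem _ hay)
        (by rw [mul_smul]; exact N.smul_mem _ hbz)
    | smul b y _ hy => exact hscale b y hy
  have : Module.IsTorsionFree R M := Module.IsTorsionFree.trans_faithfulSMul R K M
  refine EmbedsInFree.of_lattice (α := α) (ratFieldAction_algebraMap s) hρ.semilinear N hN hspan ?_
  let x' : S → N := fun m => ⟨x m, by simpa using hgen 1 m m.2⟩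
  refine embedsInFree_of_generators (isAlgebraicAction_symAction s) (isShiftable_symAction s)
    (fun g a m => Subtype.ext (hR g a m)) (Finset.univ.image x') (fun m hm => ?_) ?_
  · obtain ⟨m, -, rfl⟩ := Finset.mem_image.1 hm
    have hle : (orbitSpan ρ (x m)).toSubmodule ≤ N.restrictScalars k :=
      Submodule.span_le.2 fun _ ⟨g, hg⟩ => hg ▸ hgen g m m.2
    exact IsPolynomialElement.map_mem_equivariantSpan (π' := restrictRep ρ N hN) (hx m)
      (Submodule.inclusion hle) fun _ _ => rfl
  · have hinj := Submodule.map_injective_of_injective (f := N.subtype) N.injective_subtype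
    apply hinj
    rw [Submodule.map_span, Submodule.map_top, Submodule.range_subtype]
    congr 1
    ext y
    constructor
    · rintro ⟨_, ⟨g, _, hz, rfl⟩, rfl⟩
      obtain ⟨m, -, rfl⟩ := Finset.mem_image.1 hz
      exact ⟨g, m, m.2, rfl⟩
    · rintro ⟨g, m, hm, rfl⟩
      exact ⟨restrictRep ρ N hN g (x' ⟨m, hm⟩),
        ⟨g, _, Finset.mem_image_of_mem _ (Finset.mem_univ _), rfl⟩, rfl⟩

end Applications

end GLEmbed

end

theorem theorem3p9 (k : Type*) [Field k] [CharZero k] :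
    (∀ (A : Type*) [CommRing A] [IsDomain A] [Algebra k A]
        (n : ℕ) (s : Fin n → YoungDiagram)
        (M : Type*) [AddCommGroup M] [Module k M] [Module (GLEmbed.PolyRing (k := k) A s) M]
        [IsScalarTower k (GLEmbed.PolyRing (k := k) A s) M]
        (ρ : Representation k (GLEmbed.GLInf k) M),
        GLEmbed.IsGLModule (GLEmbed.polyRingAction A s) ρ →
        GLEmbed.IsFinitelyGLGenerated (GLEmbed.PolyRing (k := k) A s) ρ →
        Module.IsTorsionFree (GLEmbed.PolyRing (k := k) A s) M →
        GLEmbed.EmbedsInFree (GLEmbed.polyRingAction A s) ρ) ∧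
    (∀ (n : ℕ) (s : Fin n → YoungDiagram)
        (M : Type*) [AddCommGroup M] [Module k M] [Module (GLEmbed.RatField k s) M]
        [IsScalarTower k (GLEmbed.RatField k s) M]
        (ρ : Representation k (GLEmbed.GLInf k) M),
        GLEmbed.IsGLFieldModule (GLEmbed.ratFieldAction k s) ρ →
        GLEmbed.IsFinitelyGLGenerated (GLEmbed.RatField k s) ρ →
        GLEmbed.EmbedsInFree (GLEmbed.ratFieldAction k s) ρ) := by
  refine ⟨fun A _ _ _ n s M _ _ _ _ ρ hρ hM _ => ?_, fun n s M _ _ _ _ ρ hρ hM => ?_⟩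
  · exact GLEmbed.embedsInFree_of_isGLModule s A hρ hM
  · exact GLEmbed.embedsInFree_of_isGLFieldModule s hρ hM
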